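/- All Hilbert spaces are finite dimensional, logarithms are in base $2$, and entropic quantities take values in $[-\infty,+\infty]$. A state (resp. substate) on $\mathcal H$ is an operator $\rho\ge 0$ with $\operatorname{tr}\rho=1$ (resp. $\operatorname{tr}\rho\le 1$). **Relative entropies.** For a substate $\rho$ and $\sigma\ge 0$ put $$D_\alpha(\rho\|\sigma)=\tfrac{1}{\alpha-1}\log\operatorname{tr}\big[(\sigma^{\frac{1-\alpha}{2\alpha}}\rho\,\sigma^{\frac{1-\alpha}{2\alpha}})^\alpha\big]\quad(\alpha\in[\tfrac12,1)\cup(1,\infty)),$$ $D_1(\rho\|\sigma)=\operatorname{tr}(\rho\log\rho-\rho\log\sigma)$, $D_\infty(\rho\|\sigma)=D_{\max}(\rho\|\sigma)=\log\inf\{\lambda>0:\rho\le\lambda\sigma\}$ and $D_{\min}=D_{1/2}$. Powers and logarithms are taken on the support, and for $\alpha\ge 1$ the value is $+\infty$ unless $\operatorname{supp}\rho\le\operatorname{supp}\sigma$. **Smoothing.** For substates write $\rho'\sim^\varepsilon\rho$ if $\sqrt{1-F(\rho',\rho)^2}\le\varepsilon$, where $F(\rho',\rho)=\operatorname{tr}|\sqrt{\rho'}\sqrt\rho|+\sqrt{(1-\operatorname{tr}\rho')(1-\operatorname{tr}\rho)}$.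 **Subalgebra entropies.** For a unital $*$-subalgebra $\mathcal N\subseteq B(\mathcal H)$ let $\mathbb D(\rho\|\mathcal N)=\inf_\sigma\mathbb D(\rho\|\sigma)$ over all states $\sigma\in\mathcal N$, for $\mathbb D=D_\alpha,D_{\max},D_{\min}$, and let $$D_{\max}^\varepsilon(\rho\|\mathcal N)=\inf_{\rho'\sim^\varepsilon\rho}D_{\max}(\rho'\|\mathcal N),\qquad D_{\min}^\varepsilon(\rho\|\mathcal N)=\sup_{\rho'\sim^\varepsilon\rho}D_{\min}(\rho'\|\mathcal N),$$ with $\rho'$ ranging over substates. **Conditional entropies.** For a substate $\rho$ on $\mathcal H_X\otimes\mathcal H_Y$, with $\sigma$ ranging over states on $\mathcal H_Y$ and $\rho'$ over substates on $\mathcal H_X\otimes\mathcal H_Y$, let $$H_{\min}(X|Y)_\rho=-\inf_\sigma D_{\max}(\rho\|1_X\otimes\sigma),\qquad H_{\max}(X|Y)_\rho=-\inf_\sigma D_{\min}(\rho\|1_X\otimes\sigma),$$ $$H_{\min}^\varepsilon(X|Y)_\rho=\sup_{\rho'\sim^\varepsilon\rho}H_{\min}(X|Y)_{\rho'},\qquad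 H_{\max}^\varepsilon(X|Y)_\rho=\inf_{\rho'\sim^\varepsilon\rho}H_{\max}(X|Y)_{\rho'},$$ and $H_\alpha(X|Y)_\rho=\sup_\sigma-D_\alpha(\rho\|1_X\otimes\sigma)$ for $\alpha\in[\frac12,\infty]$, $\alpha\ne1$, while $H_1(X|Y)_\rho=-\operatorname{tr}(\rho\log\rho)+\operatorname{tr}(\rho_Y\log\rho_Y)$ with $\rho_Y=\operatorname{tr}_X\rho$. For a state on a larger tensor product these are evaluated on its marginal on $XY$. **Statement.** Let $\mathcal N\subseteq B(\mathcal H_A)$ be a unital $*$-subalgebra and $\mathcal E:B(\mathcal H_A)\to\mathcal N$ the trace preserving conditional expectation, i.e. the unique linear map into $\mathcal N$ with $\operatorname{tr}(xy)=\operatorname{tr}(x\mathcal E(y))$ for all $x\in\mathcal N$, $y\in B(\mathcal H_A)$. Let $V:\mathcal H_A\to\mathcal H_A\otimes\mathcal H_E$ be an isometry with $\mathcal E(x)=\operatorname{tr}_E(VxV^*)$ for all $x$. Let $\rho$ be a state on $\mathcal H_A$ and let $|\psi\rangle\in\mathcal H_A\otimes\mathcal H_F$ be a purification of $\rho$, i.e.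 $\operatorname{tr}_F|\psi\rangle\langle\psi|=\rho$. Put $\xi_{EAF}=(V\otimes1_F)|\psi\rangle\langle\psi|(V\otimes1_F)^*$. Then $\xi$ is a purification of $V\rho V^*$ (it has the form $|\phi\rangle\langle\phi|$, and $\operatorname{tr}_F\xi=V\rho V^*$). For every $\varepsilon\in[0,1)$, $$D_{\max}^\varepsilon(\rho\|\mathcal N)=-H_{\min}^\varepsilon(E|A)_\xi=H_{\max}^\varepsilon(E|F)_\xi,$$ $$D_{\min}^\varepsilon(\rho\|\mathcal N)=-H_{\max}^\varepsilon(E|A)_\xi=H_{\min}^\varepsilon(E|F)_\xi,$$ and for all $\alpha\in[\frac12,\infty]$ and $\beta$ with $\frac1\alpha+\frac1\beta=2$ (where $\frac1\infty=0$), $$D_\alpha(\rho\|\mathcal N)=-H_\alpha(E|A)_\xi=H_\beta(E|F)_\xi.$$ -/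

import Mathlib

open scoped Kronecker ENNReal ComplexOrder

namespace SubalgebraEntropy

noncomputable section

/-! ### States, substates, partial traces

The finite dimensional Hilbert space `ℂ^x` is represented by a finite index type `x`, operators on
it by `Matrix x x ℂ`, and tensor products by product index types and the Kronecker product. -/

/-- A state: a positive semidefinite operator of trace one. -/
def IsState {x : Type*} [Fintype x] (ρ : Matrix x x ℂ) : Prop :=
  ρ.PosSemidef ∧ ρ.trace = 1

/-- A substate: a positive semidefinite operator of trace at most one. -/
def IsSubstate {x : Type*} [Fintype x] (ρ : Matrix x x ℂ) : Prop :=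
  ρ.PosSemidef ∧ ρ.trace.re ≤ 1

/-- The partial trace over the second tensor factor. -/
def traceSnd {x y : Type*} [Fintype y] (ρ : Matrix (x × y) (x × y) ℂ) : Matrix x x ℂ :=
  Matrix.of fun i i' => ∑ j, ρ (i, j) (i', j)

/-- The partial trace over the first tensor factor. -/
def traceFst {x y : Type*} [Fintype x] (ρ : Matrix (x × y) (x × y) ℂ) : Matrix y y ℂ :=
  Matrix.of fun j j' => ∑ i, ρ (i, j) (i, j')

/-- The rank one operator `|φ⟩⟨φ|`. -/
def ketBra {x : Type*} (φ : x → ℂ) : Matrix x x ℂ :=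
  Matrix.vecMulVec φ (star φ)

/-- `ξ` (on `ℂ^x ⊗ ℂ^y`) is a purification of `ω` (on `ℂ^x`): it is of the form `|φ⟩⟨φ|` and its
marginal on the first factor is `ω`. -/
def IsPurification {x y : Type*} [Fintype y] (ξ : Matrix (x × y) (x × y) ℂ)
    (ω : Matrix x x ℂ) : Prop :=
  (∃ φ : x × y → ℂ, ξ = ketBra φ) ∧ traceSnd ξ = ω

/-! ### Relative entropies (base `2`, values in the extended reals) -/

/-- Logarithm in base `2`, with `log2 0 = -∞` and `log2 ∞ = +∞`. -/
def log2 (t : ℝ≥0∞) : EReal := ENNReal.log t / ((Real.log 2 : ℝ) : EReal)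

/-- `supp ρ ≤ supp σ`; the support of a positive semidefinite operator is its range. -/
def SuppLE {x : Type*} [Fintype x] (ρ σ : Matrix x x ℂ) : Prop :=
  LinearMap.range ρ.mulVecLin ≤ LinearMap.range σ.mulVecLin

/-- The real power `σ ^ s` of a positive semidefinite operator, taken on its support when
`s ≠ 0`: the function `t ↦ t ^ s` is applied to the eigenvalues, with value `0` at `t = 0`. -/
def matPow {x : Type*} [Fintype x] [DecidableEq x] (σ : Matrix x x ℂ) (s : ℝ) : Matrix x x ℂ :=
  cfc (fun t : ℝ => t ^ s) σ

/-- The binary logarithm of a positive semidefinite operator, taken on its support. -/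
def matLog {x : Type*} [Fintype x] [DecidableEq x] (σ : Matrix x x ℂ) : Matrix x x ℂ :=
  cfc (fun t : ℝ => Real.logb 2 t) σ

/-- The trace norm `tr |X| = tr (X^* X)^{1/2}`. -/
def traceNorm {x : Type*} [Fintype x] [DecidableEq x] (X : Matrix x x ℂ) : ℝ :=
  (matPow (X.conjTranspose * X) (1 / 2)).trace.re

/-- Relative entropy `D(ρ‖σ) = tr (ρ log ρ - ρ log σ)`, and `+∞` unless `supp ρ ≤ supp σ`. -/
def relEntropy {x : Type*} [Fintype x] [DecidableEq x] (ρ σ : Matrix x x ℂ) : EReal :=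
  open Classical in
  if SuppLE ρ σ then (((ρ * matLog ρ - ρ * matLog σ).trace.re : ℝ) : EReal) else ⊤

/-- Max-relative entropy `log inf {c > 0 | ρ ≤ c σ}`; it is `+∞` if there is no such `c`. -/
def Dmax {x : Type*} [Fintype x] (ρ σ : Matrix x x ℂ) : EReal :=
  log2 (⨅ (c : ℝ) (_ : 0 < c ∧ (c • σ - ρ).PosSemidef), ENNReal.ofReal c)

/-- Sandwiched Rényi relative entropy for a real parameter `α ≠ 1`,
`D_α(ρ‖σ) = (α - 1)⁻¹ log tr (σ^{(1-α)/2α} ρ σ^{(1-α)/2α})^α`, and `+∞` if `α > 1` and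
`supp ρ ≤ supp σ` fails. -/
def sandwiched {x : Type*} [Fintype x] [DecidableEq x] (α : ℝ) (ρ σ : Matrix x x ℂ) : EReal :=
  open Classical in
  if 1 < α ∧ ¬ SuppLE ρ σ then ⊤ else
    (((α - 1)⁻¹ : ℝ) : EReal) *
      log2 (ENNReal.ofReal (matPow (matPow σ ((1 - α) / (2 * α)) * ρ *
        matPow σ ((1 - α) / (2 * α))) α).trace.re)

/-- `D_α(ρ‖σ)` for `α ∈ [1/2, ∞]`: the sandwiched Rényi relative entropy, with the
relative entropy at `α = 1` and the max-relative entropy at `α = ∞`. -/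
def Dalpha {x : Type*} [Fintype x] [DecidableEq x] (α : ℝ≥0∞) (ρ σ : Matrix x x ℂ) : EReal :=
  if α = ⊤ then Dmax ρ σ
  else if α = 1 then relEntropy ρ σ
  else sandwiched α.toReal ρ σ

/-- Min-relative entropy `D_min = D_{1/2}`. -/
def Dmin {x : Type*} [Fintype x] [DecidableEq x] (ρ σ : Matrix x x ℂ) : EReal :=
  sandwiched (1 / 2) ρ σ

/-! ### Purified distance -/

/-- Generalized fidelity `tr |√ρ √σ| + √((1 - tr ρ)(1 - tr σ))` of two substates. -/
def genFidelity {x : Type*} [Fintype x] [DecidableEq x] (ρ σ : Matrix x x ℂ) : ℝ :=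
  traceNorm (matPow ρ (1 / 2) * matPow σ (1 / 2)) +
    Real.sqrt ((1 - ρ.trace.re) * (1 - σ.trace.re))

/-- Purified distance `√(1 - F²)`. -/
def purifiedDist {x : Type*} [Fintype x] [DecidableEq x] (ρ σ : Matrix x x ℂ) : ℝ :=
  Real.sqrt (1 - genFidelity ρ σ ^ 2)

/-- `ρ'` is a substate that is `ε`-close to `ρ` in purified distance. -/
def IsClose {x : Type*} [Fintype x] [DecidableEq x] (ε : ℝ) (ρ' ρ : Matrix x x ℂ) : Prop :=
  IsSubstate ρ' ∧ purifiedDist ρ' ρ ≤ ε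

/-! ### Subalgebra entropies -/

/-- The infimum of `D(ρ‖σ)` over the state space `S(N)`, for a relative entropy `D`. -/
def infState {x : Type*} [Fintype x] [DecidableEq x]
    (D : Matrix x x ℂ → Matrix x x ℂ → EReal) (ρ : Matrix x x ℂ)
    (N : StarSubalgebra ℂ (Matrix x x ℂ)) : EReal :=
  ⨅ (σ : Matrix x x ℂ) (_ : IsState σ ∧ σ ∈ N), D ρ σ

/-- `D_α(ρ‖N)`. -/
def DalphaSub {x : Type*} [Fintype x] [DecidableEq x] (α : ℝ≥0∞) (ρ : Matrix x x ℂ)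
    (N : StarSubalgebra ℂ (Matrix x x ℂ)) : EReal :=
  infState (Dalpha α) ρ N

/-- `D_max^ε(ρ‖N)`. -/
def DmaxSub {x : Type*} [Fintype x] [DecidableEq x] (ε : ℝ) (ρ : Matrix x x ℂ)
    (N : StarSubalgebra ℂ (Matrix x x ℂ)) : EReal :=
  ⨅ (ρ' : Matrix x x ℂ) (_ : IsClose ε ρ' ρ), infState Dmax ρ' N

/-- `D_min^ε(ρ‖N)`. -/
def DminSub {x : Type*} [Fintype x] [DecidableEq x] (ε : ℝ) (ρ : Matrix x x ℂ)
    (N : StarSubalgebra ℂ (Matrix x x ℂ)) : EReal :=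
  ⨆ (ρ' : Matrix x x ℂ) (_ : IsClose ε ρ' ρ), infState Dmin ρ' N

/-! ### Conditional entropies of a bipartite operator on `ℂ^x ⊗ ℂ^y`, conditioned on `y` -/

/-- `H_min(X|Y)_ρ = - inf_σ D_max(ρ‖1 ⊗ σ)`, the infimum over states `σ` of `Y`. -/
def Hmin {x y : Type*} [Fintype x] [DecidableEq x] [Fintype y]
    (ρ : Matrix (x × y) (x × y) ℂ) : EReal :=
  -⨅ (σ : Matrix y y ℂ) (_ : IsState σ), Dmax ρ ((1 : Matrix x x ℂ) ⊗ₖ σ)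

/-- `H_max(X|Y)_ρ = - inf_σ D_min(ρ‖1 ⊗ σ)`, the infimum over states `σ` of `Y`. -/
def Hmax {x y : Type*} [Fintype x] [DecidableEq x] [Fintype y] [DecidableEq y]
    (ρ : Matrix (x × y) (x × y) ℂ) : EReal :=
  -⨅ (σ : Matrix y y ℂ) (_ : IsState σ), Dmin ρ ((1 : Matrix x x ℂ) ⊗ₖ σ)

/-- Smooth conditional min-entropy `H_min^ε(X|Y)_ρ`. -/
def HminSmooth {x y : Type*} [Fintype x] [DecidableEq x] [Fintype y] [DecidableEq y] (ε : ℝ)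
    (ρ : Matrix (x × y) (x × y) ℂ) : EReal :=
  ⨆ (ρ' : Matrix (x × y) (x × y) ℂ) (_ : IsClose ε ρ' ρ), Hmin ρ'

/-- Smooth conditional max-entropy `H_max^ε(X|Y)_ρ`. -/
def HmaxSmooth {x y : Type*} [Fintype x] [DecidableEq x] [Fintype y] [DecidableEq y] (ε : ℝ)
    (ρ : Matrix (x × y) (x × y) ℂ) : EReal :=
  ⨅ (ρ' : Matrix (x × y) (x × y) ℂ) (_ : IsClose ε ρ' ρ), Hmax ρ'

/-- Von Neumann entropy `- tr (ρ log ρ)`. -/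
def vnEntropy {x : Type*} [Fintype x] [DecidableEq x] (ρ : Matrix x x ℂ) : ℝ :=
  -(ρ * matLog ρ).trace.re

/-- Sandwiched Rényi conditional entropy `H_α(X|Y)_ρ = sup_σ - D_α(ρ‖1 ⊗ σ)` for
`α ∈ [1/2, ∞]`, with the von Neumann conditional entropy `H(XY) - H(Y)` at `α = 1`. -/
def Halpha {x y : Type*} [Fintype x] [DecidableEq x] [Fintype y] [DecidableEq y] (α : ℝ≥0∞)
    (ρ : Matrix (x × y) (x × y) ℂ) : EReal :=
  if α = 1 then ((vnEntropy ρ - vnEntropy (traceFst ρ) : ℝ) : EReal)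
  else ⨆ (σ : Matrix y y ℂ) (_ : IsState σ), -Dalpha α ρ ((1 : Matrix x x ℂ) ⊗ₖ σ)

/-! ### The trace preserving conditional expectation -/

/-- For a unital `*`-subalgebra `N` there is exactly one linear map `𝓔` into `N` with
`tr (x y) = tr (x 𝓔(y))` for all `x ∈ N` and all `y`. -/
theorem existsUnique_condExp {a : Type*} [Fintype a] [DecidableEq a]
    (N : StarSubalgebra ℂ (Matrix a a ℂ)) :
    ∃! 𝓔 : Matrix a a ℂ →ₗ[ℂ] Matrix a a ℂ, (∀ y, 𝓔 y ∈ N) ∧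
      ∀ x ∈ N, ∀ y, (x * y).trace = (x * 𝓔 y).trace := by
  have key : ∀ z ∈ N, (∀ x ∈ N, (x * z).trace = 0) → z = 0 := by
    intro z hz h
    have h1 := h (star z) (star_mem hz)
    rw [Matrix.star_eq_conjTranspose] at h1
    exact Matrix.trace_conjTranspose_mul_self_eq_zero_iff.mp h1
  let M : Submodule ℂ (Matrix a a ℂ) := Subalgebra.toSubmodule N.toSubalgebra
  have hM : ∀ z, z ∈ M ↔ z ∈ N := fun z => Iff.rfl
  let B : Matrix a a ℂ →ₗ[ℂ] Module.Dual ℂ M :=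
    LinearMap.mk₂ ℂ (fun (y : Matrix a a ℂ) (x : M) => ((x : Matrix a a ℂ) * y).trace)
      (by intros; simp [Matrix.mul_add]) (by intros; simp)
      (by intros; simp [Matrix.add_mul]) (by intros; simp)
  have hB : ∀ y (x : M), B y x = ((x : Matrix a a ℂ) * y).trace := fun _ _ => rfl
  let φ : M →ₗ[ℂ] Module.Dual ℂ M := B ∘ₗ M.subtype
  have hinj : Function.Injective φ := by
    rw [injective_iff_map_eq_zero]
    intro z hz
    refine Subtype.ext (key z z.2 fun x hx => ?_)
    have := congrArg (fun f : Module.Dual ℂ M => f ⟨x, hx⟩) hz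
    simpa [φ, hB] using this
  let e : M ≃ₗ[ℂ] Module.Dual ℂ M :=
    LinearEquiv.ofInjectiveOfFinrankEq φ hinj Subspace.dual_finrank_eq.symm
  have he : ∀ z, e z = φ z := fun z => rfl
  refine ⟨M.subtype ∘ₗ e.symm.toLinearMap ∘ₗ B, ⟨fun y => (e.symm (B y)).2, ?_⟩, ?_⟩
  · intro x hx y
    have h1 : φ (e.symm (B y)) = B y := by rw [← he]; simp
    have h2 := congrArg (fun f : Module.Dual ℂ M => f ⟨x, hx⟩) h1
    simpa [φ, hB] using h2.symm
  · rintro 𝓕 ⟨h1, h2⟩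
    ext1 y
    have h3 : e ⟨𝓕 y, h1 y⟩ = B y := by
      rw [he]
      ext x
      simpa [φ, hB] using (h2 x x.2 y).symm
    have h4 : e.symm (B y) = ⟨𝓕 y, h1 y⟩ := by rw [← h3]; simp
    simp [h4]

/-- The trace preserving conditional expectation onto `N`. -/
def condExp {a : Type*} [Fintype a] [DecidableEq a] (N : StarSubalgebra ℂ (Matrix a a ℂ)) :
    Matrix a a ℂ →ₗ[ℂ] Matrix a a ℂ :=
  (existsUnique_condExp N).choose

/-- `V : ℂ^a → ℂ^a ⊗ ℂ^e` is a Stinespring dilation isometry of the conditional expectation onto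
`N`: `V^* V = 1` and `𝓔(x) = tr_E (V x V^*)`. -/
def IsStinespring {a e : Type*} [Fintype a] [DecidableEq a] [Fintype e]
    (N : StarSubalgebra ℂ (Matrix a a ℂ)) (V : Matrix (a × e) a ℂ) : Prop :=
  V.conjTranspose * V = 1 ∧ ∀ X, condExp N X = traceSnd (V * X * V.conjTranspose)

/-! ### The tripartite pure state and its marginals -/

/-- `ξ = (V ⊗ 1_F) |ψ⟩⟨ψ| (V ⊗ 1_F)^*` for `V : ℂ^a → ℂ^a ⊗ ℂ^e` and `ψ ∈ ℂ^a ⊗ ℂ^f`. -/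
def dilatedState {a e f : Type*} [Fintype a] [Fintype f] [DecidableEq f]
    (V : Matrix (a × e) a ℂ) (ψ : a × f → ℂ) : Matrix ((a × e) × f) ((a × e) × f) ℂ :=
  (V ⊗ₖ (1 : Matrix f f ℂ)) * ketBra ψ * (V ⊗ₖ (1 : Matrix f f ℂ)).conjTranspose

/-- The marginal `ξ_EA`, with the factors ordered as `E ⊗ A`. -/
def marginalEA {a e f : Type*} [Fintype f]
    (ξ : Matrix ((a × e) × f) ((a × e) × f) ℂ) : Matrix (e × a) (e × a) ℂ :=
  (traceSnd ξ).submatrix Prod.swap Prod.swap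

/-- The marginal `ξ_EF`, on `E ⊗ F`. -/
def marginalEF {a e f : Type*} [Fintype a]
    (ξ : Matrix ((a × e) × f) ((a × e) × f) ℂ) : Matrix (e × f) (e × f) ℂ :=
  traceFst (ξ.submatrix (Equiv.prodAssoc a e f).symm (Equiv.prodAssoc a e f).symm)

end

end SubalgebraEntropy

open SubalgebraEntropy

namespace SubalgebraEntropy

open scoped MatrixOrder Matrix.Norms.L2Operator
open Matrix Filter Topology

set_option linter.unusedSectionVars false

variable {w x y z : Type*} [Fintype w] [DecidableEq w] [Fintype x] [DecidableEq x] [Fintype y]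
  [DecidableEq y] [Fintype z] [DecidableEq z]

/-! ### Functional calculus of Hermitian matrices -/

/-! Write `W` for the dilation `V` with `E` placed first, `𝓔` for the conditional expectation and `ρ
= Ψ Ψ^*` with `Ψ` the matrix of `ψ`. Since `𝓔` is self-adjoint for the trace pairing, the dual of
the channel `X ↦ tr_E (W X W^*)` is `𝓔` again, so `𝓔(Y) = W^* (1 ⊗ Y) W`: the conditional
expectation is a compression (`compress_flipDilation`). Elements of `N` are fixed by it and
intertwined by `W`. If `σ ∈ N`, then every function of `σ` lies in `N`, and replacing `(ρ, σ)` by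
`(W ρ W^*, 1 ⊗ σ)` does not increase the divergence. For arbitrary `σ`, the operator Jensen
inequalities for compressions (`compress_matPow_le`, `shiftedPow_compress_le`) show that passing
from `(W ρ W^*, 1 ⊗ σ)` to `(ρ, 𝓔(σ))` does not increase it either. The two infima therefore agree.

For duality, dual parameters are `1/(1 - s)` and `1/(1 + s)` with `0 < s ≤ 1`. With `G = W Ψ`,
Hölder's inequality turns `D_α(G G^*‖T)` for `α > 1` into the supremum over states `τ` of `tr
[T^{-s} G τ^s G^*]` (`Dalpha_upperParam_le_iff`). Reverse Hölder turns `-D_β` of the complementary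
marginal into the infimum over `σ` of the same quantity, read across the other cut (`trace_swapCut`,
`reverse_holder`). Duality is thus the exchange of an infimum and a supremum, and `exists_saddle`
proves it by perturbing a maximiser. The shifts `δ > 0` replace negative powers by bounded ones, so
that supports enter only through limits.

At `α = 1` Klein's inequality makes `𝓔(ρ)` the optimal state of `N`. Duality then says that
complementary marginals of a vector have equal spectra up to transposition.

For the smoothed quantities, `ρ' ↦ W ρ' W^*` and `ω ↦ W^* ω W` carry the two smoothing balls into
each other, and the entropies behave correctly under both maps. Smooth duality follows from a form
of Uhlmann's theorem (`exists_uhlmann`): a nearby substate dominates a marginal of a vector on the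
same purifying space, and monotonicity of the entropies in the operator absorbs the difference. -/

theorem continuousOn_spectrum (A : Matrix x x ℂ) (f : ℝ → ℝ) : ContinuousOn f (spectrum ℝ A) :=
  (Matrix.finite_real_spectrum (A := A)).continuousOn f

/-- Spectra are finite, so every function agrees with an interpolation polynomial there. Identities
of the functional calculus thus reduce to identities of powers, and no continuity of the function is
needed. -/
theorem exists_polynomial_eq {S : Set ℝ} (hS : S.Finite) (f : ℝ → ℝ) :
    ∃ p : Polynomial ℝ, ∀ t ∈ S, p.eval t = f t := by
  classical
  refine ⟨Lagrange.interpolate hS.toFinset id f, fun t ht => ?_⟩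
  exact Lagrange.eval_interpolate_at_node (v := id) f (Set.injOn_id _) (hS.mem_toFinset.mpr ht)

theorem cfc_eq_aeval {A : Matrix x x ℂ} (hA : A.IsHermitian) {f : ℝ → ℝ} {p : Polynomial ℝ}
    (h : ∀ t ∈ spectrum ℝ A, p.eval t = f t) : cfc f A = Polynomial.aeval A p := by
  rw [← cfc_polynomial p A hA.isSelfAdjoint]
  exact cfc_congr fun t ht => (h t ht).symm

theorem isHermitian_cfc (f : ℝ → ℝ) (A : Matrix x x ℂ) : (cfc f A).IsHermitian :=
  (IsSelfAdjoint.cfc (f := f) (a := A))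

/-- The functional calculus intertwines whatever its arguments intertwine. -/
theorem cfc_mul_intertwine {A : Matrix x x ℂ} {B : Matrix y y ℂ} (hA : A.IsHermitian)
    (hB : B.IsHermitian) {L : Matrix x y ℂ} (h : A * L = L * B) (f : ℝ → ℝ) :
    cfc f A * L = L * cfc f B := by
  obtain ⟨p, hp⟩ := exists_polynomial_eq
    ((Matrix.finite_real_spectrum (A := A)).union (Matrix.finite_real_spectrum (A := B))) f
  rw [cfc_eq_aeval hA fun t ht => hp t (Or.inl ht), cfc_eq_aeval hB fun t ht => hp t (Or.inr ht)]
  clear hp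
  have key : ∀ n : ℕ, A ^ n * L = L * B ^ n := by
    intro n
    induction n with
    | zero => simp
    | succ n ih => rw [pow_succ, Matrix.mul_assoc, h, ← Matrix.mul_assoc, ih, Matrix.mul_assoc,
        ← pow_succ]
  induction p using Polynomial.induction_on' with
  | add p q hp hq => simp [Matrix.add_mul, Matrix.mul_add, hp, hq]
  | monomial n a => simp [Polynomial.aeval_monomial, Algebra.algebraMap_eq_smul_one, key]

theorem map_cfc_algHom (φ : Matrix x x ℂ →ₐ[ℝ] Matrix y y ℂ) {A : Matrix x x ℂ}
    (hA : A.IsHermitian) (hφ : (φ A).IsHermitian) (f : ℝ → ℝ) : φ (cfc f A) = cfc f (φ A) := by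
  obtain ⟨p, hp⟩ := exists_polynomial_eq
    ((Matrix.finite_real_spectrum (A := A)).union (Matrix.finite_real_spectrum (A := φ A))) f
  rw [cfc_eq_aeval hA fun t ht => hp t (Or.inl ht), cfc_eq_aeval hφ fun t ht => hp t (Or.inr ht),
    Polynomial.aeval_algHom_apply]

theorem cfc_mem_starSubalgebra (N : StarSubalgebra ℂ (Matrix x x ℂ)) {A : Matrix x x ℂ}
    (hA : A.IsHermitian) (hN : A ∈ N) (f : ℝ → ℝ) : cfc f A ∈ N := by
  obtain ⟨p, hp⟩ := exists_polynomial_eq (Matrix.finite_real_spectrum (A := A)) f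
  rw [cfc_eq_aeval hA hp, Polynomial.aeval_eq_sum_range]
  refine sum_mem fun i _ => ?_
  have := N.smul_mem (pow_mem hN i) ((p.coeff i : ℝ) : ℂ)
  simpa using this

theorem cfc_mul_cfc (f g : ℝ → ℝ) (A : Matrix x x ℂ) :
    cfc f A * cfc g A = cfc (fun t => f t * g t) A :=
  (cfc_mul f g A (continuousOn_spectrum A f) (continuousOn_spectrum A g)).symm

theorem cfc_id_eq {A : Matrix x x ℂ} (hA : A.IsHermitian) : cfc (fun t : ℝ => t) A = A :=
  cfc_id' ℝ A hA.isSelfAdjoint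

theorem cfc_mul_self {A : Matrix x x ℂ} (hA : A.IsHermitian) (f : ℝ → ℝ) :
    cfc f A * A = cfc (fun t => f t * t) A := by
  conv_lhs => rw [← cfc_id_eq hA]
  rw [cfc_id_eq hA]
  nth_rewrite 2 [← cfc_id_eq hA]
  exact cfc_mul_cfc _ _ _

theorem self_mul_cfc {A : Matrix x x ℂ} (hA : A.IsHermitian) (f : ℝ → ℝ) :
    A * cfc f A = cfc (fun t => t * f t) A := by
  nth_rewrite 1 [← cfc_id_eq hA]
  exact cfc_mul_cfc _ _ _

theorem spectrum_nonneg {A : Matrix x x ℂ} (hA : A.PosSemidef) {t : ℝ} (ht : t ∈ spectrum ℝ A) :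
    0 ≤ t :=
  spectrum_nonneg_of_nonneg hA.nonneg ht

theorem posSemidef_cfc {f : ℝ → ℝ} {A : Matrix x x ℂ} (h : ∀ t ∈ spectrum ℝ A, 0 ≤ f t) :
    (cfc f A).PosSemidef :=
  Matrix.nonneg_iff_posSemidef.mp (cfc_nonneg h)

theorem cfc_le_cfc {f g : ℝ → ℝ} {A : Matrix x x ℂ} (h : ∀ t ∈ spectrum ℝ A, f t ≤ g t) :
    cfc f A ≤ cfc g A :=
  cfc_mono h (continuousOn_spectrum A f) (continuousOn_spectrum A g)

theorem cfc_congr_nonneg {f g : ℝ → ℝ} {A : Matrix x x ℂ} (hA : A.PosSemidef)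
    (h : ∀ t, 0 ≤ t → f t = g t) : cfc f A = cfc g A :=
  cfc_congr fun _ ht => h _ (spectrum_nonneg hA ht)

theorem isHermitian_conj_mul_self (L : Matrix x y ℂ) : (Lᴴ * L).IsHermitian :=
  (Matrix.posSemidef_conjTranspose_mul_self L).isHermitian

theorem isHermitian_mul_conj_self (L : Matrix x y ℂ) : (L * Lᴴ).IsHermitian :=
  (Matrix.posSemidef_self_mul_conjTranspose L).isHermitian

theorem cfc_mul_conj_mul (L : Matrix x y ℂ) (f : ℝ → ℝ) :
    cfc f (L * Lᴴ) * L = L * cfc f (Lᴴ * L) :=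
  cfc_mul_intertwine (isHermitian_mul_conj_self L) (isHermitian_conj_mul_self L)
    (Matrix.mul_assoc _ _ _) f

/-- `L L^*` and `L^* L` have the same nonzero spectrum. -/
theorem trace_cfc_mul_conj (L : Matrix x y ℂ) {f : ℝ → ℝ} (hf : f 0 = 0) :
    (cfc f (L * Lᴴ)).trace = (cfc f (Lᴴ * L)).trace := by
  -- Because `f 0 = 0`, one factor `t` can be split off from `f t`, also at `t = 0`. Intertwining
  -- and cyclicity of the trace then move it to the other side.
  have h1 : cfc f (L * Lᴴ) = cfc (fun t => f t / t) (L * Lᴴ) * (L * Lᴴ) := by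
    rw [cfc_mul_self (isHermitian_mul_conj_self L)]
    refine cfc_congr fun t _ => ?_
    by_cases h : t = 0
    · simp [h, hf]
    · field_simp
  have h2 : cfc f (Lᴴ * L) = (Lᴴ * L) * cfc (fun t => f t / t) (Lᴴ * L) := by
    rw [self_mul_cfc (isHermitian_conj_mul_self L)]
    refine cfc_congr fun t _ => ?_
    by_cases h : t = 0
    · simp [h, hf]
    · field_simp
  rw [h1, h2, ← Matrix.mul_assoc, cfc_mul_conj_mul, Matrix.trace_mul_comm, Matrix.mul_assoc]

/-- Transposition reverses products, but on Hermitian matrices it agrees with entrywise conjugation,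
which is a real algebra homomorphism. -/
theorem cfc_transpose {A : Matrix x x ℂ} (hA : A.IsHermitian) (f : ℝ → ℝ) :
    cfc f Aᵀ = (cfc f A)ᵀ := by
  have h : ∀ B : Matrix x x ℂ, B.IsHermitian →
      ((Complex.conjAe : ℂ →ₐ[ℝ] ℂ).mapMatrix (m := x)) B = Bᵀ := by
    intro B hB
    ext i j
    simpa using hB.apply j i
  rw [← h A hA, ← h _ (isHermitian_cfc f A)]
  exact (map_cfc_algHom _ hA (by rw [h A hA]; exact hA.transpose) f).symm

theorem cfc_one_kronecker {A : Matrix x x ℂ} (hA : A.IsHermitian) (f : ℝ → ℝ) :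
    cfc f ((1 : Matrix y y ℂ) ⊗ₖ A) = (1 : Matrix y y ℂ) ⊗ₖ cfc f A := by
  let φ : Matrix x x ℂ →ₐ[ℝ] Matrix (y × x) (y × x) ℂ :=
    AlgHom.ofLinearMap
      { toFun := fun B => (1 : Matrix y y ℂ) ⊗ₖ B
        map_add' := fun B C => Matrix.kronecker_add _ _ _
        map_smul' := fun r B => Matrix.kronecker_smul _ _ _ }
      (by simp) (fun B C => by simp [← Matrix.mul_kronecker_mul])
  have hφ : ∀ B, φ B = (1 : Matrix y y ℂ) ⊗ₖ B := fun B => rfl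
  rw [← hφ, ← hφ]
  refine (map_cfc_algHom φ hA ?_ f).symm
  rw [hφ, Matrix.IsHermitian, Matrix.conjTranspose_kronecker, hA.eq, Matrix.conjTranspose_one]

/-! ### Traces -/

theorem re_trace_mul_nonneg {A B : Matrix x x ℂ} (hA : A.PosSemidef) (hB : B.PosSemidef) :
    0 ≤ (A * B).trace.re := by
  obtain ⟨K, rfl⟩ := CStarAlgebra.nonneg_iff_eq_star_mul_self.mp hB.nonneg
  rw [Matrix.star_eq_conjTranspose]
  rw [← Matrix.mul_assoc, Matrix.trace_mul_comm, ← Matrix.mul_assoc]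
  exact (Complex.le_def.mp (hA.mul_mul_conjTranspose_same K).trace_nonneg).1

theorem re_trace_nonneg {A : Matrix x x ℂ} (hA : A.PosSemidef) : 0 ≤ A.trace.re :=
  (Complex.le_def.mp hA.trace_nonneg).1

theorem re_trace_le {A B : Matrix x x ℂ} (h : A ≤ B) : A.trace.re ≤ B.trace.re := by
  have := re_trace_nonneg (Matrix.le_iff.mp h)
  rw [Matrix.trace_sub, Complex.sub_re] at this
  linarith

theorem re_trace_mul_le {A B C : Matrix x x ℂ} (h : A ≤ B) (hC : C.PosSemidef) :
    (A * C).trace.re ≤ (B * C).trace.re := by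
  have := re_trace_mul_nonneg (Matrix.le_iff.mp h) hC
  rw [Matrix.sub_mul, Matrix.trace_sub, Complex.sub_re] at this
  linarith

theorem trace_eq_re {A : Matrix x x ℂ} (hA : A.IsHermitian) : A.trace = (A.trace.re : ℂ) := by
  have h : star A.trace = A.trace := by rw [← Matrix.trace_conjTranspose, hA.eq]
  exact (Complex.conj_eq_iff_re.mp h).symm

theorem eq_zero_of_re_trace_eq_zero {A : Matrix x x ℂ} (hA : A.PosSemidef)
    (h : A.trace.re = 0) : A = 0 := by
  refine hA.trace_eq_zero_iff.mp ?_
  rw [trace_eq_re hA.isHermitian, h, Complex.ofReal_zero]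

theorem mul_conj_le {A B : Matrix x x ℂ} (h : A ≤ B) (L : Matrix x y ℂ) :
    Lᴴ * A * L ≤ Lᴴ * B * L := by
  have := (Matrix.le_iff.mp h).conjTranspose_mul_mul_same L
  rw [Matrix.mul_sub, Matrix.sub_mul] at this
  exact this

theorem conj_mul_le {A B : Matrix x x ℂ} (h : A ≤ B) (L : Matrix y x ℂ) :
    L * A * Lᴴ ≤ L * B * Lᴴ := by
  simpa using mul_conj_le h Lᴴ

theorem trace_cfc {A : Matrix x x ℂ} (hA : A.IsHermitian) (f : ℝ → ℝ) :
    (cfc f A).trace = ∑ i, ((f (hA.eigenvalues i) : ℝ) : ℂ) := by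
  rw [hA.cfc_eq, Matrix.IsHermitian.cfc, Unitary.conjStarAlgAut_apply, Matrix.trace_mul_comm,
    ← Matrix.mul_assoc, Unitary.coe_star_mul_self, Matrix.one_mul, Matrix.trace_diagonal]
  rfl

/-- The trace of `f(A) g(B)` is a double sum over the eigenvalues with doubly stochastic
weights. -/
theorem exists_weights {A B : Matrix x x ℂ} (hA : A.IsHermitian) (hB : B.IsHermitian) :
    ∃ p : x → x → ℝ, (∀ i j, 0 ≤ p i j) ∧ (∀ i, ∑ j, p i j = 1) ∧ (∀ j, ∑ i, p i j = 1) ∧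
      ∀ f g : ℝ → ℝ, (cfc f A * cfc g B).trace.re =
        ∑ i, ∑ j, f (hA.eigenvalues i) * g (hB.eigenvalues j) * p i j := by
  set U : Matrix x x ℂ := (hA.eigenvectorUnitary : Matrix x x ℂ) with hU
  set V : Matrix x x ℂ := (hB.eigenvectorUnitary : Matrix x x ℂ) with hV
  have hU1 : star U * U = 1 := Unitary.coe_star_mul_self _
  have hU2 : U * star U = 1 := Unitary.coe_mul_star_self _
  have hV1 : star V * V = 1 := Unitary.coe_star_mul_self _
  have hV2 : V * star V = 1 := Unitary.coe_mul_star_self _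
  -- The entries of `T` are the overlaps of the two eigenbases. Their squared moduli are the
  -- weights, and unitarity of `T` gives the row and column sums.
  set T : Matrix x x ℂ := star U * V with hT
  have hT1 : star T * T = 1 := by
    rw [hT, star_mul, star_star, mul_assoc, ← mul_assoc U, hU2, one_mul, hV1]
  have hT2 : T * star T = 1 := by
    rw [hT, star_mul, star_star, mul_assoc, ← mul_assoc V, hV2, one_mul, hU1]
  have key : ∀ i j, T i j * star (T i j) = ((‖T i j‖ ^ 2 : ℝ) : ℂ) := by
    intro i j
    rw [Complex.star_def, Complex.mul_conj, Complex.normSq_eq_norm_sq]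
  refine ⟨fun i j => ‖T i j‖ ^ 2, fun i j => by positivity, fun i => ?_, fun j => ?_,
    fun f g => ?_⟩
  · have := congrFun (congrFun hT2 i) i
    rw [Matrix.mul_apply] at this
    simp only [Matrix.star_apply, key, Matrix.one_apply_eq] at this
    exact_mod_cast this
  · have := congrFun (congrFun hT1 j) j
    rw [Matrix.mul_apply] at this
    simp only [Matrix.star_apply, mul_comm (star _), key, Matrix.one_apply_eq] at this
    exact_mod_cast this
  · rw [hA.cfc_eq, hB.cfc_eq, Matrix.IsHermitian.cfc, Matrix.IsHermitian.cfc,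
      Unitary.conjStarAlgAut_apply, Unitary.conjStarAlgAut_apply, ← hU, ← hV]
    set D := diagonal (RCLike.ofReal ∘ f ∘ hA.eigenvalues : x → ℂ) with hD
    set E := diagonal (RCLike.ofReal ∘ g ∘ hB.eigenvalues : x → ℂ) with hE
    have : (U * D * star U * (V * E * star V)).trace = (D * T * E * star T).trace := by
      rw [hT, star_mul, star_star]
      simp only [mul_assoc]
      rw [Matrix.trace_mul_comm]
      simp only [mul_assoc]
    rw [this, Matrix.trace, Complex.re_sum]
    refine Finset.sum_congr rfl fun i _ => ?_
    rw [Matrix.diag_apply, Matrix.mul_apply, Complex.re_sum]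
    refine Finset.sum_congr rfl fun j _ => ?_
    rw [hE, Matrix.mul_diagonal, hD, Matrix.diagonal_mul, Matrix.star_apply]
    have h2 : (RCLike.ofReal ∘ f ∘ hA.eigenvalues : x → ℂ) i * T i j *
        (RCLike.ofReal ∘ g ∘ hB.eigenvalues : x → ℂ) j * star (T i j) =
        ((f (hA.eigenvalues i) * g (hB.eigenvalues j) * ‖T i j‖ ^ 2 : ℝ) : ℂ) := by
      push_cast
      have := key i j
      push_cast at this
      rw [← this]
      simp only [Function.comp_apply, Complex.coe_algebraMap]
      ring
    rw [h2, Complex.ofReal_re]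

theorem tendsto_cfc_pointwise {ι : Type*} {l : Filter ι} {F : ι → ℝ → ℝ} {f : ℝ → ℝ}
    {A : Matrix x x ℂ} (hA : A.IsHermitian)
    (h : ∀ t ∈ spectrum ℝ A, Tendsto (fun i => F i t) l (𝓝 (f t))) :
    Tendsto (fun i => cfc (F i) A) l (𝓝 (cfc f A)) := by
  simp only [hA.cfc_eq, Matrix.IsHermitian.cfc, Unitary.conjStarAlgAut_apply]
  refine Tendsto.mul (Tendsto.mul tendsto_const_nhds ?_) tendsto_const_nhds
  refine (Continuous.matrix_diagonal continuous_id).continuousAt.tendsto.comp ?_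
  refine tendsto_pi_nhds.mpr fun i => ?_
  exact (Complex.continuous_ofReal.tendsto _).comp
    (h _ (hA.eigenvalues_mem_spectrum_real i))

/-! ### Powers of positive semidefinite matrices -/

/-- The power `(σ + δ)^s` of a positive semidefinite matrix shifted by `δ > 0`. -/
noncomputable def shiftedPow (σ : Matrix x x ℂ) (δ s : ℝ) : Matrix x x ℂ :=
  cfc (fun t : ℝ => (t + δ) ^ s) σ

theorem posSemidef_matPow {σ : Matrix x x ℂ} (hσ : σ.PosSemidef) (s : ℝ) :
    (matPow σ s).PosSemidef :=
  posSemidef_cfc fun _ ht => Real.rpow_nonneg (spectrum_nonneg hσ ht) s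

theorem posSemidef_shiftedPow {σ : Matrix x x ℂ} (hσ : σ.PosSemidef) {δ : ℝ} (hδ : 0 ≤ δ)
    (s : ℝ) : (shiftedPow σ δ s).PosSemidef :=
  posSemidef_cfc fun _ ht => Real.rpow_nonneg (add_nonneg (spectrum_nonneg hσ ht) hδ) s

theorem matPow_one {σ : Matrix x x ℂ} (hσ : σ.PosSemidef) : matPow σ 1 = σ := by
  simp only [matPow, Real.rpow_one]
  exact cfc_id_eq hσ.isHermitian

theorem matPow_zero_matrix {s : ℝ} (hs : s ≠ 0) : matPow (0 : Matrix x x ℂ) s = 0 := by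
  have h : matPow (0 : Matrix x x ℂ) s = (0 : Matrix x x ℂ) * cfc (fun t : ℝ => t ^ s / t)
      (0 : Matrix x x ℂ) := by
    rw [self_mul_cfc Matrix.isHermitian_zero]
    refine cfc_congr fun t _ => ?_
    by_cases h : t = 0
    · simp [h, Real.zero_rpow hs]
    · field_simp
  rw [h, Matrix.zero_mul]

theorem matPow_half_mul_half {σ : Matrix x x ℂ} (hσ : σ.PosSemidef) (s : ℝ) :
    matPow σ (s / 2) * matPow σ (s / 2) = matPow σ s := by
  rw [matPow, cfc_mul_cfc]
  refine cfc_congr_nonneg hσ fun t ht => ?_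
  by_cases hs : s = 0
  · simp [hs]
  · rw [← Real.rpow_add' ht (by simpa using hs), add_halves]

theorem sqrt_mul_sqrt {σ : Matrix x x ℂ} (hσ : σ.PosSemidef) :
    matPow σ (1 / 2) * matPow σ (1 / 2) = σ := by
  rw [matPow_half_mul_half hσ, matPow_one hσ]

theorem isHermitian_matPow (σ : Matrix x x ℂ) (s : ℝ) : (matPow σ s).IsHermitian :=
  isHermitian_cfc _ _

theorem exists_eq_mul_conj {σ : Matrix x x ℂ} (hσ : σ.PosSemidef) :
    ∃ K : Matrix x x ℂ, σ = K * Kᴴ :=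
  ⟨matPow σ (1 / 2), by rw [(isHermitian_matPow σ _).eq, sqrt_mul_sqrt hσ]⟩

theorem matPow_eq_rpow {σ : Matrix x x ℂ} (hσ : σ.PosSemidef) (s : ℝ) : matPow σ s = σ ^ s := by
  rw [CFC.rpow_eq_cfc_real (ha := by exact hσ.nonneg)]
  rfl

theorem matPow_le_matPow {A B : Matrix x x ℂ} (hA : A.PosSemidef) (h : A ≤ B) {s : ℝ}
    (hs : s ∈ Set.Icc (0 : ℝ) 1) : matPow A s ≤ matPow B s := by
  have hB : B.PosSemidef := Matrix.nonneg_iff_posSemidef.mp (hA.nonneg.trans h)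
  rw [matPow_eq_rpow hA, matPow_eq_rpow hB]
  exact CFC.monotone_rpow hs h

theorem matPow_concave {A B : Matrix x x ℂ} (hA : A.PosSemidef) (hB : B.PosSemidef) {s : ℝ}
    (hs : s ∈ Set.Icc (0 : ℝ) 1) {u : ℝ} (hu : u ∈ Set.Icc (0 : ℝ) 1) :
    (1 - u) • matPow A s + u • matPow B s ≤ matPow ((1 - u) • A + u • B) s := by
  have hu' : 0 ≤ 1 - u := by linarith [hu.2]
  have hC : ((1 - u) • A + u • B).PosSemidef := (hA.smul hu').add (hB.smul hu.1)
  rw [matPow_eq_rpow hA, matPow_eq_rpow hB, matPow_eq_rpow hC]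
  exact (CFC.concaveOn_rpow hs).2 hA.nonneg hB.nonneg hu' hu.1 (by ring)

theorem add_smul_one_eq_cfc {A : Matrix x x ℂ} (hA : A.IsHermitian) (δ : ℝ) :
    A + δ • (1 : Matrix x x ℂ) = cfc (fun t : ℝ => t + δ) A := by
  have h1 := cfc_add_const δ (fun t : ℝ => t) A (continuousOn_spectrum A _) hA.isSelfAdjoint
  rw [h1, cfc_id_eq hA, Algebra.algebraMap_eq_smul_one]

theorem matPow_add_smul_one {A : Matrix x x ℂ} (hA : A.IsHermitian) (δ s : ℝ) :
    matPow (A + δ • (1 : Matrix x x ℂ)) s = shiftedPow A δ s := by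
  rw [add_smul_one_eq_cfc hA, matPow, shiftedPow]
  exact (cfc_comp (fun t : ℝ => t ^ s) (fun t : ℝ => t + δ) A hA.isSelfAdjoint
    (((Matrix.finite_real_spectrum (A := A)).image _).continuousOn _)
    (continuousOn_spectrum A _)).symm

theorem isHermitian_shiftedPow (σ : Matrix x x ℂ) (δ s : ℝ) : (shiftedPow σ δ s).IsHermitian :=
  isHermitian_cfc _ _

theorem shiftedPow_mul_neg {A : Matrix x x ℂ} (hA : A.PosSemidef) {δ : ℝ} (hδ : 0 < δ) (s : ℝ) :
    shiftedPow A δ s * shiftedPow A δ (-s) = 1 := by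
  rw [shiftedPow, shiftedPow, cfc_mul_cfc, ← cfc_const_one ℝ A hA.isHermitian.isSelfAdjoint]
  refine cfc_congr_nonneg hA fun t ht => ?_
  rw [← Real.rpow_add (by linarith), add_neg_cancel, Real.rpow_zero]

theorem shiftedPow_neg_mul {A : Matrix x x ℂ} (hA : A.PosSemidef) {δ : ℝ} (hδ : 0 < δ) (s : ℝ) :
    shiftedPow A δ (-s) * shiftedPow A δ s = 1 := by
  simpa using shiftedPow_mul_neg hA hδ (-s)

/-! ### Operator Jensen inequalities for compressions -/

/-- The inverse of a compression is at most the compression of the inverse. -/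
theorem inv_le_compress_inv {C C' : Matrix y y ℂ} {D D' : Matrix x x ℂ} {W : Matrix y x ℂ}
    (hC : C.PosSemidef) (hC' : C'.IsHermitian) (hD' : D'.IsHermitian) (hCC : C * C' = 1)
    (hDD : D * D' = 1) (hW : Wᴴ * W = 1) (h : Wᴴ * C * W ≤ D) : D' ≤ Wᴴ * C' * W := by
  have hCC' : C' * C = 1 := mul_eq_one_comm.mp hCC
  have hDD' : D' * D = 1 := mul_eq_one_comm.mp hDD
  -- Completing the square: conjugating `C` by the defect gives `W^* C' W - 2 D' + D' (W^* C W) D' ≥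
  -- 0`, and the hypothesis bounds the last term by `D'`.
  have h1 := hC.conjTranspose_mul_mul_same (C' * W - W * D')
  have h2 : (C' * W - W * D')ᴴ * C * (C' * W - W * D') =
      Wᴴ * C' * W - D' - D' + D'ᴴ * (Wᴴ * C * W) * D' := by
    rw [Matrix.conjTranspose_sub, Matrix.conjTranspose_mul, Matrix.conjTranspose_mul, hC'.eq,
      hD'.eq]
    simp only [Matrix.sub_mul, Matrix.mul_sub]
    have e1 : Wᴴ * C' * C * (C' * W) = Wᴴ * C' * W := by
      rw [Matrix.mul_assoc Wᴴ, hCC', Matrix.mul_one, Matrix.mul_assoc]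
    have e2 : Wᴴ * C' * C * (W * D') = D' := by
      rw [Matrix.mul_assoc Wᴴ, hCC', Matrix.mul_one, ← Matrix.mul_assoc, hW, Matrix.one_mul]
    have e3 : D' * Wᴴ * C * (C' * W) = D' := by
      rw [Matrix.mul_assoc _ C, ← Matrix.mul_assoc C, hCC, Matrix.one_mul, Matrix.mul_assoc, hW,
        Matrix.mul_one]
    have e4 : D' * Wᴴ * C * (W * D') = D' * (Wᴴ * C * W) * D' := by
      simp only [Matrix.mul_assoc]
    rw [e1, e2, e3, e4]
    abel
  have h3 : D'ᴴ * (Wᴴ * C * W) * D' ≤ D' := by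
    refine (mul_conj_le h D').trans_eq ?_
    rw [hD'.eq, hDD', Matrix.one_mul]
  rw [h2] at h1
  have h4 := add_le_add (Matrix.le_iff.mpr (by simpa using h1) :
    (0 : Matrix x x ℂ) ≤ Wᴴ * C' * W - D' - D' + D'ᴴ * (Wᴴ * C * W) * D') h3
  have h5 := sub_nonneg.mpr h4
  refine sub_nonneg.mp (h5.trans_eq ?_)
  abel

/-- Operator monotonicity of `t ^ s`, followed by inversion, which is the case `W = 1` of
`inv_le_compress_inv`. -/
theorem shiftedPow_antitone {A B : Matrix x x ℂ} (hA : A.PosSemidef) (h : A ≤ B) {δ : ℝ}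
    (hδ : 0 < δ) {s : ℝ} (hs : s ∈ Set.Icc (0 : ℝ) 1) :
    shiftedPow B δ (-s) ≤ shiftedPow A δ (-s) := by
  have hB : B.PosSemidef := Matrix.nonneg_iff_posSemidef.mp (hA.nonneg.trans h)
  have h1 : shiftedPow A δ s ≤ shiftedPow B δ s := by
    rw [← matPow_add_smul_one hA.isHermitian, ← matPow_add_smul_one hB.isHermitian]
    exact matPow_le_matPow (hA.add (Matrix.PosSemidef.one.smul hδ.le)) (by gcongr) hs
  have := inv_le_compress_inv (W := (1 : Matrix x x ℂ)) (posSemidef_shiftedPow hA hδ.le s)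
    (isHermitian_shiftedPow _ _ _) (isHermitian_shiftedPow _ _ _) (shiftedPow_mul_neg hA hδ s)
    (shiftedPow_mul_neg hB hδ s) (by simp) (by simpa using h1)
  simpa using this

theorem tendsto_const_le {A B : ℝ → Matrix x x ℂ} {A' B' : Matrix x x ℂ}
    (hA : Tendsto A (𝓝[>] 0) (𝓝 A')) (hB : Tendsto B (𝓝[>] 0) (𝓝 B'))
    (h : ∀ δ, 0 < δ → A δ ≤ B δ) : A' ≤ B' := by
  have hcl : IsClosed {A : Matrix x x ℂ | 0 ≤ A} := CStarAlgebra.isClosed_nonneg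
  have h1 : Tendsto (fun δ => B δ - A δ) (𝓝[>] 0) (𝓝 (B' - A')) := hB.sub hA
  have := hcl.mem_of_tendsto h1 (by
    filter_upwards [self_mem_nhdsWithin] with δ hδ
    exact sub_nonneg.mpr (h δ hδ))
  exact sub_nonneg.mp this

/-- Operator Jensen inequality. With `K = A^{1/2} W` one has `K K^* ≤ A`, hence `(A + η)^{s-1} ≤ (K
K^* + η)^{s-1}`. Conjugating by `K`, the left side becomes the compression of `A (A + η)^{s-1}`; on
the right `K` moves through the functional calculus and leaves a function of `K^* K = W^* A W` that
is at most its power `s`. Finally `η → 0`. -/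
theorem compress_matPow_le {A : Matrix y y ℂ} (hA : A.PosSemidef) {W : Matrix y x ℂ}
    (hW : Wᴴ * W = 1) {s : ℝ} (hs : 0 < s) (hs1 : s ≤ 1) :
    Wᴴ * matPow A s * W ≤ matPow (Wᴴ * A * W) s := by
  set R := matPow A (1 / 2) with hR
  have hRR : R * R = A := sqrt_mul_sqrt hA
  have hRh : Rᴴ = R := (isHermitian_matPow A _).eq
  set K := R * W with hK
  have hK1 : Kᴴ * K = Wᴴ * A * W := by
    rw [hK, Matrix.conjTranspose_mul, hRh, Matrix.mul_assoc, ← Matrix.mul_assoc R, hRR,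
      Matrix.mul_assoc]
  have hWW : W * Wᴴ ≤ 1 := by
    have hP : (1 - W * Wᴴ) * (1 - W * Wᴴ)ᴴ = 1 - W * Wᴴ := by
      have : W * Wᴴ * (W * Wᴴ) = W * Wᴴ := by
        rw [Matrix.mul_assoc, ← Matrix.mul_assoc Wᴴ, hW, Matrix.one_mul]
      simp [Matrix.mul_sub, Matrix.sub_mul, this]
    rw [Matrix.le_iff, ← hP]
    exact Matrix.posSemidef_self_mul_conjTranspose _
  have hK2 : K * Kᴴ ≤ A := by
    have := conj_mul_le hWW R
    rwa [hRh, Matrix.mul_one, hRR, ← Matrix.mul_assoc, ← hK, Matrix.mul_assoc, ← hRh,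
      ← Matrix.conjTranspose_mul, ← hK] at this
  have hstep : ∀ η : ℝ, 0 < η →
      Wᴴ * (cfc (fun t : ℝ => t * (t + η) ^ (-(1 - s))) A) * W ≤ matPow (Kᴴ * K) s := by
    intro η hη
    have h1 : shiftedPow A η (-(1 - s)) ≤ shiftedPow (K * Kᴴ) η (-(1 - s)) :=
      shiftedPow_antitone (Matrix.posSemidef_self_mul_conjTranspose K) hK2 hη
        ⟨by linarith, by linarith⟩
    have h2 := mul_conj_le h1 K
    have h3 : Kᴴ * shiftedPow (K * Kᴴ) η (-(1 - s)) * K ≤ matPow (Kᴴ * K) s := by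
      rw [Matrix.mul_assoc, shiftedPow, cfc_mul_conj_mul, ← Matrix.mul_assoc,
        self_mul_cfc (isHermitian_conj_mul_self K)]
      refine cfc_le_cfc fun t ht => ?_
      have ht0 := spectrum_nonneg (Matrix.posSemidef_conjTranspose_mul_self K) ht
      rcases ht0.eq_or_lt with rfl | ht0
      · simp [Real.zero_rpow hs.ne']
      · calc t * (t + η) ^ (-(1 - s)) ≤ t * t ^ (-(1 - s)) := by
              refine mul_le_mul_of_nonneg_left ?_ ht0.le
              exact Real.rpow_le_rpow_of_nonpos ht0 (by linarith) (by linarith)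
          _ = t ^ s := by
              nth_rewrite 1 [← Real.rpow_one t]
              rw [← Real.rpow_add ht0]
              congr 1
              ring
    refine le_trans (le_of_eq ?_) (h2.trans h3)
    have hcomm : R * shiftedPow A η (-(1 - s)) * R =
        cfc (fun t : ℝ => t * (t + η) ^ (-(1 - s))) A := by
      rw [hR, matPow, shiftedPow, cfc_mul_cfc, cfc_mul_cfc]
      refine cfc_congr_nonneg hA fun t ht => ?_
      have : t ^ (1 / 2 : ℝ) * t ^ (1 / 2 : ℝ) = t := by
        rw [← Real.sqrt_eq_rpow, Real.mul_self_sqrt ht]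
      calc _ = (t ^ (1 / 2 : ℝ) * t ^ (1 / 2 : ℝ)) * (t + η) ^ (-(1 - s)) := by ring
        _ = _ := by rw [this]
    rw [← hcomm, hK, Matrix.conjTranspose_mul, hRh]
    simp only [Matrix.mul_assoc]
  rw [← hK1]
  refine tendsto_const_le (A := fun η => Wᴴ * (cfc (fun t : ℝ => t * (t + η) ^ (-(1 - s))) A) * W)
    ?_ tendsto_const_nhds hstep
  have h4 : Tendsto (fun η : ℝ => cfc (fun t : ℝ => t * (t + η) ^ (-(1 - s))) A) (𝓝[>] 0)
      (𝓝 (matPow A s)) := by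
    refine tendsto_cfc_pointwise hA.isHermitian fun t ht => ?_
    rcases (spectrum_nonneg hA ht).eq_or_lt with rfl | ht0
    · simp [Real.zero_rpow hs.ne']
    · have : t ^ s = t * (t + 0) ^ (-(1 - s)) := by
        rw [add_zero]
        nth_rewrite 2 [← Real.rpow_one t]
        rw [← Real.rpow_add ht0]
        congr 1
        ring
      rw [this]
      refine Tendsto.mono_left ?_ nhdsWithin_le_nhds
      refine ContinuousAt.tendsto (f := fun η : ℝ => t * (t + η) ^ (-(1 - s))) (x := 0) ?_
      refine continuousAt_const.mul (ContinuousAt.rpow_const (by fun_prop) (Or.inl ?_))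
      linarith
  exact ((continuous_const.matrix_mul continuous_id).matrix_mul
    continuous_const).continuousAt.tendsto.comp h4

/-- The Jensen inequality for `A + δ`, inverted. The shift survives the compression because `W^* W =
1`. -/
theorem shiftedPow_compress_le {A : Matrix y y ℂ} (hA : A.PosSemidef) {W : Matrix y x ℂ}
    (hW : Wᴴ * W = 1) {s : ℝ} (hs : 0 < s) (hs1 : s ≤ 1) {δ : ℝ} (hδ : 0 < δ) :
    shiftedPow (Wᴴ * A * W) δ (-s) ≤ Wᴴ * shiftedPow A δ (-s) * W := by
  have hB := hA.conjTranspose_mul_mul_same W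
  refine inv_le_compress_inv (posSemidef_shiftedPow hA hδ.le s) (isHermitian_shiftedPow _ _ _)
    (isHermitian_shiftedPow _ _ _) (shiftedPow_mul_neg hA hδ s) (shiftedPow_mul_neg hB hδ s) hW ?_
  rw [← matPow_add_smul_one hA.isHermitian, ← matPow_add_smul_one hB.isHermitian]
  have := compress_matPow_le (hA.add (Matrix.PosSemidef.one.smul hδ.le)) hW hs hs1
  rwa [Matrix.mul_add, Matrix.add_mul, Matrix.mul_smul, Matrix.smul_mul, Matrix.mul_one, hW]
    at this

/-! ### Hölder inequalities for traces of powers -/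

theorem re_trace_matPow_nonneg {A : Matrix x x ℂ} (hA : A.PosSemidef) (s : ℝ) :
    0 ≤ (matPow A s).trace.re :=
  re_trace_nonneg (posSemidef_matPow hA s)

theorem re_trace_add_smul_one (A : Matrix x x ℂ) (δ : ℝ) :
    (A + δ • (1 : Matrix x x ℂ)).trace.re = A.trace.re + δ * Fintype.card x := by
  simp [Matrix.trace_add, Matrix.trace_smul]

/-- Scalar Hölder with exponent `1 + s` on pairs of eigenvalues, with weights `(σ_i + δ) p_ij`. For
a state `S` and `δ → 0` it bounds `tr S^{-s} Y` below by `(tr Y^β)^{1+s}`. -/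
theorem reverse_holder {S Y : Matrix x x ℂ} (hS : S.PosSemidef) (hY : Y.PosSemidef) {δ s β : ℝ}
    (hδ : 0 < δ) (hs : 0 < s) (hβ : β = (1 + s)⁻¹) :
    (matPow Y β).trace.re ≤ (S.trace.re + δ * Fintype.card x) ^ (1 - β) *
      (shiftedPow S δ (-s) * Y).trace.re ^ β := by
  obtain ⟨p, hp, -, -, hfg⟩ := exists_weights hS.isHermitian hY.isHermitian
  set σ := hS.isHermitian.eigenvalues
  set η := hY.isHermitian.eigenvalues
  have hσ : ∀ i, 0 < σ i + δ := fun i => add_pos_of_nonneg_of_pos (hS.eigenvalues_nonneg i) hδ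
  have hη : ∀ i, 0 ≤ η i := hY.eigenvalues_nonneg
  have key := Real.inner_le_weight_mul_Lp_of_nonneg (Finset.univ : Finset (x × x))
    (p := 1 + s) (by linarith) (fun q => (σ q.1 + δ) * p q.1 q.2)
    (fun q => (σ q.1 + δ)⁻¹ * η q.2 ^ β)
    (fun q => mul_nonneg (hσ _).le (hp _ _))
    (fun q => mul_nonneg (inv_nonneg.mpr (hσ _).le) (Real.rpow_nonneg (hη _) _))
  rw [← hβ] at key
  have e1 : (matPow Y β).trace.re =
      ∑ q : x × x, (σ q.1 + δ) * p q.1 q.2 * ((σ q.1 + δ)⁻¹ * η q.2 ^ β) := by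
    have h1 : (matPow Y β).trace.re = (cfc (fun _ : ℝ => 1) S * matPow Y β).trace.re := by
      rw [cfc_const_one ℝ S hS.isHermitian.isSelfAdjoint, Matrix.one_mul]
    rw [h1, matPow, hfg, Fintype.sum_prod_type]
    refine Finset.sum_congr rfl fun i _ => Finset.sum_congr rfl fun j _ => ?_
    have := (hσ i).ne'
    field_simp
  have e2 : S.trace.re + δ * Fintype.card x = ∑ q : x × x, (σ q.1 + δ) * p q.1 q.2 := by
    have h1 : S.trace.re + δ * Fintype.card x =
        (cfc (fun t : ℝ => t + δ) S * cfc (fun _ : ℝ => 1) Y).trace.re := by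
      rw [cfc_const_one ℝ Y hY.isHermitian.isSelfAdjoint, Matrix.mul_one,
        ← add_smul_one_eq_cfc hS.isHermitian, re_trace_add_smul_one]
    rw [h1, hfg, Fintype.sum_prod_type]
    simp [σ]
  have e3 : (shiftedPow S δ (-s) * Y).trace.re =
      ∑ q : x × x, (σ q.1 + δ) * p q.1 q.2 * ((σ q.1 + δ)⁻¹ * η q.2 ^ β) ^ (1 + s) := by
    nth_rewrite 1 [← cfc_id_eq hY.isHermitian]
    rw [shiftedPow, hfg, Fintype.sum_prod_type]
    refine Finset.sum_congr rfl fun i _ => Finset.sum_congr rfl fun j _ => ?_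
    have h0 := hσ i
    rw [Real.mul_rpow (inv_nonneg.mpr h0.le) (Real.rpow_nonneg (hη j) _), ← Real.rpow_mul (hη j),
      hβ, inv_mul_cancel₀ (by linarith), Real.rpow_one, Real.inv_rpow h0.le,
      Real.rpow_add h0, Real.rpow_one, Real.rpow_neg h0.le]
    have := (Real.rpow_pos_of_pos h0 s).ne'
    field_simp
  rw [e1, e2, e3]
  exact key

/-- Scalar Hölder with exponent `α` on pairs of eigenvalues, now with weights `η_j p_ij` and values
`ζ_i η_j^{s-1}`. -/
theorem holder {Z τ : Matrix x x ℂ} (hZ : Z.PosSemidef) (hτ : τ.PosSemidef) {s α : ℝ}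
    (hs : 0 < s) (hs1 : s < 1) (hα : α = (1 - s)⁻¹) :
    (Z * matPow τ s).trace.re ≤ τ.trace.re ^ s * (matPow Z α).trace.re ^ (1 - s) := by
  obtain ⟨p, hp, hp1, -, hfg⟩ := exists_weights hZ.isHermitian hτ.isHermitian
  set ζ := hZ.isHermitian.eigenvalues
  set η := hτ.isHermitian.eigenvalues
  have hζ : ∀ i, 0 ≤ ζ i := hZ.eigenvalues_nonneg
  have hη : ∀ i, 0 ≤ η i := hτ.eigenvalues_nonneg
  have hα1 : 1 ≤ α := by
    rw [hα]
    exact (one_le_inv₀ (by linarith)).mpr (by linarith)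
  have hα' : α⁻¹ = 1 - s := by rw [hα, inv_inv]
  have key := Real.inner_le_weight_mul_Lp_of_nonneg (Finset.univ : Finset (x × x))
    (p := α) hα1 (fun q => η q.2 * p q.1 q.2) (fun q => ζ q.1 * η q.2 ^ (s - 1))
    (fun q => mul_nonneg (hη _) (hp _ _))
    (fun q => mul_nonneg (hζ _) (Real.rpow_nonneg (hη _) _))
  rw [hα', sub_sub_cancel] at key
  have e1 : (Z * matPow τ s).trace.re =
      ∑ q : x × x, η q.2 * p q.1 q.2 * (ζ q.1 * η q.2 ^ (s - 1)) := by
    nth_rewrite 1 [← cfc_id_eq hZ.isHermitian]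
    rw [matPow, hfg, Fintype.sum_prod_type]
    refine Finset.sum_congr rfl fun i _ => Finset.sum_congr rfl fun j _ => ?_
    have h2 : η j ^ s = η j * η j ^ (s - 1) := by
      rcases (hη j).eq_or_lt with h | h
      · rw [← h, Real.zero_rpow hs.ne', zero_mul]
      · nth_rewrite 2 [← Real.rpow_one (η j)]
        rw [← Real.rpow_add h]
        congr 1
        ring
    change ζ i * η j ^ s * p i j = _
    rw [h2]
    ring
  have e2 : τ.trace.re = ∑ q : x × x, η q.2 * p q.1 q.2 := by
    have h1 : τ.trace.re = (cfc (fun _ : ℝ => 1) Z * cfc (fun t : ℝ => t) τ).trace.re := by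
      rw [cfc_const_one ℝ Z hZ.isHermitian.isSelfAdjoint, Matrix.one_mul, cfc_id_eq hτ.isHermitian]
    rw [h1, hfg, Fintype.sum_prod_type]
    simp [η]
  -- Only an inequality: eigenvectors in the kernel of `τ` have weight zero on the left but may
  -- contribute to `tr Z^α`.
  have e3 : ∑ q : x × x, η q.2 * p q.1 q.2 * (ζ q.1 * η q.2 ^ (s - 1)) ^ α ≤
      (matPow Z α).trace.re := by
    have h1 : (matPow Z α).trace.re = (matPow Z α * cfc (fun _ : ℝ => 1) τ).trace.re := by
      rw [cfc_const_one ℝ τ hτ.isHermitian.isSelfAdjoint, Matrix.mul_one]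
    rw [h1, matPow, hfg, Fintype.sum_prod_type]
    refine Finset.sum_le_sum fun i _ => Finset.sum_le_sum fun j _ => ?_
    have hz : 0 ≤ ζ i ^ α := Real.rpow_nonneg (hζ i) _
    rcases (hη j).eq_or_lt with h | h
    · rw [← h, zero_mul, zero_mul, mul_one]
      exact mul_nonneg hz (hp i j)
    · rw [Real.mul_rpow (hζ i) (Real.rpow_nonneg h.le _), ← Real.rpow_mul h.le]
      have h3 : (s - 1) * α = -1 := by
        rw [hα]
        have : 1 - s ≠ 0 := by linarith
        field_simp
        ring
      rw [h3, Real.rpow_neg_one]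
      refine le_of_eq ?_
      have := h.ne'
      change η j * p i j * (ζ i ^ α * (η j)⁻¹) = ζ i ^ α * 1 * p i j
      field_simp
  rw [e1]
  refine key.trans ?_
  rw [← e2]
  have h5 : 0 ≤ ∑ q : x × x, η q.2 * p q.1 q.2 * (ζ q.1 * η q.2 ^ (s - 1)) ^ α :=
    Finset.sum_nonneg fun q _ => mul_nonneg (mul_nonneg (hη _) (hp _ _))
      (Real.rpow_nonneg (mul_nonneg (hζ _) (Real.rpow_nonneg (hη _) _)) _)
  exact mul_le_mul_of_nonneg_left (Real.rpow_le_rpow h5 e3 (by linarith))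
    (Real.rpow_nonneg (re_trace_nonneg hτ) _)

/-! ### Continuity of the functional calculus -/

/-- Near `A` all spectra lie in the compact interval `[0, ‖A‖ + 1]`, where continuity of `f` gives
continuity of the calculus. -/
theorem continuousOn_cfc_posSemidef {f : ℝ → ℝ} (hf : ContinuousOn f (Set.Ici 0)) :
    ContinuousOn (fun A : Matrix x x ℂ => cfc f A) {A | A.PosSemidef} := by
  intro A hA
  have h := continuousOn_cfc (𝕜 := ℝ) (Matrix x x ℂ) (p := IsSelfAdjoint)
    (isCompact_Icc (a := (0 : ℝ)) (b := ‖A‖ + 1)) f (hf.mono fun t ht => ht.1)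
  have hball : ∀ᶠ B in 𝓝 A, ‖B‖ < ‖A‖ + 1 :=
    (continuous_norm.tendsto A).eventually (gt_mem_nhds (by linarith))
  have hmem : ∀ B : Matrix x x ℂ, B.PosSemidef → ‖B‖ < ‖A‖ + 1 →
      B ∈ {a : Matrix x x ℂ | IsSelfAdjoint a ∧ spectrum ℝ a ⊆ Set.Icc 0 (‖A‖ + 1)} := by
    refine fun B hB hn => ⟨hB.isHermitian.isSelfAdjoint, fun t ht => ⟨spectrum_nonneg hB ht, ?_⟩⟩
    by_cases hx : Nonempty x
    · have := spectrum.norm_le_norm_of_mem ht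
      linarith [Real.le_norm_self t]
    · have : IsEmpty x := not_nonempty_iff.mp hx
      exact absurd ht (by
        rw [spectrum.of_subsingleton]
        simp)
  refine (h A (hmem A hA (by linarith))).mono_of_mem_nhdsWithin ?_
  filter_upwards [nhdsWithin_le_nhds hball, self_mem_nhdsWithin] with B h1 h2
  exact hmem B h2 h1

theorem continuousOn_matPow {s : ℝ} (hs : 0 ≤ s) :
    ContinuousOn (fun A : Matrix x x ℂ => matPow A s) {A | A.PosSemidef} :=
  continuousOn_cfc_posSemidef fun _ _ =>
    (Real.continuousAt_rpow_const _ _ (Or.inr hs)).continuousWithinAt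

theorem continuousOn_shiftedPow {δ : ℝ} (hδ : 0 < δ) (s : ℝ) :
    ContinuousOn (fun A : Matrix x x ℂ => shiftedPow A δ s) {A | A.PosSemidef} := by
  refine continuousOn_cfc_posSemidef fun t ht => ContinuousAt.continuousWithinAt ?_
  have ht' : (0 : ℝ) ≤ t := ht
  exact ContinuousAt.rpow_const (by fun_prop) (Or.inl (by linarith))

/-! ### The set of states -/

theorem le_one_of_isState {τ : Matrix x x ℂ} (hτ : IsState τ) : τ ≤ 1 := by
  have h := hτ.1.isHermitian
  have hsum : ∑ i, h.eigenvalues i = 1 := by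
    have h1 := trace_cfc h fun t => t
    rw [cfc_id_eq h, hτ.2] at h1
    exact_mod_cast h1.symm
  rw [← cfc_id_eq h, ← cfc_const_one ℝ τ h.isSelfAdjoint]
  refine cfc_le_cfc fun t ht => ?_
  obtain ⟨i, rfl⟩ := h.spectrum_real_eq_range_eigenvalues ▸ ht
  rw [← hsum]
  exact Finset.single_le_sum (fun j _ => hτ.1.eigenvalues_nonneg j) (Finset.mem_univ i)

theorem isCompact_setOf_isState : IsCompact {τ : Matrix x x ℂ | IsState τ} := by
  have : ProperSpace (Matrix x x ℂ) := FiniteDimensional.proper ℂ _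
  have hcl : IsClosed {τ : Matrix x x ℂ | IsState τ} := by
    have h1 : IsClosed {τ : Matrix x x ℂ | 0 ≤ τ} := CStarAlgebra.isClosed_nonneg
    have h2 : IsClosed {τ : Matrix x x ℂ | τ.trace = 1} :=
      isClosed_eq (continuous_id.matrix_trace) continuous_const
    have h3 : {τ : Matrix x x ℂ | IsState τ} =
        {τ : Matrix x x ℂ | 0 ≤ τ} ∩ {τ : Matrix x x ℂ | τ.trace = 1} := by
      ext τ
      simp [IsState, Matrix.nonneg_iff_posSemidef]
    rw [h3]
    exact h1.inter h2
  refine Metric.isCompact_of_isClosed_isBounded hcl ?_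
  refine (Metric.isBounded_closedBall (x := (0 : Matrix x x ℂ)) (r := 1)).subset fun τ hτ => ?_
  rw [mem_closedBall_zero_iff]
  exact (CStarAlgebra.norm_le_one_iff_of_nonneg τ hτ.1.nonneg).mpr (le_one_of_isState hτ)

theorem isState_smul {A : Matrix x x ℂ} (hA : A.PosSemidef) (h : A.trace.re ≠ 0) :
    IsState (A.trace.re⁻¹ • A) := by
  have h0 : 0 ≤ A.trace.re := re_trace_nonneg hA
  refine ⟨hA.smul (inv_nonneg.mpr h0), ?_⟩
  rw [Matrix.trace_smul, trace_eq_re hA.isHermitian, Complex.ofReal_re, Complex.real_smul,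
    ← Complex.ofReal_mul, inv_mul_cancel₀ h, Complex.ofReal_one]

theorem exists_isState [Nonempty x] : ∃ τ : Matrix x x ℂ, IsState τ :=
  ⟨_, isState_smul (A := (1 : Matrix x x ℂ)) Matrix.PosSemidef.one (by simp)⟩

theorem isState_convex {A B : Matrix x x ℂ} (hA : IsState A) (hB : IsState B) {u : ℝ}
    (hu : u ∈ Set.Icc (0 : ℝ) 1) : IsState ((1 - u) • A + u • B) := by
  refine ⟨(hA.1.smul (by linarith [hu.2])).add (hB.1.smul hu.1), ?_⟩
  rw [Matrix.trace_add, Matrix.trace_smul, Matrix.trace_smul, hA.2, hB.2, ← add_smul]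
  simp

theorem isState_re {A : Matrix x x ℂ} (hA : IsState A) : A.trace.re = 1 := by
  rw [hA.2, Complex.one_re]

theorem isState_transpose {A : Matrix x x ℂ} (hA : IsState A) : IsState Aᵀ :=
  ⟨hA.1.transpose, by rw [Matrix.trace_transpose, hA.2]⟩

theorem re_trace_matPow_eq_zero {A : Matrix x x ℂ} (hA : A.PosSemidef) {s : ℝ}
    (h : (matPow A s).trace.re = 0) : A = 0 := by
  have h1 := eq_zero_of_re_trace_eq_zero (posSemidef_matPow hA s) h
  have h2 : A = matPow A s * cfc (fun t : ℝ => t / t ^ s) A := by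
    rw [matPow, cfc_mul_cfc]
    nth_rewrite 1 [← cfc_id_eq hA.isHermitian]
    refine cfc_congr_nonneg hA fun t ht => ?_
    rcases ht.eq_or_lt with rfl | h
    · simp
    · have := (Real.rpow_pos_of_pos h s).ne'
      field_simp
  rw [h2, h1, Matrix.zero_mul]

/-! ### The compressed power and its trace functional -/

/-- The operator `H^* (1 ⊗ τ) H` for `H : ℂ^z → ℂ^x ⊗ ℂ^y`. -/
noncomputable def compress (H : Matrix (x × y) z ℂ) (τ : Matrix y y ℂ) : Matrix z z ℂ :=
  Hᴴ * ((1 : Matrix x x ℂ) ⊗ₖ τ) * H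

theorem posSemidef_compress (H : Matrix (x × y) z ℂ) {τ : Matrix y y ℂ} (hτ : τ.PosSemidef) :
    (compress H τ).PosSemidef :=
  (Matrix.PosSemidef.one.kronecker hτ).conjTranspose_mul_mul_same H

theorem compress_add (H : Matrix (x × y) z ℂ) (τ ω : Matrix y y ℂ) :
    compress H (τ + ω) = compress H τ + compress H ω := by
  simp only [compress, Matrix.kronecker_add, Matrix.mul_add, Matrix.add_mul]

theorem compress_smul (H : Matrix (x × y) z ℂ) (r : ℝ) (τ : Matrix y y ℂ) :
    compress H (r • τ) = r • compress H τ := by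
  simp only [compress, Matrix.kronecker_smul, Matrix.mul_smul, Matrix.smul_mul]

theorem compress_sub (H : Matrix (x × y) z ℂ) (τ ω : Matrix y y ℂ) :
    compress H (τ - ω) = compress H τ - compress H ω := by
  rw [eq_sub_iff_add_eq, ← compress_add, sub_add_cancel]

theorem compress_le_compress (H : Matrix (x × y) z ℂ) {τ ω : Matrix y y ℂ} (h : τ ≤ ω) :
    compress H τ ≤ compress H ω := by
  have := posSemidef_compress H (Matrix.le_iff.mp h)
  rwa [compress_sub] at this

theorem continuous_compress (H : Matrix (x × y) z ℂ) : Continuous (compress H) := by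
  have h : Continuous fun τ : Matrix y y ℂ => (1 : Matrix x x ℂ) ⊗ₖ τ := by
    refine continuous_matrix fun p q => ?_
    simp only [Matrix.kroneckerMap_apply]
    exact continuous_const.mul (continuous_id.matrix_elem _ _)
  exact (continuous_const.matrix_mul h).matrix_mul continuous_const

theorem tendsto_of_continuousOn {ι X Y : Type*} [TopologicalSpace X] [TopologicalSpace Y]
    {l : Filter ι} {F : X → Y} {S : Set X} (hF : ContinuousOn F S) {A : ι → X} {A' : X}
    (hA' : A' ∈ S) (hA : Tendsto A l (𝓝 A')) (h : ∀ᶠ i in l, A i ∈ S) :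
    Tendsto (fun i => F (A i)) l (𝓝 (F A')) :=
  (hF A' hA').tendsto.comp (tendsto_nhdsWithin_iff.mpr ⟨hA, h⟩)

theorem continuous_re_trace : Continuous fun A : Matrix x x ℂ => A.trace.re :=
  Complex.continuous_re.comp continuous_id.matrix_trace

/-- The normalised power `X^β / tr X^β`. -/
noncomputable def normPow (X : Matrix x x ℂ) (β : ℝ) : Matrix x x ℂ :=
  (matPow X β).trace.re⁻¹ • matPow X β

theorem isState_normPow {X : Matrix x x ℂ} (hX : X.PosSemidef) (h0 : X ≠ 0) (β : ℝ) :
    IsState (normPow X β) :=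
  isState_smul (posSemidef_matPow hX β) fun h => h0 (re_trace_matPow_eq_zero hX h)

/-- The state proportional to `X^β` is the equality case of reverse Hölder: without the shift
`σ^{-s} X = q^s X^β`, of trace `q^{1+s}`, and the shift only lowers the trace. -/
theorem shiftedPow_normPow_le {X : Matrix x x ℂ} (hX : X.PosSemidef) (h0 : X ≠ 0) {δ s β : ℝ}
    (hδ : 0 < δ) (hs : 0 < s) (hβ : β = (1 + s)⁻¹) :
    (shiftedPow (normPow X β) δ (-s) * X).trace.re ≤ (matPow X β).trace.re ^ (1 + s) := by
  set q := (matPow X β).trace.re with hq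
  have hq0 : 0 < q := lt_of_le_of_ne (re_trace_matPow_nonneg hX β)
    fun h => h0 (re_trace_matPow_eq_zero hX h.symm)
  have hβs : 1 + β * -s = β := by
    rw [hβ]
    field_simp
    ring
  have h1 : shiftedPow (normPow X β) δ (-s) = cfc (fun t : ℝ => (q⁻¹ * t ^ β + δ) ^ (-s)) X := by
    have h2 : normPow X β = cfc (fun t : ℝ => q⁻¹ * t ^ β) X := by
      rw [normPow, ← hq, matPow, ← cfc_smul q⁻¹ (fun t : ℝ => t ^ β) X (continuousOn_spectrum _ _)]
      rfl
    rw [h2, shiftedPow]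
    exact (cfc_comp (fun t : ℝ => (t + δ) ^ (-s)) (fun t : ℝ => q⁻¹ * t ^ β) X
      hX.isHermitian.isSelfAdjoint (((Matrix.finite_real_spectrum (A := X)).image _).continuousOn _)
      (continuousOn_spectrum X _)).symm
  have h3 : cfc (fun t : ℝ => (q⁻¹ * t ^ β + δ) ^ (-s)) X * X ≤ q ^ s • matPow X β := by
    rw [cfc_mul_self hX.isHermitian, matPow,
      ← cfc_smul (q ^ s) (fun t : ℝ => t ^ β) X (continuousOn_spectrum _ _)]
    refine cfc_le_cfc fun t ht => ?_
    rcases (spectrum_nonneg hX ht).eq_or_lt with rfl | ht0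
    · rw [mul_zero, Real.zero_rpow (by rw [hβ]; positivity), smul_zero]
    · have hpos : 0 < q⁻¹ * t ^ β := by positivity
      calc (q⁻¹ * t ^ β + δ) ^ (-s) * t ≤ (q⁻¹ * t ^ β) ^ (-s) * t := by
            refine mul_le_mul_of_nonneg_right ?_ ht0.le
            exact Real.rpow_le_rpow_of_nonpos hpos (by linarith) (by linarith)
        _ = q ^ s * (t ^ (β * -s) * t) := by
            rw [Real.mul_rpow (inv_nonneg.mpr hq0.le) (by positivity), ← Real.rpow_mul ht0.le,
              Real.inv_rpow hq0.le, Real.rpow_neg hq0.le, inv_inv, mul_assoc]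
        _ = q ^ s • t ^ β := by
            nth_rewrite 2 [← Real.rpow_one t]
            rw [← Real.rpow_add ht0, add_comm (β * -s), hβs, smul_eq_mul]
  rw [h1]
  refine (re_trace_le h3).trans_eq ?_
  rw [Matrix.trace_smul, Complex.smul_re, ← hq, smul_eq_mul, add_comm 1 s, Real.rpow_add hq0,
    Real.rpow_one]

/-- The minimax theorem behind the duality of the sandwiched Rényi conditional entropies: there are
an optimal `τ` for `tr [(H^* (1 ⊗ τ^s) H)^β]` and a matching `σ`. -/
theorem exists_saddle [Nonempty y] [Nonempty z] (H : Matrix (x × y) z ℂ) {s β : ℝ}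
    (hs : 0 < s) (hs1 : s ≤ 1) (hβ : β = (1 + s)⁻¹) :
    ∃ (σ : Matrix z z ℂ) (τ' : Matrix y y ℂ), IsState σ ∧ IsState τ' ∧
      ∀ τ : Matrix y y ℂ, IsState τ → ∀ δ : ℝ, 0 < δ →
        (shiftedPow σ δ (-s) * compress H (matPow τ s)).trace.re ≤
          (matPow (compress H (matPow τ' s)) β).trace.re ^ (1 + s) := by
  have hβ0 : 0 < β := by rw [hβ]; positivity
  set X : Matrix y y ℂ → Matrix z z ℂ := fun τ => compress H (matPow τ s) with hXdef
  have hX : ∀ τ, IsState τ → (X τ).PosSemidef := fun τ hτ =>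
    posSemidef_compress H (posSemidef_matPow hτ.1 s)
  have hXc : ContinuousOn X {τ | IsState τ} :=
    (continuous_compress H).comp_continuousOn ((continuousOn_matPow hs.le).mono fun τ hτ => hτ.1)
  have hgc : ContinuousOn (fun τ => (matPow (X τ) β).trace.re) {τ | IsState τ} :=
    continuous_re_trace.comp_continuousOn ((continuousOn_matPow hβ0.le).comp hXc hX)
  obtain ⟨τ', hτ', hmax⟩ := isCompact_setOf_isState.exists_isMaxOn exists_isState hgc
  have hτ'S : IsState τ' := hτ'
  have hmax' : ∀ τ, IsState τ → (matPow (X τ) β).trace.re ≤ (matPow (X τ') β).trace.re :=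
    fun τ hτ => hmax hτ
  set q := (matPow (X τ') β).trace.re with hq
  have hq_nonneg : 0 ≤ q := re_trace_matPow_nonneg (hX _ hτ'S) _
  -- If the maximum is zero, then `X` vanishes at every state and any `σ` will do. Otherwise `X τ'`
  -- can be normalised.
  by_cases h0 : X τ' = 0
  · obtain ⟨σ, hσ⟩ := exists_isState (x := z)
    refine ⟨σ, τ', hσ, hτ'S, fun τ hτ δ hδ => ?_⟩
    have hq0 : q = 0 := by rw [hq, h0, matPow_zero_matrix hβ0.ne']; simp
    have h1 : X τ = 0 := re_trace_matPow_eq_zero (hX τ hτ)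
      (le_antisymm (hq0 ▸ hmax' τ hτ) (re_trace_matPow_nonneg (hX τ hτ) β))
    change (_ * X τ).trace.re ≤ _
    rw [h1]
    simp only [Matrix.mul_zero, Matrix.trace_zero, Complex.zero_re]
    positivity
  have hq_pos : 0 < q := lt_of_le_of_ne hq_nonneg
    fun h => h0 (re_trace_matPow_eq_zero (hX _ hτ'S) h.symm)
  refine ⟨normPow (X τ') β, τ', isState_normPow (hX _ hτ'S) h0 β, hτ'S, fun τ hτ δ hδ => ?_⟩
  change (_ * X τ).trace.re ≤ _
  -- Perturbation towards `τ`. The state `σ` optimal for `X (τu u)` gives a value at most `q^{1+s}`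
  -- there; by concavity of `X` this value dominates the mixture of the values at `τ'` and `τ`.
  -- Reverse Hölder makes the value at `τ'` essentially at least `q^{1+s}`, so the value at `τ` is
  -- at most `q^{1+s}`.
  set τu : ℝ → Matrix y y ℂ := fun u => (1 - u) • τ' + u • τ with hτu
  have hτuS : ∀ u ∈ Set.Ioo (0 : ℝ) 1, IsState (τu u) := fun u hu =>
    isState_convex hτ'S hτ ⟨hu.1.le, hu.2.le⟩
  have hXu : ∀ u ∈ Set.Ioo (0 : ℝ) 1, (1 - u) • X τ' + u • X τ ≤ X (τu u) := by
    intro u hu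
    have := compress_le_compress H
      (matPow_concave hτ'S.1 hτ.1 ⟨hs.le, hs1⟩ (u := u) ⟨hu.1.le, hu.2.le⟩)
    rwa [compress_add, compress_smul, compress_smul] at this
  have hXu0 : ∀ u ∈ Set.Ioo (0 : ℝ) 1, X (τu u) ≠ 0 := by
    intro u hu h
    have h1 := hXu u hu
    rw [h] at h1
    have h2 : (1 - u) • X τ' ≤ 0 := by
      refine le_trans ?_ h1
      exact le_add_of_nonneg_right ((hX τ hτ).smul hu.1.le).nonneg
    have h3 : (1 - u) • X τ' = 0 :=
      le_antisymm h2 ((hX τ' hτ'S).smul (by linarith [hu.2])).nonneg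
    exact (smul_ne_zero (by linarith [hu.2]) h0) h3
  -- the bound along the segment
  have hseg : ∀ u ∈ Set.Ioo (0 : ℝ) 1,
      (shiftedPow (normPow (X (τu u)) β) δ (-s) * X τ).trace.re ≤ q ^ (1 + s) := by
    intro u hu
    set σ := normPow (X (τu u)) β with hσ
    have hσS : IsState σ := isState_normPow (hX _ (hτuS u hu)) (hXu0 u hu) β
    -- Two separate shifts: `δ` stays fixed in the conclusion while the error in reverse Hölder is
    -- governed by `η`. Letting `η → 0` at fixed `u` removes this error before the division by `u`.
    have hbound : ∀ η : ℝ, 0 < η → η < δ → u * (shiftedPow σ δ (-s) * X τ).trace.re ≤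
        q ^ (1 + s) - (1 - u) * (q ^ (1 + s) / (1 + η * Fintype.card z) ^ s) := by
      intro η hη hηδ
      have hS := posSemidef_shiftedPow hσS.1 hη.le (-s)
      have b1 : (shiftedPow σ η (-s) * X (τu u)).trace.re ≤ q ^ (1 + s) :=
        (shiftedPow_normPow_le (hX _ (hτuS u hu)) (hXu0 u hu) hη hs hβ).trans
          (Real.rpow_le_rpow (re_trace_matPow_nonneg (hX _ (hτuS u hu)) _) (hmax' _ (hτuS u hu))
            (by linarith))
      have b2 : (1 - u) * (shiftedPow σ η (-s) * X τ').trace.re +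
          u * (shiftedPow σ η (-s) * X τ).trace.re ≤
          (shiftedPow σ η (-s) * X (τu u)).trace.re := by
        have := re_trace_mul_le (hXu u hu) hS
        rw [Matrix.trace_mul_comm, Matrix.trace_mul_comm (X (τu u)), Matrix.mul_add,
          Matrix.mul_smul, Matrix.mul_smul, Matrix.trace_add, Matrix.trace_smul,
          Matrix.trace_smul] at this
        simpa using this
      have b3 := reverse_holder hσS.1 (hX τ' hτ'S) hη hs hβ
      rw [isState_re hσS, ← hq] at b3
      have hc : (0 : ℝ) < 1 + η * Fintype.card z := by positivity
      have hT : 0 ≤ (shiftedPow σ η (-s) * X τ').trace.re :=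
        re_trace_mul_nonneg hS (hX τ' hτ'S)
      have b4 : q ^ (1 + s) / (1 + η * Fintype.card z) ^ s ≤
          (shiftedPow σ η (-s) * X τ').trace.re := by
        rw [div_le_iff₀ (by positivity)]
        have b5 := Real.rpow_le_rpow hq_nonneg b3 (by linarith : 0 ≤ 1 + s)
        rw [Real.mul_rpow (by positivity) (by positivity), ← Real.rpow_mul hc.le,
          ← Real.rpow_mul hT] at b5
        have e1 : (1 - β) * (1 + s) = s := by
          rw [hβ]
          field_simp
          ring
        have e2 : β * (1 + s) = 1 := by
          rw [hβ]
          field_simp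
        rw [e1, e2, Real.rpow_one] at b5
        linarith
      have b6 : (shiftedPow σ δ (-s) * X τ).trace.re ≤ (shiftedPow σ η (-s) * X τ).trace.re := by
        refine re_trace_mul_le (cfc_le_cfc fun t ht => ?_) (hX τ hτ)
        have ht0 := spectrum_nonneg hσS.1 ht
        exact Real.rpow_le_rpow_of_nonpos (by linarith) (by linarith) (by linarith)
      have b7 := mul_le_mul_of_nonneg_left b6 hu.1.le
      have b8 := mul_le_mul_of_nonneg_left b4 (by linarith [hu.2] : 0 ≤ 1 - u)
      linarith
    have hlim : Tendsto (fun η : ℝ =>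
        q ^ (1 + s) - (1 - u) * (q ^ (1 + s) / (1 + η * Fintype.card z) ^ s)) (𝓝[>] 0)
        (𝓝 (q ^ (1 + s) - (1 - u) * (q ^ (1 + s) / (1 + 0 * Fintype.card z) ^ s))) := by
      refine Tendsto.mono_left ?_ nhdsWithin_le_nhds
      refine ContinuousAt.tendsto (f := fun η : ℝ =>
        q ^ (1 + s) - (1 - u) * (q ^ (1 + s) / (1 + η * Fintype.card z) ^ s)) (x := 0) ?_
      refine continuousAt_const.sub (continuousAt_const.mul (continuousAt_const.div
        (ContinuousAt.rpow_const (by fun_prop) (Or.inl (by simp))) (by simp)))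
    have hle := ge_of_tendsto hlim (by
      filter_upwards [Ioo_mem_nhdsGT hδ] with η hη
      exact hbound η hη.1 hη.2)
    rw [zero_mul, add_zero, Real.one_rpow, div_one] at hle
    have : u * (shiftedPow σ δ (-s) * X τ).trace.re ≤ u * q ^ (1 + s) := by linarith
    exact le_of_mul_le_mul_left this hu.1
  -- the limit at the optimiser
  have hev : ∀ᶠ u in 𝓝[>] (0 : ℝ), u ∈ Set.Ioo (0 : ℝ) 1 := Ioo_mem_nhdsGT one_pos
  have l1 : Tendsto τu (𝓝[>] 0) (𝓝 τ') := by
    have : Tendsto τu (𝓝 0) (𝓝 (τu 0)) := by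
      refine Continuous.tendsto ?_ 0
      exact ((continuous_const.sub continuous_id).smul continuous_const).add
        (continuous_id.smul continuous_const)
    simp only [hτu, sub_zero, one_smul, zero_smul, add_zero] at this
    exact this.mono_left nhdsWithin_le_nhds
  have l2 : Tendsto (fun u => X (τu u)) (𝓝[>] 0) (𝓝 (X τ')) :=
    tendsto_of_continuousOn hXc hτ'S l1 (hev.mono fun u hu => hτuS u hu)
  have l3 : Tendsto (fun u => matPow (X (τu u)) β) (𝓝[>] 0) (𝓝 (matPow (X τ') β)) :=
    tendsto_of_continuousOn (continuousOn_matPow hβ0.le) (hX τ' hτ'S) l2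
      (hev.mono fun u hu => hX _ (hτuS u hu))
  have l4 : Tendsto (fun u => normPow (X (τu u)) β) (𝓝[>] 0) (𝓝 (normPow (X τ') β)) :=
    Tendsto.smul (((continuous_re_trace.tendsto _).comp l3).inv₀ hq_pos.ne') l3
  have l5 : Tendsto (fun u => shiftedPow (normPow (X (τu u)) β) δ (-s)) (𝓝[>] 0)
      (𝓝 (shiftedPow (normPow (X τ') β) δ (-s))) :=
    tendsto_of_continuousOn (continuousOn_shiftedPow hδ (-s))
      (isState_normPow (hX _ hτ'S) h0 β).1 l4
      (hev.mono fun u hu => (isState_normPow (hX _ (hτuS u hu)) (hXu0 u hu) β).1)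
  have l6 : Tendsto (fun u => (shiftedPow (normPow (X (τu u)) β) δ (-s) * X τ).trace.re) (𝓝[>] 0)
      (𝓝 (shiftedPow (normPow (X τ') β) δ (-s) * X τ).trace.re) :=
    (continuous_re_trace.tendsto _).comp (l5.mul tendsto_const_nhds)
  exact le_of_tendsto l6 (hev.mono hseg)

/-! ### Changing the cut of a tripartite vector -/

/-- A vector of `ℂ^x ⊗ ℂ^y ⊗ ℂ^z`, as a matrix from `ℂ^z` to `ℂ^x ⊗ ℂ^y`, becomes a matrix from
`ℂ^y` to `ℂ^x ⊗ ℂ^z`. -/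
def swapCut (G : Matrix (x × y) z ℂ) : Matrix (x × z) y ℂ :=
  Matrix.of fun p j => G (p.1, j) p.2

theorem swapCut_swapCut (G : Matrix (x × y) z ℂ) : swapCut (swapCut G) = G := rfl

/-- Both sides are the same contraction of the tensor `G` with its conjugate. The transposes arise
because each cut reads one of the legs `y`, `z` as an input. -/
theorem trace_swapCut (G : Matrix (x × y) z ℂ) (S : Matrix y y ℂ) (T : Matrix z z ℂ) :
    (((1 : Matrix x x ℂ) ⊗ₖ Sᵀ) * (G * Tᵀ * Gᴴ)).trace =
      (S * compress (swapCut G) T).trace := by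
  simp only [compress, Matrix.trace, Matrix.diag_apply, Matrix.mul_apply, swapCut, Matrix.of_apply,
    Matrix.kroneckerMap_apply, Matrix.transpose_apply, Matrix.conjTranspose_apply,
    Fintype.sum_prod_type, Matrix.one_apply, ite_mul, one_mul, zero_mul, mul_ite, mul_zero,
    Finset.sum_ite_eq, Finset.sum_ite_eq', Finset.mem_univ, if_true, Finset.sum_ite_irrel,
    Finset.sum_const_zero, Finset.mul_sum, Finset.sum_mul]
  rw [Finset.sum_comm, Finset.sum_congr rfl fun i _ => Finset.sum_comm, Finset.sum_comm]
  refine Finset.sum_congr rfl fun j _ => Finset.sum_congr rfl fun i _ =>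
    Finset.sum_congr rfl fun k _ => ?_
  rw [Finset.sum_comm]
  refine Finset.sum_congr rfl fun l _ => Finset.sum_congr rfl fun m _ => ?_
  ring

/-! ### The binary logarithm -/

theorem log_two_pos : (0 : EReal) < ((Real.log 2 : ℝ) : EReal) :=
  EReal.coe_pos.mpr (Real.log_pos (by norm_num))

theorem log2_le_log2 {s t : ℝ≥0∞} : log2 s ≤ log2 t ↔ s ≤ t := by
  have h : StrictMono log2 := fun a b hab =>
    EReal.strictMono_div_right_of_pos log_two_pos (EReal.coe_ne_top _) (ENNReal.log_strictMono hab)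
  exact h.le_iff_le

theorem log2_rpow (t : ℝ≥0∞) (r : ℝ) : log2 (t ^ r) = (r : EReal) * log2 t := by
  rw [log2, log2, ENNReal.log_rpow, EReal.mul_div]

theorem log2_surjective : Function.Surjective log2 := by
  intro d
  obtain ⟨t, ht⟩ := ENNReal.log_surjective (d * ((Real.log 2 : ℝ) : EReal))
  refine ⟨t, ?_⟩
  rw [log2, ht, EReal.div_eq_iff (EReal.coe_ne_bot _) (EReal.coe_ne_top _) log_two_pos.ne']

theorem log2_top : log2 ⊤ = ⊤ := by
  rw [log2, ENNReal.log_top, EReal.top_div_of_pos_ne_top log_two_pos (EReal.coe_ne_top _)]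

/-! ### Supports -/

/-- The projection onto the support of a Hermitian matrix. -/
noncomputable def suppProj (σ : Matrix x x ℂ) : Matrix x x ℂ :=
  cfc (fun t : ℝ => if t = 0 then 0 else 1) σ

theorem isHermitian_suppProj (σ : Matrix x x ℂ) : (suppProj σ).IsHermitian :=
  isHermitian_cfc _ _

theorem suppProj_mul_self {σ : Matrix x x ℂ} (hσ : σ.IsHermitian) : suppProj σ * σ = σ := by
  rw [suppProj, cfc_mul_self hσ]
  nth_rewrite 2 [← cfc_id_eq hσ]
  refine cfc_congr fun t _ => ?_
  split_ifs with h <;> simp [h]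

/-- The projection onto the kernel of a Hermitian matrix. -/
noncomputable def kerProj (σ : Matrix x x ℂ) : Matrix x x ℂ :=
  cfc (fun t : ℝ => if t = 0 then 1 else 0) σ

theorem isHermitian_kerProj (σ : Matrix x x ℂ) : (kerProj σ).IsHermitian :=
  isHermitian_cfc _ _

theorem posSemidef_kerProj (σ : Matrix x x ℂ) : (kerProj σ).PosSemidef :=
  posSemidef_cfc fun t _ => by positivity

theorem kerProj_mul_kerProj (σ : Matrix x x ℂ) : kerProj σ * kerProj σ = kerProj σ := by
  rw [kerProj, cfc_mul_cfc]
  refine cfc_congr fun t _ => ?_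
  split_ifs <;> simp

theorem kerProj_add_suppProj {σ : Matrix x x ℂ} (hσ : σ.IsHermitian) :
    kerProj σ + suppProj σ = 1 := by
  rw [kerProj, suppProj, ← cfc_add _ _ _ (continuousOn_spectrum _ _) (continuousOn_spectrum _ _),
    ← cfc_const_one ℝ σ hσ.isSelfAdjoint]
  refine cfc_congr fun t _ => ?_
  split_ifs <;> simp

theorem kerProj_mul_self {σ : Matrix x x ℂ} (hσ : σ.IsHermitian) : kerProj σ * σ = 0 := by
  have h := congrArg (· * σ) (kerProj_add_suppProj hσ)
  simpa [Matrix.add_mul, suppProj_mul_self hσ] using h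

/-- The trace is the squared Hilbert–Schmidt norm of `kerProj σ * G`. A support condition thereby
becomes a scalar one that passes to limits. -/
theorem kerProj_mul_eq_zero_iff {σ : Matrix x x ℂ} (G : Matrix x y ℂ) :
    kerProj σ * G = 0 ↔ (kerProj σ * (G * Gᴴ)).trace.re = 0 := by
  constructor
  · intro h
    rw [← Matrix.mul_assoc, h, Matrix.zero_mul, Matrix.trace_zero, Complex.zero_re]
  · intro h
    have h1 : ((kerProj σ * G) * (kerProj σ * G)ᴴ).trace.re = 0 := by
      rw [Matrix.conjTranspose_mul, (isHermitian_kerProj σ).eq, Matrix.mul_assoc,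
        ← Matrix.mul_assoc G, ← Matrix.mul_assoc, Matrix.trace_mul_comm, ← Matrix.mul_assoc,
        kerProj_mul_kerProj, h]
    have h2 := eq_zero_of_re_trace_eq_zero (Matrix.posSemidef_self_mul_conjTranspose _) h1
    exact Matrix.self_mul_conjTranspose_eq_zero.mp h2

theorem suppLE_iff {σ : Matrix x x ℂ} (hσ : σ.IsHermitian) (G : Matrix x y ℂ) :
    SuppLE (G * Gᴴ) σ ↔ kerProj σ * G = 0 := by
  constructor
  · intro h
    have h1 : kerProj σ * (G * Gᴴ) = 0 := by
      refine Matrix.ext_of_mulVec_single fun j => ?_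
      have hmem : (G * Gᴴ) *ᵥ Pi.single j 1 ∈ LinearMap.range σ.mulVecLin :=
        h ⟨Pi.single j 1, rfl⟩
      obtain ⟨v, hv⟩ := hmem
      rw [Matrix.mulVecLin_apply] at hv
      rw [← Matrix.mulVec_mulVec, ← hv, Matrix.mulVec_mulVec, kerProj_mul_self hσ]
      simp only [Matrix.zero_mulVec]
    rw [kerProj_mul_eq_zero_iff, h1]
    simp
  · intro h
    have h1 : G * Gᴴ = σ * (cfc (fun t : ℝ => t⁻¹) σ * (G * Gᴴ)) := by
      have h2 : suppProj σ * G = G := by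
        have h3 := congrArg (· * G) (kerProj_add_suppProj hσ)
        simpa [Matrix.add_mul, h] using h3
      have h4 : σ * cfc (fun t : ℝ => t⁻¹) σ = suppProj σ := by
        rw [self_mul_cfc hσ, suppProj]
        refine cfc_congr fun t _ => ?_
        by_cases ht : t = 0 <;> simp [ht]
      rw [← Matrix.mul_assoc, h4, ← Matrix.mul_assoc, h2]
    rintro _ ⟨v, rfl⟩
    refine ⟨(cfc (fun t : ℝ => t⁻¹) σ * (G * Gᴴ)) *ᵥ v, ?_⟩
    rw [Matrix.mulVecLin_apply, Matrix.mulVecLin_apply, Matrix.mulVec_mulVec, ← h1]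

/-! ### Rényi relative entropies of `G G^*` -/

/-- With `L = T^{r/2} G` the two operators are `L L^*` and `L^* L`. -/
theorem trace_sandwich {T : Matrix x x ℂ} (hT : T.PosSemidef) (G : Matrix x y ℂ) (r : ℝ) {α : ℝ}
    (hα : α ≠ 0) :
    (matPow (matPow T (r / 2) * (G * Gᴴ) * matPow T (r / 2)) α).trace =
      (matPow (Gᴴ * matPow T r * G) α).trace := by
  set L := matPow T (r / 2) * G with hL
  have h1 : matPow T (r / 2) * (G * Gᴴ) * matPow T (r / 2) = L * Lᴴ := by
    rw [hL, Matrix.conjTranspose_mul, (isHermitian_matPow T _).eq]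
    simp only [Matrix.mul_assoc]
  have h2 : Gᴴ * matPow T r * G = Lᴴ * L := by
    rw [hL, Matrix.conjTranspose_mul, (isHermitian_matPow T _).eq, ← matPow_half_mul_half hT]
    simp only [Matrix.mul_assoc]
  rw [h1, h2]
  exact trace_cfc_mul_conj L (Real.zero_rpow hα)

theorem le_smul_one_iff {B : Matrix x x ℂ} (hB : B.IsHermitian) (c : ℝ) :
    B ≤ c • (1 : Matrix x x ℂ) ↔ ∀ t ∈ spectrum ℝ B, t ≤ c := by
  have h : c • (1 : Matrix x x ℂ) - B = cfc (fun t : ℝ => c - t) B := by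
    rw [cfc_sub _ _ _ (continuousOn_spectrum _ _) (continuousOn_spectrum _ _), cfc_id_eq hB,
      cfc_const c B hB.isSelfAdjoint, Algebra.algebraMap_eq_smul_one]
  rw [← sub_nonneg, h, cfc_nonneg_iff _ _ (continuousOn_spectrum _ _) hB.isSelfAdjoint]
  simp only [sub_nonneg]

/-- Conjugating the hypothesis by `L` gives `B² ≤ c B` for `B = L^* L`, so each eigenvalue satisfies
`t² ≤ c t`. -/
theorem conj_mul_le_smul_one {L : Matrix x y ℂ} {c : ℝ} (hc : 0 ≤ c)
    (h : L * Lᴴ ≤ c • (1 : Matrix x x ℂ)) : Lᴴ * L ≤ c • (1 : Matrix y y ℂ) := by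
  have hB := isHermitian_conj_mul_self L
  rw [le_smul_one_iff hB]
  have h1 : 0 ≤ c • (Lᴴ * L) - Lᴴ * L * (Lᴴ * L) := by
    refine sub_nonneg.mpr ((le_of_eq ?_).trans ((mul_conj_le h L).trans_eq ?_))
    · simp only [Matrix.mul_assoc]
    · rw [Matrix.mul_smul, Matrix.smul_mul, Matrix.mul_one]
  have h2 : c • (Lᴴ * L) - Lᴴ * L * (Lᴴ * L) = cfc (fun t : ℝ => c * t - t * t) (Lᴴ * L) := by
    rw [cfc_sub _ _ _ (continuousOn_spectrum _ _) (continuousOn_spectrum _ _),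
      cfc_const_mul c (fun t : ℝ => t) _ (continuousOn_spectrum _ _), ← cfc_mul_cfc, cfc_id_eq hB]
  rw [h2, cfc_nonneg_iff _ _ (continuousOn_spectrum _ _) hB.isSelfAdjoint] at h1
  intro t ht
  have ht1 := h1 t ht
  have ht0 := spectrum_nonneg (Matrix.posSemidef_conjTranspose_mul_self L) ht
  by_contra! hlt
  nlinarith

/-- It suffices to test on the normalised spectral projections of `B`. -/
theorem le_smul_one_of_trace {B : Matrix x x ℂ} (hB : B.PosSemidef) {c : ℝ}
    (h : ∀ τ, IsState τ → (B * τ).trace.re ≤ c) : B ≤ c • (1 : Matrix x x ℂ) := by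
  rw [le_smul_one_iff hB.isHermitian]
  intro t ht
  obtain ⟨i, hi⟩ := hB.isHermitian.spectrum_real_eq_range_eigenvalues ▸ ht
  set P := cfc (fun u : ℝ => if u = t then (1 : ℝ) else 0) B with hP
  have hPpos : P.PosSemidef := posSemidef_cfc fun u _ => by positivity
  have htr : P.trace.re ≠ 0 := by
    rw [hP, trace_cfc hB.isHermitian, Complex.re_sum]
    simp only [Complex.ofReal_re]
    refine (Finset.sum_pos' (fun j _ => by positivity) ⟨i, Finset.mem_univ _, ?_⟩).ne'
    simp [hi]
  have h1 := h _ (isState_smul hPpos htr)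
  have h2 : B * P = t • P := by
    rw [hP, self_mul_cfc hB.isHermitian,
      ← cfc_smul t _ _ (continuousOn_spectrum _ _)]
    refine cfc_congr fun u _ => ?_
    by_cases hu : u = t <;> simp [hu]
  rw [Matrix.mul_smul, h2, Matrix.trace_smul, Matrix.trace_smul, Complex.smul_re,
    Complex.smul_re, smul_eq_mul, smul_eq_mul] at h1
  have h3 : P.trace.re⁻¹ * (t * P.trace.re) = t := by field_simp
  linarith

theorem trace_conj_cycle (S : Matrix x x ℂ) (G : Matrix x y ℂ) (R : Matrix y y ℂ) :
    (S * (G * R * Gᴴ)).trace = (Gᴴ * S * G * R).trace := by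
  rw [← Matrix.mul_assoc, Matrix.trace_mul_comm]
  simp only [Matrix.mul_assoc]

/-- The endpoint `s = 1` of the variational formula. With `R = (T + δ)^{-1/2}`, the inequality `G
G^* ≤ c (T + δ)` means `(R G)(R G)^* ≤ c`, equivalently `(R G)^* (R G) ≤ c`, and the latter is
tested on states. Then `δ → 0`. -/
theorem Dmax_le_iff (G : Matrix x y ℂ) {T : Matrix x x ℂ} (hT : T.PosSemidef) {c : ℝ}
    (hc : 0 ≤ c) :
    Dmax (G * Gᴴ) T ≤ log2 (ENNReal.ofReal c) ↔ ∀ δ : ℝ, 0 < δ → ∀ τ : Matrix y y ℂ, IsState τ →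
      (shiftedPow T δ (-1) * (G * τ * Gᴴ)).trace.re ≤ c := by
  have hinv : ∀ δ : ℝ, 0 < δ → shiftedPow T δ (1 / 2) * shiftedPow T δ (1 / 2) =
      T + δ • (1 : Matrix x x ℂ) := by
    intro δ hδ
    rw [add_smul_one_eq_cfc hT.isHermitian, shiftedPow, cfc_mul_cfc]
    refine cfc_congr_nonneg hT fun t ht => ?_
    rw [← Real.rpow_add (by linarith), add_halves, Real.rpow_one]
  have hinv' : ∀ δ : ℝ, 0 < δ → shiftedPow T δ (-(1 / 2)) * shiftedPow T δ (-(1 / 2)) =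
      shiftedPow T δ (-1) := by
    intro δ hδ
    rw [shiftedPow, cfc_mul_cfc]
    refine cfc_congr_nonneg hT fun t ht => ?_
    rw [← Real.rpow_add (by linarith)]
    norm_num
  have hone : ∀ δ : ℝ, 0 < δ → shiftedPow T δ (-(1 / 2)) * (T + δ • (1 : Matrix x x ℂ)) *
      (shiftedPow T δ (-(1 / 2)))ᴴ = 1 := by
    intro δ hδ
    rw [← hinv δ hδ, (isHermitian_shiftedPow _ _ _).eq, ← Matrix.mul_assoc,
      shiftedPow_neg_mul hT hδ, Matrix.one_mul, shiftedPow_mul_neg hT hδ]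
  rw [Dmax, log2_le_log2]
  constructor
  · intro h δ hδ τ hτ
    -- The infimum in `Dmax` is not known to be attained, so an admissible constant is taken below
    -- an arbitrary `c' > c`.
    refine le_of_forall_gt_imp_ge_of_dense fun c' hc' => ?_
    have hlt := h.trans_lt (ENNReal.ofReal_lt_ofReal_iff (hc.trans_lt hc') |>.mpr hc')
    simp only [iInf_lt_iff] at hlt
    obtain ⟨d, ⟨hd, hdT⟩, hdc⟩ := hlt
    have hdc' : d < c' := (ENNReal.ofReal_lt_ofReal_iff (hc.trans_lt hc')).mp hdc
    set R := shiftedPow T δ (-(1 / 2)) with hR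
    have hRh : Rᴴ = R := (isHermitian_shiftedPow _ _ _).eq
    have h1 : G * Gᴴ ≤ d • (T + δ • (1 : Matrix x x ℂ)) := by
      refine (Matrix.le_iff.mpr hdT).trans ?_
      rw [smul_add]
      exact le_add_of_nonneg_right (((Matrix.PosSemidef.one).smul hδ.le).smul hd.le).nonneg
    have h2 : (R * G) * (R * G)ᴴ ≤ d • (1 : Matrix x x ℂ) := by
      have h3 := conj_mul_le h1 R
      rw [Matrix.mul_smul, Matrix.smul_mul, hone δ hδ] at h3
      refine (le_of_eq ?_).trans h3
      rw [Matrix.conjTranspose_mul]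
      simp only [Matrix.mul_assoc]
    have h4 := conj_mul_le_smul_one hd.le h2
    have h5 := re_trace_mul_le h4 hτ.1
    rw [Matrix.smul_mul, Matrix.one_mul, Matrix.trace_smul, hτ.2] at h5
    have h6 : (R * G)ᴴ * (R * G) = Gᴴ * shiftedPow T δ (-1) * G := by
      rw [Matrix.conjTranspose_mul, hRh, ← hinv' δ hδ]
      simp only [Matrix.mul_assoc, hR]
    rw [h6, ← trace_conj_cycle] at h5
    simp only [Complex.smul_re, Complex.one_re, smul_eq_mul, mul_one] at h5
    linarith
  · intro h
    have hle : G * Gᴴ ≤ c • T := by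
      have key : ∀ δ : ℝ, 0 < δ → G * Gᴴ ≤ c • (T + δ • (1 : Matrix x x ℂ)) := by
        intro δ hδ
        set R := shiftedPow T δ (-(1 / 2)) with hR
        have hRh : Rᴴ = R := (isHermitian_shiftedPow _ _ _).eq
        have h6 : (R * G)ᴴ * (R * G) = Gᴴ * shiftedPow T δ (-1) * G := by
          rw [Matrix.conjTranspose_mul, hRh, ← hinv' δ hδ]
          simp only [Matrix.mul_assoc, hR]
        have h1 : (R * G)ᴴ * (R * G) ≤ c • (1 : Matrix y y ℂ) := by
          refine le_smul_one_of_trace (Matrix.posSemidef_conjTranspose_mul_self _) fun τ hτ => ?_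
          rw [h6, ← trace_conj_cycle]
          exact h δ hδ τ hτ
        have h2 := conj_mul_le_smul_one (L := (R * G)ᴴ) hc
          (by rwa [Matrix.conjTranspose_conjTranspose])
        rw [Matrix.conjTranspose_conjTranspose] at h2
        have h3 := conj_mul_le h2 (shiftedPow T δ (1 / 2))
        rw [(isHermitian_shiftedPow _ _ _).eq, Matrix.mul_smul, Matrix.smul_mul, Matrix.mul_one,
          hinv δ hδ] at h3
        refine (le_of_eq ?_).trans h3
        have h7 : shiftedPow T δ (1 / 2) * R = 1 := shiftedPow_mul_neg hT hδ _
        have h8 : R * shiftedPow T δ (1 / 2) = 1 := shiftedPow_neg_mul hT hδ _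
        calc G * Gᴴ = (shiftedPow T δ (1 / 2) * R) * G * Gᴴ * (R * shiftedPow T δ (1 / 2)) := by
              rw [h7, h8, Matrix.one_mul, Matrix.mul_one]
          _ = _ := by
              rw [Matrix.conjTranspose_mul, hRh]
              simp only [Matrix.mul_assoc]
      refine tendsto_const_le (A := fun _ => G * Gᴴ) tendsto_const_nhds
        (B := fun δ => c • (T + δ • (1 : Matrix x x ℂ))) ?_ key
      have : Tendsto (fun δ : ℝ => c • (T + δ • (1 : Matrix x x ℂ))) (𝓝 0)
          (𝓝 (c • (T + (0 : ℝ) • (1 : Matrix x x ℂ)))) := by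
        refine Continuous.tendsto (f := fun δ : ℝ => c • (T + δ • (1 : Matrix x x ℂ))) ?_ 0
        exact (continuous_const.add (continuous_id.smul continuous_const)).const_smul c
      rw [zero_smul, add_zero] at this
      exact this.mono_left nhdsWithin_le_nhds
    -- The value `c = 0` is allowed here but not in the infimum, so every larger constant is used
    -- instead.
    refine le_of_forall_gt_imp_ge_of_dense fun t ht => ?_
    rcases eq_or_ne t ⊤ with rfl | htop
    · exact le_top
    have ht' : c < t.toReal := by
      rwa [← ENNReal.ofReal_toReal htop, ENNReal.ofReal_lt_ofReal_iff_of_nonneg hc] at ht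
    refine (iInf₂_le t.toReal ⟨hc.trans_lt ht', ?_⟩).trans (ENNReal.ofReal_toReal htop).le
    refine Matrix.le_iff.mp (hle.trans ?_)
    exact Matrix.le_iff.mpr (by rw [← sub_smul]; exact hT.smul (by linarith))

/-- Put `Z = G^* T^{-s} G`. Hölder and its equality case give that `tr (Z τ^s)` has supremum `(tr
Z^α)^{1/α}` over states `τ`, with `1/α = 1 - s`. Boundedness uniformly in `δ` encodes the support
condition. -/
theorem sandwiched_le_iff [Nonempty y] (G : Matrix x y ℂ) {T : Matrix x x ℂ} (hT : T.PosSemidef)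
    {s c : ℝ} (hs : 0 < s) (hs1 : s < 1) (hc : 0 ≤ c) :
    sandwiched (1 - s)⁻¹ (G * Gᴴ) T ≤ log2 (ENNReal.ofReal c ^ (1 / s)) ↔
      ∀ δ : ℝ, 0 < δ → ∀ τ : Matrix y y ℂ, IsState τ →
        (shiftedPow T δ (-s) * (G * matPow τ s * Gᴴ)).trace.re ≤ c := by
  have h1s : (0 : ℝ) < 1 - s := by linarith
  set α := (1 - s)⁻¹ with hα
  have hα0 : 0 < α := inv_pos.mpr h1s
  have hα1 : 1 < α := (one_lt_inv₀ h1s).mpr (by linarith)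
  have e1 : (1 - α) / (2 * α) = -s / 2 := by
    rw [hα]
    field_simp
    ring
  have e2 : (α - 1)⁻¹ = (1 / s) * (1 - s) := by
    rw [hα]
    have : (1 - s)⁻¹ - 1 = s / (1 - s) := by
      field_simp
      ring
    rw [this, inv_div]
    ring
  set Z := Gᴴ * matPow T (-s) * G with hZ
  have hZpos : Z.PosSemidef := (posSemidef_matPow hT _).conjTranspose_mul_mul_same G
  set Q := (matPow Z α).trace.re with hQ
  have hQ0 : 0 ≤ Q := re_trace_matPow_nonneg hZpos _
  have hform : sandwiched α (G * Gᴴ) T ≤ log2 (ENNReal.ofReal c ^ (1 / s)) ↔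
      kerProj T * G = 0 ∧ Q ^ (1 - s) ≤ c := by
    rw [sandwiched, suppLE_iff hT.isHermitian, e1, trace_sandwich hT G _ hα0.ne', ← hZ, ← hQ]
    by_cases hk : kerProj T * G = 0
    · rw [if_neg (by simp [hk]), e2, ← log2_rpow, log2_le_log2, mul_comm (1 / s),
        ENNReal.rpow_mul, ENNReal.ofReal_rpow_of_nonneg hQ0 h1s.le,
        ENNReal.rpow_le_rpow_iff (by positivity), ENNReal.ofReal_le_ofReal_iff hc]
      simp [hk]
    · rw [if_pos ⟨hα1, hk⟩]
      simp only [hk, false_and, iff_false, not_le]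
      have : log2 (ENNReal.ofReal c ^ (1 / s)) < log2 ⊤ := by
        rw [← not_le, log2_le_log2, not_le]
        exact (ENNReal.rpow_lt_top_of_nonneg (by positivity) ENNReal.ofReal_ne_top)
      rwa [log2_top] at this
  rw [hform]
  constructor
  · rintro ⟨hk, hQc⟩ δ hδ τ hτ
    have hsupp : suppProj T * G = G := by
      have h3 := congrArg (· * G) (kerProj_add_suppProj hT.isHermitian)
      simpa [Matrix.add_mul, hk] using h3
    have h1 : Gᴴ * shiftedPow T δ (-s) * G ≤ Z := by
      have h2 : Gᴴ * shiftedPow T δ (-s) * G =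
          Gᴴ * (suppProj T * shiftedPow T δ (-s) * suppProj T) * G := by
        have : Gᴴ * suppProj T = Gᴴ := by
          nth_rewrite 2 [← hsupp]
          rw [Matrix.conjTranspose_mul, (isHermitian_suppProj T).eq]
        calc _ = (Gᴴ * suppProj T) * shiftedPow T δ (-s) * (suppProj T * G) := by
              rw [this, hsupp]
          _ = _ := by simp only [Matrix.mul_assoc]
      rw [h2]
      refine mul_conj_le ?_ G
      rw [suppProj, shiftedPow, cfc_mul_cfc, cfc_mul_cfc]
      refine cfc_le_cfc fun t ht => ?_
      rcases (spectrum_nonneg hT ht).eq_or_lt with rfl | ht0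
      · simp [Real.zero_rpow (neg_ne_zero.mpr hs.ne')]
      · simp only [ht0.ne', if_false, one_mul, mul_one]
        exact Real.rpow_le_rpow_of_nonpos ht0 (by linarith) (by linarith)
    rw [trace_conj_cycle]
    refine (re_trace_mul_le h1 (posSemidef_matPow hτ.1 s)).trans
      ((holder hZpos hτ.1 hs hs1 hα).trans ?_)
    rwa [isState_re hτ, Real.one_rpow, one_mul]
  · intro h
    constructor
    · -- a uniform bound as `δ → 0` forces the support condition
      -- The maximally mixed state is tested: its power is a multiple of the identity, so all of `G
      -- G^*` is seen. On the kernel of `T` the shifted power equals `δ^{-s}`.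
      set r := ((Fintype.card y : ℝ)⁻¹) with hr
      have hr0 : 0 < r := by positivity
      have hmix : IsState (r • (1 : Matrix y y ℂ)) := by
        have := isState_smul (A := (1 : Matrix y y ℂ)) Matrix.PosSemidef.one (by simp)
        simpa [hr] using this
      have hpow : matPow (r • (1 : Matrix y y ℂ)) s = r ^ s • (1 : Matrix y y ℂ) := by
        rw [← Algebra.algebraMap_eq_smul_one, ← Algebra.algebraMap_eq_smul_one]
        exact cfc_algebraMap r _
      have hb : ∀ δ : ℝ, 0 < δ →
          (kerProj T * (G * Gᴴ)).trace.re ≤ δ ^ s * (c / r ^ s) := by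
        intro δ hδ
        have h1 := h δ hδ _ hmix
        rw [hpow, Matrix.mul_smul, Matrix.mul_one, Matrix.smul_mul, Matrix.mul_smul,
          Matrix.trace_smul, Complex.smul_re, smul_eq_mul] at h1
        have h2 : δ ^ (-s) • kerProj T ≤ shiftedPow T δ (-s) := by
          rw [kerProj, shiftedPow, ← cfc_smul _ _ _ (continuousOn_spectrum _ _)]
          refine cfc_le_cfc fun t ht => ?_
          split_ifs with h0
          · simp [h0]
          · have := spectrum_nonneg hT ht
            simp only [smul_zero]
            positivity
        have h3 := re_trace_mul_le h2 (Matrix.posSemidef_self_mul_conjTranspose G)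
        rw [Matrix.smul_mul, Matrix.trace_smul, Complex.smul_re, smul_eq_mul,
          Real.rpow_neg hδ.le] at h3
        have hδs : 0 < δ ^ s := by positivity
        have hrs : 0 < r ^ s := by positivity
        have h4 : (shiftedPow T δ (-s) * (G * Gᴴ)).trace.re ≤ c / r ^ s := by
          rw [le_div_iff₀ hrs]
          linarith
        have h5 := mul_le_mul_of_nonneg_left (h3.trans h4) hδs.le
        rwa [mul_inv_cancel_left₀ hδs.ne'] at h5
      rw [kerProj_mul_eq_zero_iff]
      refine le_antisymm ?_ (re_trace_mul_nonneg (posSemidef_kerProj T)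
        (Matrix.posSemidef_self_mul_conjTranspose G))
      have hlim : Tendsto (fun δ : ℝ => δ ^ s * (c / r ^ s)) (𝓝[>] 0) (𝓝 0) := by
        have h6 : Tendsto (fun δ : ℝ => δ ^ s * (c / r ^ s)) (𝓝 0)
            (𝓝 ((0 : ℝ) ^ s * (c / r ^ s))) :=
          ((Real.continuousAt_rpow_const 0 s (Or.inr hs.le)).mul continuousAt_const).tendsto
        rw [Real.zero_rpow hs.ne', zero_mul] at h6
        exact h6.mono_left nhdsWithin_le_nhds
      exact ge_of_tendsto hlim (by
        filter_upwards [self_mem_nhdsWithin] with δ hδ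
        exact hb δ hδ)
    · rcases hQ0.eq_or_lt with hQ' | hQ'
      · rw [← hQ', Real.zero_rpow h1s.ne']
        exact hc
      -- The equality case of Hölder.
      set τ := Q⁻¹ • matPow Z α with hτ
      have hτS : IsState τ := isState_smul (posSemidef_matPow hZpos α) hQ'.ne'
      have hZτ : (Z * matPow τ s).trace.re ≤ c := by
        -- On the kernel of `T` the shifted power diverges whereas `matPow T (-s)` is zero there by
        -- convention. Dropping that part gives a convergent family that is still bounded by the
        -- shifted power.
        have hlim : Tendsto (fun δ : ℝ =>
            (cfc (fun t : ℝ => if t = 0 then 0 else (t + δ) ^ (-s)) T *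
              (G * matPow τ s * Gᴴ)).trace.re) (𝓝[>] 0)
            (𝓝 (matPow T (-s) * (G * matPow τ s * Gᴴ)).trace.re) := by
          refine (continuous_re_trace.tendsto _).comp (Tendsto.mul ?_ tendsto_const_nhds)
          refine tendsto_cfc_pointwise hT.isHermitian fun t ht => ?_
          rcases (spectrum_nonneg hT ht).eq_or_lt with rfl | ht0
          · simp [Real.zero_rpow (neg_ne_zero.mpr hs.ne')]
          · simp only [ht0.ne', if_false]
            have h6 : Tendsto (fun δ : ℝ => (t + δ) ^ (-s)) (𝓝 0) (𝓝 ((t + 0) ^ (-s))) :=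
              ContinuousAt.tendsto (f := fun δ : ℝ => (t + δ) ^ (-s)) (x := 0)
                (ContinuousAt.rpow_const (by fun_prop) (Or.inl (by simpa using ht0.ne')))
            rw [add_zero] at h6
            exact h6.mono_left nhdsWithin_le_nhds
        rw [hZ, ← trace_conj_cycle]
        refine le_of_tendsto hlim ?_
        filter_upwards [self_mem_nhdsWithin] with δ hδ
        have hδ' : (0 : ℝ) < δ := hδ
        refine le_trans (re_trace_mul_le (cfc_le_cfc fun t ht => ?_)
          ((posSemidef_matPow hτS.1 s).mul_mul_conjTranspose_same G)) (h δ hδ τ hτS)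
        have := spectrum_nonneg hT ht
        split_ifs
        · positivity
        · exact le_rfl
      have hval : (Z * matPow τ s).trace.re = Q ^ (1 - s) := by
        have h1 : Z * matPow τ s = (Q ^ (-s)) • matPow Z α := by
          have h2 : τ = cfc (fun t : ℝ => Q⁻¹ * t ^ α) Z := by
            rw [hτ, matPow, ← cfc_smul Q⁻¹ (fun t : ℝ => t ^ α) Z (continuousOn_spectrum _ _)]
            rfl
          have h3 : matPow τ s = cfc (fun t : ℝ => (Q⁻¹ * t ^ α) ^ s) Z := by
            rw [h2, matPow]
            exact (cfc_comp (fun t : ℝ => t ^ s) (fun t : ℝ => Q⁻¹ * t ^ α) Z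
              hZpos.isHermitian.isSelfAdjoint
              (((Matrix.finite_real_spectrum (A := Z)).image _).continuousOn _)
              (continuousOn_spectrum Z _)).symm
          rw [h3, self_mul_cfc hZpos.isHermitian, matPow,
            ← cfc_smul (Q ^ (-s)) (fun t : ℝ => t ^ α) Z (continuousOn_spectrum _ _)]
          refine cfc_congr_nonneg hZpos fun t ht => ?_
          rcases ht.eq_or_lt with rfl | ht0
          · simp [Real.zero_rpow hα0.ne']
          · have hαs : 1 + α * s = α := by
              rw [hα]
              field_simp
              ring
            rw [Real.mul_rpow (inv_nonneg.mpr hQ'.le) (by positivity), ← Real.rpow_mul ht,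
              Real.inv_rpow hQ'.le, Real.rpow_neg hQ'.le, smul_eq_mul]
            have h4 : t ^ α = t * t ^ (α * s) := by
              conv_lhs => rw [← hαs, Real.rpow_add ht0, Real.rpow_one]
            rw [h4]
            ring
        rw [h1, Matrix.trace_smul, Complex.smul_re, ← hQ, smul_eq_mul, sub_eq_neg_add,
          Real.rpow_add hQ', Real.rpow_one]
      rwa [← hval]

/-- Parametrisation of the Rényi parameter `α ∈ (1, ∞]` by `s = (α - 1)/α ∈ (0, 1]`. -/
noncomputable def upperParam (s : ℝ) : ℝ≥0∞ := (ENNReal.ofReal (1 - s))⁻¹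

/-- Parametrisation of the Rényi parameter `β ∈ [1/2, 1)` by `s = (1 - β)/β ∈ (0, 1]`. -/
noncomputable def lowerParam (s : ℝ) : ℝ≥0∞ := (ENNReal.ofReal (1 + s))⁻¹

theorem Dalpha_upperParam_le_iff [Nonempty y] (G : Matrix x y ℂ) {T : Matrix x x ℂ}
    (hT : T.PosSemidef) {s c : ℝ} (hs : 0 < s) (hs1 : s ≤ 1) (hc : 0 ≤ c) :
    Dalpha (upperParam s) (G * Gᴴ) T ≤ log2 (ENNReal.ofReal c ^ (1 / s)) ↔
      ∀ δ : ℝ, 0 < δ → ∀ τ : Matrix y y ℂ, IsState τ →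
        (shiftedPow T δ (-s) * (G * matPow τ s * Gᴴ)).trace.re ≤ c := by
  rcases hs1.eq_or_lt with rfl | hs1
  · have h1 : Dalpha (upperParam 1) (G * Gᴴ) T = Dmax (G * Gᴴ) T := by
      rw [Dalpha, if_pos (by simp [upperParam])]
    rw [h1, div_one, ENNReal.rpow_one, Dmax_le_iff G hT hc]
    refine forall₂_congr fun δ _ => forall₂_congr fun τ hτ => ?_
    rw [matPow_one hτ.1]
  · have h0 : (0 : ℝ) < 1 - s := by linarith
    have h1 : Dalpha (upperParam s) (G * Gᴴ) T = sandwiched (1 - s)⁻¹ (G * Gᴴ) T := by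
      rw [Dalpha, if_neg, if_neg, upperParam, ENNReal.toReal_inv, ENNReal.toReal_ofReal h0.le]
      · rw [upperParam, ENNReal.inv_eq_one, ENNReal.ofReal_eq_one]
        linarith
      · rw [upperParam, ENNReal.inv_eq_top, ENNReal.ofReal_eq_zero, not_le]
        exact h0
    rw [h1]
    exact sandwiched_le_iff G hT hs hs1 hc

/-- Below `1` there is no support condition and `T` carries a positive power, so a closed formula
replaces the variational one. -/
theorem neg_Dalpha_lowerParam (H : Matrix x y ℂ) {T : Matrix x x ℂ} (hT : T.PosSemidef) {s : ℝ}
    (hs : 0 < s) :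
    -Dalpha (lowerParam s) (H * Hᴴ) T = log2
      (ENNReal.ofReal (matPow (Hᴴ * matPow T s * H) (1 + s)⁻¹).trace.re ^ ((1 + s) / s)) := by
  have h0 : (0 : ℝ) < 1 + s := by linarith
  have h1 : Dalpha (lowerParam s) (H * Hᴴ) T = sandwiched (1 + s)⁻¹ (H * Hᴴ) T := by
    rw [Dalpha, if_neg, if_neg, lowerParam, ENNReal.toReal_inv, ENNReal.toReal_ofReal h0.le]
    · rw [lowerParam, ENNReal.inv_eq_one, ENNReal.ofReal_eq_one]
      linarith
    · rw [lowerParam, ENNReal.inv_eq_top, ENNReal.ofReal_eq_zero, not_le]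
      exact h0
  have hlt : ¬ (1 < (1 + s)⁻¹) := by
    rw [not_lt]
    exact inv_le_one_of_one_le₀ (by linarith)
  have e1 : (1 - (1 + s)⁻¹) / (2 * (1 + s)⁻¹) = s / 2 := by
    field_simp
    ring
  have e2 : ((1 + s)⁻¹ - 1)⁻¹ = -((1 + s) / s) := by
    have : (1 + s)⁻¹ - 1 = -(s / (1 + s)) := by
      field_simp
      ring
    rw [this, inv_neg, inv_div]
  rw [h1, sandwiched, if_neg (fun h => hlt h.1), e1, trace_sandwich hT H s (by positivity), e2,
    log2_rpow, EReal.coe_neg, EReal.neg_mul, neg_neg]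

/-! ### Duality -/

/-- Reverse Hölder raised to the power `1 + s`, in the limit `δ → 0`. This is the easy half of the
minimax. -/
theorem le_of_forall_reverse_holder {S Y : Matrix x x ℂ} (hS : IsState S) (hY : Y.PosSemidef)
    {s c : ℝ} (hs : 0 < s) (h : ∀ δ : ℝ, 0 < δ → (shiftedPow S δ (-s) * Y).trace.re ≤ c) :
    (matPow Y (1 + s)⁻¹).trace.re ^ (1 + s) ≤ c := by
  have h1s : (0 : ℝ) < 1 + s := by linarith
  have key : ∀ δ : ℝ, 0 < δ → (matPow Y (1 + s)⁻¹).trace.re ^ (1 + s) ≤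
      (1 + δ * Fintype.card x) ^ s * c := by
    intro δ hδ
    have hT : 0 ≤ (shiftedPow S δ (-s) * Y).trace.re :=
      re_trace_mul_nonneg (posSemidef_shiftedPow hS.1 hδ.le _) hY
    have h1 := reverse_holder hS.1 hY hδ hs rfl
    rw [isState_re hS] at h1
    have hd : (0 : ℝ) ≤ 1 + δ * Fintype.card x := by positivity
    have h2 := Real.rpow_le_rpow (re_trace_matPow_nonneg hY _) h1 h1s.le
    rw [Real.mul_rpow (by positivity) (by positivity), ← Real.rpow_mul hd, ← Real.rpow_mul hT,
      inv_mul_cancel₀ h1s.ne', Real.rpow_one] at h2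
    have e1 : (1 - (1 + s)⁻¹) * (1 + s) = s := by
      field_simp
      ring
    rw [e1] at h2
    exact h2.trans (mul_le_mul_of_nonneg_left (h δ hδ) (by positivity))
  have hlim : Tendsto (fun δ : ℝ => (1 + δ * Fintype.card x) ^ s * c) (𝓝[>] 0)
      (𝓝 ((1 + 0 * Fintype.card x) ^ s * c)) := by
    refine Tendsto.mono_left ?_ nhdsWithin_le_nhds
    refine ContinuousAt.tendsto (f := fun δ : ℝ => (1 + δ * Fintype.card x) ^ s * c) (x := 0) ?_
    exact (ContinuousAt.rpow_const (by fun_prop) (Or.inl (by simp))).mul continuousAt_const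
  rw [zero_mul, add_zero, Real.one_rpow, one_mul] at hlim
  exact ge_of_tendsto hlim (by
    filter_upwards [self_mem_nhdsWithin] with δ hδ
    exact key δ hδ)

theorem shiftedPow_one_kronecker {σ : Matrix y y ℂ} (hσ : σ.IsHermitian) (δ s : ℝ) :
    shiftedPow ((1 : Matrix x x ℂ) ⊗ₖ σ) δ s = (1 : Matrix x x ℂ) ⊗ₖ shiftedPow σ δ s :=
  cfc_one_kronecker hσ _

theorem matPow_one_kronecker {σ : Matrix y y ℂ} (hσ : σ.IsHermitian) (s : ℝ) :
    matPow ((1 : Matrix x x ℂ) ⊗ₖ σ) s = (1 : Matrix x x ℂ) ⊗ₖ matPow σ s :=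
  cfc_one_kronecker hσ _

theorem trace_shiftedPow_swapCut (G : Matrix (x × y) z ℂ) {σ : Matrix y y ℂ} {τ : Matrix z z ℂ}
    (hσ : σ.IsHermitian) (hτ : τ.IsHermitian) (δ s r : ℝ) :
    (shiftedPow ((1 : Matrix x x ℂ) ⊗ₖ σᵀ) δ r * (G * matPow τᵀ s * Gᴴ)).trace =
      (shiftedPow σ δ r * compress (swapCut G) (matPow τ s)).trace := by
  rw [← trace_swapCut, shiftedPow_one_kronecker hσ.transpose]
  congr 4
  · exact cfc_transpose hσ _
  · exact cfc_transpose hτ _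

theorem forall_isState_transpose {p : Matrix x x ℂ → Prop} (h : ∀ τ, IsState τ → p τᵀ) :
    ∀ τ, IsState τ → p τ := fun τ hτ => by
  simpa using h τᵀ (isState_transpose hτ)

/-- Duality of the sandwiched Rényi conditional entropies of a tripartite vector. -/
theorem iInf_Dalpha_eq_iSup [Nonempty y] [Nonempty z] (G : Matrix (x × y) z ℂ) {s : ℝ}
    (hs : 0 < s) (hs1 : s ≤ 1) :
    ⨅ (σ : Matrix y y ℂ) (_ : IsState σ),
        Dalpha (upperParam s) (G * Gᴴ) ((1 : Matrix x x ℂ) ⊗ₖ σ) =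
      ⨆ (τ : Matrix z z ℂ) (_ : IsState τ),
        -Dalpha (lowerParam s) (swapCut G * (swapCut G)ᴴ) ((1 : Matrix x x ℂ) ⊗ₖ τ) := by
  have hneg : ∀ τ : Matrix z z ℂ, IsState τ →
      -Dalpha (lowerParam s) (swapCut G * (swapCut G)ᴴ) ((1 : Matrix x x ℂ) ⊗ₖ τ) =
        log2 (ENNReal.ofReal ((matPow (compress (swapCut G) (matPow τ s)) (1 + s)⁻¹).trace.re ^
          (1 + s)) ^ (1 / s)) := by
    intro τ hτ
    rw [neg_Dalpha_lowerParam _ (Matrix.PosSemidef.one.kronecker hτ.1) hs,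
      matPow_one_kronecker hτ.1.isHermitian, ← ENNReal.ofReal_rpow_of_nonneg
        (re_trace_matPow_nonneg (posSemidef_compress _ (posSemidef_matPow hτ.1 _)) _)
        (by linarith), ← ENNReal.rpow_mul, mul_one_div]
    rfl
  apply le_antisymm
  -- The hard half: the saddle point supplies one `σ` whose supremum over `τ` is at most the value
  -- at `τ'`.
  · obtain ⟨σ, τ', hσ, hτ', h⟩ := exists_saddle (swapCut G) hs hs1 rfl
    refine (iInf₂_le σᵀ (isState_transpose hσ)).trans (le_trans ?_ (le_iSup₂ τ' hτ'))
    rw [hneg τ' hτ', Dalpha_upperParam_le_iff G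
      (Matrix.PosSemidef.one.kronecker hσ.1.transpose) hs hs1
      (Real.rpow_nonneg (re_trace_matPow_nonneg
        (posSemidef_compress _ (posSemidef_matPow hτ'.1 _)) _) _)]
    intro δ hδ
    refine forall_isState_transpose fun τ hτ => ?_
    rw [trace_shiftedPow_swapCut G hσ.1.isHermitian hτ.1.isHermitian]
    exact h τ hτ δ hδ
  · refine le_iInf₂ fun σ hσ => iSup₂_le fun τ hτ => ?_
    rw [hneg τ hτ]
    obtain ⟨t, ht⟩ := log2_surjective
      (Dalpha (upperParam s) (G * Gᴴ) ((1 : Matrix x x ℂ) ⊗ₖ σ))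
    rw [← ht, log2_le_log2]
    rcases eq_or_ne t ⊤ with rfl | htop
    · exact le_top
    -- A finite value is rewritten as `c ^ (1 / s)`, the form in which the variational formula
    -- applies.
    have hc : t = ENNReal.ofReal ((t ^ s).toReal) ^ (1 / s) := by
      rw [ENNReal.ofReal_toReal (ENNReal.rpow_ne_top_of_nonneg hs.le htop), ← ENNReal.rpow_mul,
        mul_one_div_cancel hs.ne', ENNReal.rpow_one]
    rw [hc] at ht ⊢
    have hle := (Dalpha_upperParam_le_iff G (Matrix.PosSemidef.one.kronecker hσ.1) hs hs1
      ENNReal.toReal_nonneg).mp ht.ge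
    refine ENNReal.rpow_le_rpow (ENNReal.ofReal_le_ofReal ?_) (by positivity)
    refine le_of_forall_reverse_holder (isState_transpose hσ)
      (posSemidef_compress _ (posSemidef_matPow hτ.1 _)) hs fun δ hδ => ?_
    rw [← trace_shiftedPow_swapCut G hσ.1.isHermitian.transpose hτ.1.isHermitian]
    simpa using hle δ hδ τᵀ (isState_transpose hτ)

/-! ### Comparison of Rényi relative entropies -/

/-- The test states `τ` live on the common purifying space `y`, so divergences on different spaces
`x` and `z` can be compared term by term. -/
theorem Dalpha_upperParam_le_of_trace_le [Nonempty y] {G : Matrix x y ℂ} {T : Matrix x x ℂ}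
    (hT : T.PosSemidef) {G' : Matrix z y ℂ} {T' : Matrix z z ℂ} (hT' : T'.PosSemidef) {s : ℝ}
    (hs : 0 < s) (hs1 : s ≤ 1)
    (h : ∀ δ : ℝ, 0 < δ → ∀ τ : Matrix y y ℂ, IsState τ →
      (shiftedPow T δ (-s) * (G * matPow τ s * Gᴴ)).trace.re ≤
        (shiftedPow T' δ (-s) * (G' * matPow τ s * G'ᴴ)).trace.re) :
    Dalpha (upperParam s) (G * Gᴴ) T ≤ Dalpha (upperParam s) (G' * G'ᴴ) T' := by
  obtain ⟨t, ht⟩ := log2_surjective (Dalpha (upperParam s) (G' * G'ᴴ) T')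
  rcases eq_or_ne t ⊤ with rfl | htop
  · rw [← ht, log2_top]
    exact le_top
  have hc : t = ENNReal.ofReal ((t ^ s).toReal) ^ (1 / s) := by
    rw [ENNReal.ofReal_toReal (ENNReal.rpow_ne_top_of_nonneg hs.le htop), ← ENNReal.rpow_mul,
      mul_one_div_cancel hs.ne', ENNReal.rpow_one]
  rw [hc] at ht
  rw [← ht]
  have hle := (Dalpha_upperParam_le_iff G' hT' hs hs1 ENNReal.toReal_nonneg).mp ht.ge
  rw [Dalpha_upperParam_le_iff G hT hs hs1 ENNReal.toReal_nonneg]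
  exact fun δ hδ τ hτ => (h δ hδ τ hτ).trans (hle δ hδ τ hτ)

theorem Dalpha_lowerParam_le_of_le {H : Matrix x y ℂ} {T : Matrix x x ℂ} (hT : T.PosSemidef)
    {H' : Matrix z y ℂ} {T' : Matrix z z ℂ} (hT' : T'.PosSemidef) {s : ℝ} (hs : 0 < s)
    (h : H'ᴴ * matPow T' s * H' ≤ Hᴴ * matPow T s * H) :
    Dalpha (lowerParam s) (H * Hᴴ) T ≤ Dalpha (lowerParam s) (H' * H'ᴴ) T' := by
  rw [← EReal.neg_le_neg_iff, neg_Dalpha_lowerParam H hT hs, neg_Dalpha_lowerParam H' hT' hs,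
    log2_le_log2]
  refine ENNReal.rpow_le_rpow (ENNReal.ofReal_le_ofReal (re_trace_le (matPow_le_matPow
    ((posSemidef_matPow hT' s).conjTranspose_mul_mul_same H') h ⟨by positivity, ?_⟩)))
    (by positivity)
  exact inv_le_one_of_one_le₀ (by linarith)

/-! ### The conditional expectation and its dilation -/

variable {a e f : Type*} [Fintype a] [DecidableEq a] [Fintype e] [DecidableEq e] [Fintype f]
  [DecidableEq f]

theorem condExp_mem (N : StarSubalgebra ℂ (Matrix a a ℂ)) (X : Matrix a a ℂ) : condExp N X ∈ N :=
  (existsUnique_condExp N).choose_spec.1.1 X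

theorem trace_mul_condExp {N : StarSubalgebra ℂ (Matrix a a ℂ)} {S : Matrix a a ℂ} (hS : S ∈ N)
    (X : Matrix a a ℂ) : (S * condExp N X).trace = (S * X).trace :=
  ((existsUnique_condExp N).choose_spec.1.2 S hS X).symm

/-- Both sides equal the trace of `condExp N X * condExp N Y`. -/
theorem trace_condExp_mul (N : StarSubalgebra ℂ (Matrix a a ℂ)) (X Y : Matrix a a ℂ) :
    (condExp N X * Y).trace = (X * condExp N Y).trace := by
  rw [← trace_mul_condExp (condExp_mem N X) Y, Matrix.trace_mul_comm,
    trace_mul_condExp (condExp_mem N Y) X, Matrix.trace_mul_comm]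

theorem trace_condExp (N : StarSubalgebra ℂ (Matrix a a ℂ)) (X : Matrix a a ℂ) :
    (condExp N X).trace = X.trace := by
  simpa using trace_mul_condExp (one_mem N) X

/-- The isometry `V`, with values in `ℂ^e ⊗ ℂ^a`. -/
def flipDilation (V : Matrix (a × e) a ℂ) : Matrix (e × a) a ℂ :=
  V.submatrix Prod.swap id

theorem flipDilation_isometry {N : StarSubalgebra ℂ (Matrix a a ℂ)} {V : Matrix (a × e) a ℂ}
    (hV : IsStinespring N V) : (flipDilation V)ᴴ * flipDilation V = 1 := by
  rw [← hV.1, flipDilation, Matrix.conjTranspose_submatrix]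
  exact Matrix.submatrix_mul_equiv _ _ _ (Equiv.prodComm e a) _

theorem flipDilation_conj (V : Matrix (a × e) a ℂ) (X : Matrix a a ℂ) :
    flipDilation V * X * (flipDilation V)ᴴ = (V * X * Vᴴ).submatrix Prod.swap Prod.swap := by
  ext p q
  simp [flipDilation, Matrix.mul_apply]

theorem condExp_eq_traceFst {N : StarSubalgebra ℂ (Matrix a a ℂ)} {V : Matrix (a × e) a ℂ}
    (hV : IsStinespring N V) (X : Matrix a a ℂ) :
    condExp N X = traceFst (flipDilation V * X * (flipDilation V)ᴴ) := by
  rw [hV.2, flipDilation_conj]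
  rfl

theorem trace_mul_traceFst (A : Matrix (x × y) (x × y) ℂ) (B : Matrix y y ℂ) :
    (traceFst A * B).trace = (A * ((1 : Matrix x x ℂ) ⊗ₖ B)).trace := by
  simp only [Matrix.trace, Matrix.diag_apply, Matrix.mul_apply, traceFst, Matrix.of_apply,
    Matrix.kroneckerMap_apply, Fintype.sum_prod_type, Matrix.one_apply, ite_mul, one_mul, zero_mul,
    mul_ite, mul_zero, Finset.sum_ite_irrel, Finset.sum_const_zero, Finset.sum_mul]
  rw [Finset.sum_congr rfl fun i _ => Finset.sum_comm, Finset.sum_comm]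
  simp

/-- The map `Y ↦ W^* (1 ⊗ Y) W` is the trace dual of the channel dilated by `W`. That channel is the
conditional expectation, which is its own dual. -/
theorem compress_flipDilation {N : StarSubalgebra ℂ (Matrix a a ℂ)} {V : Matrix (a × e) a ℂ}
    (hV : IsStinespring N V) (Y : Matrix a a ℂ) :
    compress (flipDilation V) Y = condExp N Y := by
  refine Matrix.ext_iff_trace_mul_left.mpr fun X => ?_
  rw [← trace_condExp_mul, condExp_eq_traceFst hV, trace_mul_traceFst, compress]
  rw [Matrix.trace_mul_comm _ ((1 : Matrix e e ℂ) ⊗ₖ Y), trace_conj_cycle, Matrix.trace_mul_comm]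

theorem condExp_posSemidef {N : StarSubalgebra ℂ (Matrix a a ℂ)} {V : Matrix (a × e) a ℂ}
    (hV : IsStinespring N V) {Y : Matrix a a ℂ} (hY : Y.PosSemidef) :
    (condExp N Y).PosSemidef := by
  rw [← compress_flipDilation hV]
  exact posSemidef_compress _ hY

theorem isState_condExp {N : StarSubalgebra ℂ (Matrix a a ℂ)} {V : Matrix (a × e) a ℂ}
    (hV : IsStinespring N V) {Y : Matrix a a ℂ} (hY : IsState Y) : IsState (condExp N Y) :=
  ⟨condExp_posSemidef hV hY.1, by rw [trace_condExp, hY.2]⟩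

theorem condExp_of_mem {N : StarSubalgebra ℂ (Matrix a a ℂ)} {Y : Matrix a a ℂ} (hY : Y ∈ N) :
    condExp N Y = Y := by
  have h : ∀ X ∈ N, (X * (condExp N Y - Y)).trace = 0 := fun X hX => by
    rw [Matrix.mul_sub, Matrix.trace_sub, trace_mul_condExp hX, sub_self]
  have h1 := h _ (star_mem (sub_mem (condExp_mem N Y) hY))
  rw [Matrix.star_eq_conjTranspose] at h1
  exact sub_eq_zero.mp (Matrix.trace_conjTranspose_mul_self_eq_zero_iff.mp h1)

/-- The dilation intertwines the elements of `N`, which lie in the multiplicative domain of the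
conditional expectation. -/
theorem one_kronecker_mul_flipDilation {N : StarSubalgebra ℂ (Matrix a a ℂ)}
    {V : Matrix (a × e) a ℂ} (hV : IsStinespring N V) {Y : Matrix a a ℂ} (hY : Y ∈ N) :
    ((1 : Matrix e e ℂ) ⊗ₖ Y) * flipDilation V = flipDilation V * Y := by
  set W := flipDilation V with hW
  have hiso : Wᴴ * W = 1 := flipDilation_isometry hV
  have hc : ∀ Z ∈ N, Wᴴ * ((1 : Matrix e e ℂ) ⊗ₖ Z) * W = Z := fun Z hZ =>
    (compress_flipDilation hV Z).trans (condExp_of_mem hZ)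
  have hYs : Yᴴ ∈ N := star_mem hY
  -- The defect vanishes because its square does: compression fixes `Y`, `Y^*` and `Y^* Y`, and each
  -- of the four terms equals `Y^* Y`.
  have h0 : (((1 : Matrix e e ℂ) ⊗ₖ Y) * W - W * Y)ᴴ * (((1 : Matrix e e ℂ) ⊗ₖ Y) * W - W * Y) =
      0 := by
    rw [Matrix.conjTranspose_sub, Matrix.conjTranspose_mul, Matrix.conjTranspose_mul,
      Matrix.conjTranspose_kronecker, Matrix.conjTranspose_one, Matrix.sub_mul, Matrix.mul_sub,
      Matrix.mul_sub]
    have e1 : Wᴴ * ((1 : Matrix e e ℂ) ⊗ₖ Yᴴ) * (((1 : Matrix e e ℂ) ⊗ₖ Y) * W) = Yᴴ * Y := by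
      rw [← hc _ (mul_mem hYs hY)]
      rw [← Matrix.one_mul (1 : Matrix e e ℂ), Matrix.mul_kronecker_mul, Matrix.one_mul]
      simp only [Matrix.mul_assoc]
    have e2 : Wᴴ * ((1 : Matrix e e ℂ) ⊗ₖ Yᴴ) * (W * Y) = Yᴴ * Y := by
      rw [← Matrix.mul_assoc, hc _ hYs]
    have e3 : Yᴴ * Wᴴ * (((1 : Matrix e e ℂ) ⊗ₖ Y) * W) = Yᴴ * Y := by
      rw [Matrix.mul_assoc, ← Matrix.mul_assoc Wᴴ, hc _ hY]
    have e4 : Yᴴ * Wᴴ * (W * Y) = Yᴴ * Y := by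
      rw [Matrix.mul_assoc, ← Matrix.mul_assoc Wᴴ, hiso, Matrix.one_mul]
    rw [e1, e2, e3, e4]
    simp
  exact sub_eq_zero.mp (Matrix.conjTranspose_mul_self_eq_zero.mp h0)

theorem conj_compress (V : Matrix (a × e) a ℂ) (K : Matrix a a ℂ) (Y : Matrix a a ℂ) :
    (flipDilation V * K)ᴴ * ((1 : Matrix e e ℂ) ⊗ₖ Y) * (flipDilation V * K) =
      Kᴴ * compress (flipDilation V) Y * K := by
  rw [compress, Matrix.conjTranspose_mul]
  simp only [Matrix.mul_assoc]

theorem dilate_mul_conj (V : Matrix (a × e) a ℂ) (K : Matrix a f ℂ) :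
    flipDilation V * (K * Kᴴ) * (flipDilation V)ᴴ =
      (flipDilation V * K) * (flipDilation V * K)ᴴ := by
  rw [Matrix.conjTranspose_mul]
  simp only [Matrix.mul_assoc]

theorem condExp_matPow_le {N : StarSubalgebra ℂ (Matrix a a ℂ)} {V : Matrix (a × e) a ℂ}
    (hV : IsStinespring N V) {σ : Matrix a a ℂ} (hσ : σ.PosSemidef) {s : ℝ} (hs : 0 < s)
    (hs1 : s ≤ 1) : condExp N (matPow σ s) ≤ matPow (condExp N σ) s := by
  rw [← compress_flipDilation hV, ← compress_flipDilation hV, compress,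
    ← matPow_one_kronecker hσ.isHermitian]
  exact compress_matPow_le (Matrix.PosSemidef.one.kronecker hσ) (flipDilation_isometry hV) hs hs1

theorem shiftedPow_condExp_le {N : StarSubalgebra ℂ (Matrix a a ℂ)} {V : Matrix (a × e) a ℂ}
    (hV : IsStinespring N V) {σ : Matrix a a ℂ} (hσ : σ.PosSemidef) {s : ℝ} (hs : 0 < s)
    (hs1 : s ≤ 1) {δ : ℝ} (hδ : 0 < δ) :
    shiftedPow (condExp N σ) δ (-s) ≤ condExp N (shiftedPow σ δ (-s)) := by
  rw [← compress_flipDilation hV, ← compress_flipDilation hV, compress, compress,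
    ← shiftedPow_one_kronecker hσ.isHermitian]
  exact shiftedPow_compress_le (Matrix.PosSemidef.one.kronecker hσ) (flipDilation_isometry hV)
    hs hs1 hδ

theorem trace_shiftedPow_dilate {N : StarSubalgebra ℂ (Matrix a a ℂ)} {V : Matrix (a × e) a ℂ}
    (hV : IsStinespring N V) {σ : Matrix a a ℂ} (hσ : σ.IsHermitian) (K R : Matrix a a ℂ)
    (δ s : ℝ) :
    (shiftedPow ((1 : Matrix e e ℂ) ⊗ₖ σ) δ s *
        (flipDilation V * K * R * (flipDilation V * K)ᴴ)).trace =
      (condExp N (shiftedPow σ δ s) * (K * R * Kᴴ)).trace := by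
  rw [shiftedPow_one_kronecker hσ, trace_conj_cycle, conj_compress, compress_flipDilation hV,
    ← trace_conj_cycle]

/-- A relative entropy which is unchanged by the dilation on `N` and decreases under the conditional
expectation has the same infimum over the states of `N` and over the states `1 ⊗ σ`. -/
theorem infState_eq_iInf {N : StarSubalgebra ℂ (Matrix a a ℂ)} {V : Matrix (a × e) a ℂ}
    (hV : IsStinespring N V) {ρ : Matrix a a ℂ} {D : Matrix a a ℂ → Matrix a a ℂ → EReal}
    {D' : Matrix (e × a) (e × a) ℂ → Matrix (e × a) (e × a) ℂ → EReal}
    {ω : Matrix (e × a) (e × a) ℂ}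
    (h1 : ∀ σ, IsState σ → σ ∈ N → D' ω ((1 : Matrix e e ℂ) ⊗ₖ σ) ≤ D ρ σ)
    (h2 : ∀ σ, IsState σ → D ρ (condExp N σ) ≤ D' ω ((1 : Matrix e e ℂ) ⊗ₖ σ)) :
    infState D ρ N = ⨅ (σ : Matrix a a ℂ) (_ : IsState σ), D' ω ((1 : Matrix e e ℂ) ⊗ₖ σ) := by
  refine le_antisymm (le_iInf₂ fun σ hσ => ?_) (le_iInf₂ fun σ hσ => ?_)
  · exact (iInf₂_le (condExp N σ) ⟨isState_condExp hV hσ, condExp_mem N σ⟩).trans (h2 σ hσ)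
  · exact (iInf₂_le σ hσ.1).trans (h1 σ hσ.1 hσ.2)

/-- For `σ ∈ N` the shifted powers lie in `N` and are fixed by the conditional expectation, so the
tested traces agree. For general `σ` they compare by Jensen for negative powers. -/
theorem DalphaSub_upperParam [Nonempty a] {N : StarSubalgebra ℂ (Matrix a a ℂ)}
    {V : Matrix (a × e) a ℂ} (hV : IsStinespring N V) {ρ : Matrix a a ℂ} (hρ : ρ.PosSemidef)
    {s : ℝ} (hs : 0 < s) (hs1 : s ≤ 1) :
    DalphaSub (upperParam s) ρ N = ⨅ (σ : Matrix a a ℂ) (_ : IsState σ),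
      Dalpha (upperParam s) (flipDilation V * ρ * (flipDilation V)ᴴ)
        ((1 : Matrix e e ℂ) ⊗ₖ σ) := by
  obtain ⟨K, rfl⟩ := exists_eq_mul_conj hρ
  rw [dilate_mul_conj]
  refine infState_eq_iInf hV (fun σ hσ hσN => ?_) (fun σ hσ => ?_)
  · refine Dalpha_upperParam_le_of_trace_le (Matrix.PosSemidef.one.kronecker hσ.1) hσ.1 hs hs1
      fun δ hδ τ hτ => ?_
    rw [trace_shiftedPow_dilate hV hσ.1.isHermitian,
      condExp_of_mem (Y := shiftedPow σ δ (-s))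
        (cfc_mem_starSubalgebra N hσ.1.isHermitian hσN _)]
  · refine Dalpha_upperParam_le_of_trace_le (condExp_posSemidef hV hσ.1)
      (Matrix.PosSemidef.one.kronecker hσ.1) hs hs1 fun δ hδ τ hτ => ?_
    rw [trace_shiftedPow_dilate hV hσ.1.isHermitian]
    exact re_trace_mul_le (shiftedPow_condExp_le hV hσ.1 hs hs1 hδ)
      ((posSemidef_matPow hτ.1 s).mul_mul_conjTranspose_same K)

theorem Dalpha_lowerParam_dilate_le {N : StarSubalgebra ℂ (Matrix a a ℂ)} {V : Matrix (a × e) a ℂ}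
    (hV : IsStinespring N V) {ρ : Matrix a a ℂ} (hρ : ρ.PosSemidef) {σ : Matrix a a ℂ}
    (hσ : σ.PosSemidef) (hσN : σ ∈ N) {s : ℝ} (hs : 0 < s) :
    Dalpha (lowerParam s) (flipDilation V * ρ * (flipDilation V)ᴴ) ((1 : Matrix e e ℂ) ⊗ₖ σ) ≤
      Dalpha (lowerParam s) ρ σ := by
  obtain ⟨K, rfl⟩ := exists_eq_mul_conj hρ
  rw [dilate_mul_conj]
  refine Dalpha_lowerParam_le_of_le (Matrix.PosSemidef.one.kronecker hσ) hσ hs ?_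
  rw [matPow_one_kronecker hσ.isHermitian, conj_compress, compress_flipDilation hV,
    condExp_of_mem (Y := matPow σ s) (cfc_mem_starSubalgebra N hσ.isHermitian hσN _)]

/-- The same argument with Jensen for the positive power `s`. The sign of `β - 1` reverses the
order. -/
theorem DalphaSub_lowerParam {N : StarSubalgebra ℂ (Matrix a a ℂ)}
    {V : Matrix (a × e) a ℂ} (hV : IsStinespring N V) {ρ : Matrix a a ℂ} (hρ : ρ.PosSemidef)
    {s : ℝ} (hs : 0 < s) (hs1 : s ≤ 1) :
    DalphaSub (lowerParam s) ρ N = ⨅ (σ : Matrix a a ℂ) (_ : IsState σ),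
      Dalpha (lowerParam s) (flipDilation V * ρ * (flipDilation V)ᴴ)
        ((1 : Matrix e e ℂ) ⊗ₖ σ) := by
  refine infState_eq_iInf hV
    (fun σ hσ hσN => Dalpha_lowerParam_dilate_le hV hρ hσ.1 hσN hs) (fun σ hσ => ?_)
  obtain ⟨K, rfl⟩ := exists_eq_mul_conj hρ
  rw [dilate_mul_conj]
  refine Dalpha_lowerParam_le_of_le (condExp_posSemidef hV hσ.1)
    (Matrix.PosSemidef.one.kronecker hσ.1) hs ?_
  rw [matPow_one_kronecker hσ.1.isHermitian, conj_compress, compress_flipDilation hV]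
  exact mul_conj_le (condExp_matPow_le hV hσ.1 hs hs1) K

/-! ### The case `α = 1` -/

theorem mul_matLog_eq_cfc (A : Matrix x x ℂ) (hA : A.IsHermitian) :
    A * matLog A = cfc (fun t : ℝ => t * Real.logb 2 t) A := by
  rw [matLog, self_mul_cfc hA]

theorem vnEntropy_mul_conj (L : Matrix x y ℂ) : vnEntropy (L * Lᴴ) = vnEntropy (Lᴴ * L) := by
  rw [vnEntropy, vnEntropy, mul_matLog_eq_cfc _ (isHermitian_mul_conj_self L),
    mul_matLog_eq_cfc _ (isHermitian_conj_mul_self L), trace_cfc_mul_conj L (by simp)]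

theorem vnEntropy_transpose {A : Matrix x x ℂ} (hA : A.IsHermitian) :
    vnEntropy Aᵀ = vnEntropy A := by
  rw [vnEntropy, vnEntropy, mul_matLog_eq_cfc _ hA, mul_matLog_eq_cfc _ hA.transpose,
    cfc_transpose hA, Matrix.trace_transpose]

theorem traceFst_swapCut (G : Matrix (x × y) z ℂ) :
    traceFst (swapCut G * (swapCut G)ᴴ) = (Gᴴ * G)ᵀ := by
  ext i j
  simp only [traceFst, swapCut, Matrix.of_apply, Matrix.mul_apply, Matrix.conjTranspose_apply,
    Matrix.transpose_apply, Fintype.sum_prod_type]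
  exact Finset.sum_congr rfl fun _ _ => Finset.sum_congr rfl fun _ _ => mul_comm _ _

/-- Each joint marginal of the vector has, apart from zeros, the spectrum of the remaining single
marginal, so the two entropy differences are negatives of each other. -/
theorem Halpha_one_dual (G : Matrix (x × y) z ℂ) :
    -Halpha 1 (G * Gᴴ) = Halpha 1 (swapCut G * (swapCut G)ᴴ) := by
  have h1 := traceFst_swapCut G
  have h2 := traceFst_swapCut (swapCut G)
  rw [swapCut_swapCut] at h2
  rw [Halpha, Halpha, if_pos rfl, if_pos rfl, h1, h2,
    vnEntropy_transpose (isHermitian_conj_mul_self _),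
    vnEntropy_transpose (isHermitian_conj_mul_self _), vnEntropy_mul_conj, vnEntropy_mul_conj,
    ← EReal.coe_neg, neg_sub]

theorem suppLE_iff_trace {ρ σ : Matrix x x ℂ} (hρ : ρ.PosSemidef) (hσ : σ.IsHermitian) :
    SuppLE ρ σ ↔ (kerProj σ * ρ).trace.re = 0 := by
  obtain ⟨K, rfl⟩ := exists_eq_mul_conj hρ
  rw [suppLE_iff hσ, kerProj_mul_eq_zero_iff]

/-- This is `log x ≤ x - 1` at `x = t / s`. The last hypothesis excludes `t = 0 < s`, where the
convention `log 0 = 0` would give a wrong finite value. -/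
theorem mul_logb_sub_ge {s t : ℝ} (hs : 0 ≤ s) (ht : 0 ≤ t) (h : t = 0 → s = 0) :
    (s - t) / Real.log 2 ≤ s * Real.logb 2 s - s * Real.logb 2 t := by
  have hl : 0 < Real.log 2 := Real.log_pos (by norm_num)
  rw [div_le_iff₀ hl, Real.logb, Real.logb]
  have e1 : (s * (Real.log s / Real.log 2) - s * (Real.log t / Real.log 2)) * Real.log 2 =
      s * (Real.log s - Real.log t) := by
    field_simp
  rw [e1]
  rcases hs.eq_or_lt with rfl | hs
  · simpa using ht
  have ht' : 0 < t := lt_of_le_of_ne ht fun h0 => hs.ne' (h h0.symm)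
  have h2 := Real.log_le_sub_one_of_pos (div_pos ht' hs)
  rw [Real.log_div ht'.ne' hs.ne'] at h2
  have h3 := mul_le_mul_of_nonneg_left h2 hs.le
  have h4 : s * (t / s - 1) = t - s := by field_simp
  rw [h4] at h3
  linarith

/-- Klein's inequality. -/
theorem klein {A B : Matrix x x ℂ} (hA : A.PosSemidef) (hB : B.PosSemidef)
    (htr : A.trace.re = B.trace.re) (hk : (kerProj B * A).trace.re = 0) :
    (A * matLog B).trace.re ≤ (A * matLog A).trace.re := by
  obtain ⟨p, hp, hp1, hp2, hfg⟩ := exists_weights hA.isHermitian hB.isHermitian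
  set α := hA.isHermitian.eigenvalues
  set β := hB.isHermitian.eigenvalues
  have hα : ∀ i, 0 ≤ α i := hA.eigenvalues_nonneg
  have hβ : ∀ i, 0 ≤ β i := hB.eigenvalues_nonneg
  have e1 : (A * matLog B).trace.re = ∑ i, ∑ j, α i * Real.logb 2 (β j) * p i j := by
    nth_rewrite 1 [← cfc_id_eq hA.isHermitian]
    rw [matLog, hfg]
  have e2 : (A * matLog A).trace.re = ∑ i, ∑ j, α i * Real.logb 2 (α i) * 1 * p i j := by
    rw [mul_matLog_eq_cfc A hA.isHermitian, ← hfg (fun t => t * Real.logb 2 t) (fun _ => 1),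
      cfc_const_one ℝ B hB.isHermitian.isSelfAdjoint, Matrix.mul_one]
  have e3 : A.trace.re = ∑ i, ∑ j, α i * 1 * p i j := by
    rw [← hfg (fun t => t) (fun _ => 1), cfc_const_one ℝ B hB.isHermitian.isSelfAdjoint,
      Matrix.mul_one, cfc_id_eq hA.isHermitian]
  have e4 : B.trace.re = ∑ i, ∑ j, 1 * β j * p i j := by
    rw [← hfg (fun _ => 1) (fun t => t), cfc_const_one ℝ A hA.isHermitian.isSelfAdjoint,
      Matrix.one_mul, cfc_id_eq hB.isHermitian]
  have e5 : ∑ i, ∑ j, α i * (if β j = 0 then 1 else 0) * p i j = 0 := by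
    rw [← hfg (fun t => t) (fun t => if t = 0 then 1 else 0), cfc_id_eq hA.isHermitian,
      Matrix.trace_mul_comm]
    exact hk
  have hnn : ∀ i j, 0 ≤ α i * (if β j = 0 then 1 else 0) * p i j := fun i j =>
    mul_nonneg (mul_nonneg (hα i) (by positivity)) (hp i j)
  -- The support condition is a vanishing sum of nonnegative terms: a zero eigenvalue of `B` never
  -- meets a nonzero one of `A` with positive weight.
  have hzero : ∀ i j, β j = 0 → α i * p i j = 0 := by
    intro i j hj
    have h1 := (Finset.sum_eq_zero_iff_of_nonneg
      fun i _ => Finset.sum_nonneg fun j _ => hnn i j).mp e5 i (Finset.mem_univ i)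
    have h2 := (Finset.sum_eq_zero_iff_of_nonneg fun j _ => hnn i j).mp h1 j (Finset.mem_univ j)
    simpa [hj] using h2
  have hterm : ∀ i j, (α i * 1 * p i j - 1 * β j * p i j) / Real.log 2 ≤
      α i * Real.logb 2 (α i) * 1 * p i j - α i * Real.logb 2 (β j) * p i j := by
    intro i j
    rcases (hp i j).eq_or_lt with h0 | h0
    · simp [← h0]
    · have h1 := mul_le_mul_of_nonneg_right
        (mul_logb_sub_ge (hα i) (hβ j) fun h => (mul_eq_zero.mp (hzero i j h)).resolve_right h0.ne')
        h0.le
      refine (le_of_eq ?_).trans (h1.trans_eq ?_) <;> ring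
  have hsum := Finset.sum_le_sum fun i (_ : i ∈ Finset.univ) =>
    Finset.sum_le_sum fun j (_ : j ∈ Finset.univ) => hterm i j
  simp only [Finset.sum_sub_distrib, ← Finset.sum_div] at hsum
  rw [← e1, ← e2, ← e3, ← e4, htr, sub_self, zero_div] at hsum
  linarith

/-- For `σ ∈ N` the logarithm of `σ` lies in `N`, so `tr ρ log σ = tr 𝓔(ρ) log σ`. By Klein's
inequality the optimal `σ` is `𝓔(ρ)`. -/
theorem DalphaSub_one {N : StarSubalgebra ℂ (Matrix a a ℂ)} {V : Matrix (a × e) a ℂ}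
    (hV : IsStinespring N V) {ρ : Matrix a a ℂ} (hρ : IsState ρ) :
    DalphaSub 1 ρ N = ((vnEntropy (condExp N ρ) - vnEntropy ρ : ℝ) : EReal) := by
  have hD : DalphaSub 1 ρ N = infState relEntropy ρ N := by
    simp [DalphaSub, infState, Dalpha]
  have hE := isState_condExp hV hρ
  have hlog : ∀ σ, IsState σ → σ ∈ N → ∀ g : ℝ → ℝ,
      (ρ * cfc g σ).trace = (condExp N ρ * cfc g σ).trace := by
    intro σ hσ hσN g
    rw [trace_condExp_mul, condExp_of_mem (cfc_mem_starSubalgebra N hσ.1.isHermitian hσN g)]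
  have hval : ∀ σ, IsState σ → σ ∈ N → SuppLE ρ σ → relEntropy ρ σ =
      ((-(condExp N ρ * matLog σ).trace.re - vnEntropy ρ : ℝ) : EReal) := by
    intro σ hσ hσN h
    rw [relEntropy, if_pos h, Matrix.trace_sub, Complex.sub_re, vnEntropy, matLog, matLog,
      hlog σ hσ hσN]
    congr 1
    ring
  rw [hD]
  refine le_antisymm ?_ (le_iInf₂ fun σ hσ => ?_)
  · have hsupp : SuppLE ρ (condExp N ρ) := by
      rw [suppLE_iff_trace hρ.1 hE.1.isHermitian, Matrix.trace_mul_comm, kerProj,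
        hlog _ hE (condExp_mem N ρ), Matrix.trace_mul_comm]
      have := kerProj_mul_self hE.1.isHermitian
      rw [kerProj] at this
      rw [this]
      simp
    refine (iInf₂_le (condExp N ρ) ⟨hE, condExp_mem N ρ⟩).trans ?_
    rw [hval _ hE (condExp_mem N ρ) hsupp]
    exact le_of_eq rfl
  · by_cases h : SuppLE ρ σ
    · rw [hval σ hσ.1 hσ.2 h, EReal.coe_le_coe_iff, vnEntropy]
      have hk : (kerProj σ * condExp N ρ).trace.re = 0 := by
        rw [suppLE_iff_trace hρ.1 hσ.1.1.isHermitian, Matrix.trace_mul_comm, kerProj,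
          hlog _ hσ.1 hσ.2] at h
        rw [Matrix.trace_mul_comm]
        exact h
      have := klein hE.1 hσ.1.1 (by rw [isState_re hE, isState_re hσ.1]) hk
      linarith
    · rw [relEntropy, if_neg h]
      exact le_top

/-! ### Fidelity -/

theorem trace_matPow_conj_comm {A : Matrix x x ℂ} (J : Matrix x y ℂ)
    (K : Matrix x z ℂ) (h : A = J * Jᴴ) {r : ℝ} (hr : r ≠ 0) :
    (matPow (Jᴴ * (K * Kᴴ) * J) r).trace = (matPow (Kᴴ * A * K) r).trace := by
  have e1 : Jᴴ * (K * Kᴴ) * J = (Kᴴ * J)ᴴ * (Kᴴ * J) := by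
    rw [Matrix.conjTranspose_mul, Matrix.conjTranspose_conjTranspose]
    simp only [Matrix.mul_assoc]
  have e2 : Kᴴ * A * K = (Kᴴ * J) * (Kᴴ * J)ᴴ := by
    rw [h, Matrix.conjTranspose_mul, Matrix.conjTranspose_conjTranspose]
    simp only [Matrix.mul_assoc]
  rw [e1, e2]
  exact (trace_cfc_mul_conj (Kᴴ * J) (f := fun t : ℝ => t ^ r) (Real.zero_rpow hr)).symm

/-- The fidelity can be computed from any factorisation `K K^*`, even a rectangular one, hence from
any purification. -/
theorem traceNorm_sqrt_mul_sqrt {ρ : Matrix x x ℂ} (hρ : ρ.PosSemidef) (K : Matrix x y ℂ) :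
    traceNorm (matPow ρ (1 / 2) * matPow (K * Kᴴ) (1 / 2)) =
      (matPow (Kᴴ * ρ * K) (1 / 2)).trace.re := by
  have hξ : (K * Kᴴ).PosSemidef := Matrix.posSemidef_self_mul_conjTranspose K
  obtain ⟨J, hJ⟩ := exists_eq_mul_conj hρ
  have h1 : (matPow ρ (1 / 2) * matPow (K * Kᴴ) (1 / 2))ᴴ *
      (matPow ρ (1 / 2) * matPow (K * Kᴴ) (1 / 2)) =
      matPow (K * Kᴴ) (1 / 2) * (J * Jᴴ) * matPow (K * Kᴴ) (1 / 2) := by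
    rw [Matrix.conjTranspose_mul, (isHermitian_matPow _ _).eq, (isHermitian_matPow _ _).eq, ← hJ]
    conv_rhs => rw [← sqrt_mul_sqrt hρ]
    simp only [Matrix.mul_assoc]
  rw [traceNorm, h1, trace_sandwich hξ J 1 (by norm_num), matPow_one hξ,
    trace_matPow_conj_comm J K hJ (by norm_num)]

theorem genFidelity_of_isState {ρ : Matrix x x ℂ} (hρ : ρ.PosSemidef) {K : Matrix x y ℂ}
    (hK : IsState (K * Kᴴ)) :
    genFidelity ρ (K * Kᴴ) = (matPow (Kᴴ * ρ * K) (1 / 2)).trace.re := by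
  rw [genFidelity, isState_re hK, sub_self, mul_zero, Real.sqrt_zero, add_zero,
    traceNorm_sqrt_mul_sqrt hρ]

/-- The reference operators are normalised, so the correction term of the generalized fidelity
vanishes and closeness on different spaces is compared by fidelities alone. -/
theorem isClose_of_fidelity_le {ρ : Matrix x x ℂ} (hρ : IsSubstate ρ) {K : Matrix x y ℂ}
    (hK : IsState (K * Kᴴ)) {ω : Matrix w w ℂ} {L : Matrix w z ℂ} (hL : IsState (L * Lᴴ)) {ε : ℝ}
    (h : IsClose ε ω (L * Lᴴ))
    (hle : (matPow (Lᴴ * ω * L) (1 / 2)).trace.re ≤ (matPow (Kᴴ * ρ * K) (1 / 2)).trace.re) :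
    IsClose ε ρ (K * Kᴴ) := by
  refine ⟨hρ, le_trans ?_ h.2⟩
  rw [purifiedDist, purifiedDist, genFidelity_of_isState hρ.1 hK, genFidelity_of_isState h.1.1 hL]
  have h0 : 0 ≤ (matPow (Lᴴ * ω * L) (1 / 2)).trace.re :=
    re_trace_matPow_nonneg (h.1.1.conjTranspose_mul_mul_same L) _
  exact Real.sqrt_le_sqrt (sub_le_sub_left (pow_le_pow_left₀ h0 hle 2) 1)

/-- Split `X = R P` with `P = |X|^{1/2}` and `R = X |X|^{-1/2}`. Both factors have squared
Hilbert–Schmidt norm `tr |X|`, and the bound follows by expanding the squared norm of `P - R^*`. -/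
theorem re_trace_le_trace_abs (X : Matrix x x ℂ) :
    X.trace.re ≤ (matPow (Xᴴ * X) (1 / 2)).trace.re := by
  set B := Xᴴ * X with hB
  have hBpos : B.PosSemidef := Matrix.posSemidef_conjTranspose_mul_self X
  set P := matPow B (1 / 4) with hP
  set R := X * matPow B (-(1 / 4)) with hR
  have hPh : Pᴴ = P := (isHermitian_matPow _ _).eq
  have hker : X * kerProj B = 0 := by
    refine Matrix.conjTranspose_mul_self_eq_zero.mp ?_
    rw [Matrix.conjTranspose_mul, (isHermitian_kerProj B).eq, Matrix.mul_assoc,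
      ← Matrix.mul_assoc Xᴴ, ← hB, ← Matrix.mul_assoc, kerProj_mul_self hBpos.isHermitian,
      Matrix.zero_mul]
  have hRP : R * P = X := by
    have h1 : matPow B (-(1 / 4)) * matPow B (1 / 4) = suppProj B := by
      rw [matPow, matPow, cfc_mul_cfc, suppProj]
      refine cfc_congr_nonneg hBpos fun t ht => ?_
      rcases ht.eq_or_lt with rfl | ht0
      · simp
      · rw [← Real.rpow_add ht0, neg_add_cancel, Real.rpow_zero, if_neg ht0.ne']
    have h2 := congrArg (X * ·) (kerProj_add_suppProj hBpos.isHermitian)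
    simp only [Matrix.mul_add, hker, zero_add, Matrix.mul_one] at h2
    rw [hR, hP, Matrix.mul_assoc, h1, h2]
  have hRR : Rᴴ * R = matPow B (1 / 2) := by
    rw [hR, Matrix.conjTranspose_mul, (isHermitian_matPow _ _).eq, Matrix.mul_assoc,
      ← Matrix.mul_assoc Xᴴ, ← hB, matPow, self_mul_cfc hBpos.isHermitian, cfc_mul_cfc]
    refine cfc_congr_nonneg hBpos fun t ht => ?_
    rcases ht.eq_or_lt with rfl | ht0
    · simp
    · nth_rewrite 2 [← Real.rpow_one t]
      rw [← Real.rpow_add ht0, ← Real.rpow_add ht0]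
      norm_num
  have hPP : P * P = matPow B (1 / 2) := by
    have := matPow_half_mul_half hBpos (1 / 2)
    rw [show (1 / 2 / 2 : ℝ) = 1 / 4 by norm_num] at this
    exact this
  have h1 := re_trace_nonneg (Matrix.posSemidef_conjTranspose_mul_self (P - Rᴴ))
  have h2 : ((P * Rᴴ).trace).re = X.trace.re := by
    have := congrArg Matrix.conjTranspose hRP
    rw [Matrix.conjTranspose_mul, hPh] at this
    rw [this, Matrix.trace_conjTranspose]
    simp
  rw [Matrix.conjTranspose_sub, hPh, Matrix.conjTranspose_conjTranspose, Matrix.sub_mul,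
    Matrix.mul_sub, Matrix.mul_sub, hPP, hRP, Matrix.trace_sub, Matrix.trace_sub,
    Matrix.trace_sub, Matrix.trace_mul_comm R, hRR] at h1
  simp only [Complex.sub_re] at h1
  rw [h2] at h1
  linarith

/-- The overlap of two vectors is at most the fidelity of their marginals. -/
theorem re_trace_le_fidelity (J K : Matrix x y ℂ) :
    (Jᴴ * K).trace.re ≤ (matPow (Kᴴ * (J * Jᴴ) * K) (1 / 2)).trace.re := by
  refine (re_trace_le_trace_abs (Jᴴ * K)).trans_eq ?_
  rw [Matrix.conjTranspose_mul, Matrix.conjTranspose_conjTranspose]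
  simp only [Matrix.mul_assoc]

/-- A version of Uhlmann's theorem in which the dimension of the purifying system is prescribed. -/
theorem exists_uhlmann {ω : Matrix x x ℂ} (hω : ω.PosSemidef) (M : Matrix x y ℂ) :
    ∃ M' : Matrix x y ℂ, M' * M'ᴴ ≤ ω ∧
      (M'ᴴ * M).trace.re = (matPow (Mᴴ * ω * M) (1 / 2)).trace.re := by
  set R := matPow ω (1 / 2) with hR
  have hRh : Rᴴ = R := (isHermitian_matPow _ _).eq
  have hRR : R * R = ω := sqrt_mul_sqrt hω
  set L := R * M with hL
  have hLL : Lᴴ * L = Mᴴ * ω * M := by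
    rw [hL, Matrix.conjTranspose_mul, hRh, ← hRR]
    simp only [Matrix.mul_assoc]
  have hpos : (Lᴴ * L).PosSemidef := Matrix.posSemidef_conjTranspose_mul_self L
  set C := matPow (Lᴴ * L) (-(1 / 2)) with hC
  have hCh : Cᴴ = C := (isHermitian_matPow _ _).eq
  -- `U` is the partial isometry in the polar decomposition of `L = ω^{1/2} M`. It is in general
  -- only a contraction, so `ω^{1/2} U` has a marginal below `ω`; equality cannot be expected when
  -- `y` is too small to purify `ω`.
  set U := L * C with hU
  have hUU : Uᴴ * U ≤ (1 : ℝ) • (1 : Matrix y y ℂ) := by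
    rw [hU, Matrix.conjTranspose_mul, hCh, Matrix.mul_assoc, ← Matrix.mul_assoc Lᴴ, hC, matPow,
      self_mul_cfc hpos.isHermitian, cfc_mul_cfc, one_smul,
      ← cfc_const_one ℝ (Lᴴ * L) hpos.isHermitian.isSelfAdjoint]
    refine cfc_le_cfc fun t ht => ?_
    rcases (spectrum_nonneg hpos ht).eq_or_lt with rfl | ht0
    · simp
    · refine le_of_eq ?_
      nth_rewrite 2 [← Real.rpow_one t]
      rw [← Real.rpow_add ht0, ← Real.rpow_add ht0]
      norm_num
  have hUU' : U * Uᴴ ≤ (1 : ℝ) • (1 : Matrix x x ℂ) := by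
    have := conj_mul_le_smul_one (L := Uᴴ) zero_le_one
      (by rwa [Matrix.conjTranspose_conjTranspose])
    rwa [Matrix.conjTranspose_conjTranspose] at this
  refine ⟨R * U, ?_, ?_⟩
  · have := conj_mul_le hUU' R
    rw [one_smul, Matrix.mul_one, hRh, hRR] at this
    refine (le_of_eq ?_).trans this
    rw [Matrix.conjTranspose_mul, hRh]
    simp only [Matrix.mul_assoc]
  · have h1 : (R * U)ᴴ * M = matPow (Lᴴ * L) (1 / 2) := by
      rw [Matrix.conjTranspose_mul, hRh, hU, Matrix.conjTranspose_mul, hCh, Matrix.mul_assoc,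
        Matrix.mul_assoc, ← hL, hC, matPow, cfc_mul_self hpos.isHermitian]
      refine cfc_congr_nonneg hpos fun t ht => ?_
      rcases ht.eq_or_lt with rfl | ht0
      · simp
      · nth_rewrite 2 [← Real.rpow_one t]
        rw [← Real.rpow_add ht0]
        norm_num
    rw [h1, hLL]

/-! ### Min- and max-entropies -/

theorem neg_iInf₂ {ι : Type*} {p : ι → Prop} (g : ι → EReal) :
    -(⨅ (i) (_ : p i), g i) = ⨆ (i) (_ : p i), -g i := by
  refine le_antisymm ?_ (iSup₂_le fun i hi => EReal.neg_le_neg_iff.mpr (iInf₂_le i hi))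
  rw [EReal.neg_le]
  refine le_iInf₂ fun i hi => ?_
  rw [EReal.neg_le]
  exact le_iSup₂ (f := fun i (_ : p i) => -g i) i hi

theorem neg_iSup₂ {ι : Type*} {p : ι → Prop} (g : ι → EReal) :
    -(⨆ (i) (_ : p i), g i) = ⨅ (i) (_ : p i), -g i := by
  rw [← neg_neg (⨅ (i) (_ : p i), -g i), neg_iInf₂]
  simp only [neg_neg]

theorem Dalpha_upperParam_one (ρ σ : Matrix x x ℂ) : Dalpha (upperParam 1) ρ σ = Dmax ρ σ := by
  rw [Dalpha, if_pos (by simp [upperParam])]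

theorem Dalpha_lowerParam_one (ρ σ : Matrix x x ℂ) : Dalpha (lowerParam 1) ρ σ = Dmin ρ σ := by
  have h : lowerParam 1 = ENNReal.ofReal (1 / 2) := by
    rw [lowerParam, ← ENNReal.ofReal_inv_of_pos (by norm_num)]
    norm_num
  rw [h, Dalpha, if_neg ENNReal.ofReal_ne_top, if_neg, ENNReal.toReal_ofReal (by norm_num), Dmin]
  rw [ENNReal.ofReal_eq_one]
  norm_num

theorem Dmax_mono {A B : Matrix x x ℂ} (h : A ≤ B) (T : Matrix x x ℂ) : Dmax A T ≤ Dmax B T := by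
  rw [Dmax, Dmax, log2_le_log2]
  exact le_iInf₂ fun c hc => iInf₂_le c ⟨hc.1, Matrix.le_iff.mp (h.trans (Matrix.le_iff.mpr hc.2))⟩

theorem neg_Dmin_mul_conj {T : Matrix x x ℂ} (hT : T.PosSemidef) (K : Matrix x y ℂ) :
    -Dmin (K * Kᴴ) T =
      log2 (ENNReal.ofReal (matPow (Kᴴ * T * K) (1 / 2)).trace.re ^ (2 : ℝ)) := by
  rw [← Dalpha_lowerParam_one, neg_Dalpha_lowerParam K hT one_pos, matPow_one hT]
  norm_num

theorem neg_Dmin_eq {A : Matrix x x ℂ} (hA : A.PosSemidef) (J : Matrix x y ℂ) :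
    -Dmin A (J * Jᴴ) =
      log2 (ENNReal.ofReal (matPow (Jᴴ * A * J) (1 / 2)).trace.re ^ (2 : ℝ)) := by
  obtain ⟨K, hK⟩ := exists_eq_mul_conj hA
  rw [← trace_matPow_conj_comm K J hK (by norm_num)]
  nth_rewrite 1 [hK]
  exact neg_Dmin_mul_conj (Matrix.posSemidef_self_mul_conjTranspose J) K

theorem log2_fidelity_mono {A B : Matrix x x ℂ} (hA : A.PosSemidef) (h : A ≤ B)
    (J : Matrix x y ℂ) :
    log2 (ENNReal.ofReal (matPow (Jᴴ * A * J) (1 / 2)).trace.re ^ (2 : ℝ)) ≤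
      log2 (ENNReal.ofReal (matPow (Jᴴ * B * J) (1 / 2)).trace.re ^ (2 : ℝ)) := by
  rw [log2_le_log2]
  exact ENNReal.rpow_le_rpow (ENNReal.ofReal_le_ofReal (re_trace_le (matPow_le_matPow
    (hA.conjTranspose_mul_mul_same J) (mul_conj_le h J) (by norm_num)))) (by norm_num)

theorem Dmin_anti_left {A B T : Matrix x x ℂ} (hA : A.PosSemidef) (h : A ≤ B)
    (hT : T.PosSemidef) : Dmin B T ≤ Dmin A T := by
  have hB : B.PosSemidef := Matrix.nonneg_iff_posSemidef.mp (hA.nonneg.trans h)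
  obtain ⟨J, rfl⟩ := exists_eq_mul_conj hT
  rw [← EReal.neg_le_neg_iff, neg_Dmin_eq hA, neg_Dmin_eq hB]
  exact log2_fidelity_mono hA h J

theorem Dmin_anti_right {A S T : Matrix x x ℂ} (hA : A.PosSemidef) (hS : S.PosSemidef)
    (h : S ≤ T) : Dmin A T ≤ Dmin A S := by
  have hT : T.PosSemidef := Matrix.nonneg_iff_posSemidef.mp (hS.nonneg.trans h)
  obtain ⟨K, rfl⟩ := exists_eq_mul_conj hA
  rw [← EReal.neg_le_neg_iff, neg_Dmin_mul_conj hS, neg_Dmin_mul_conj hT]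
  exact log2_fidelity_mono hS h K

theorem neg_Hmin_mono {A B : Matrix (x × y) (x × y) ℂ} (h : A ≤ B) : -Hmin A ≤ -Hmin B := by
  rw [Hmin, Hmin, neg_neg, neg_neg]
  exact iInf₂_mono fun σ _ => Dmax_mono h _

theorem Hmax_mono {A B : Matrix (x × y) (x × y) ℂ} (hA : A.PosSemidef) (h : A ≤ B) :
    Hmax A ≤ Hmax B := by
  rw [Hmax, Hmax, EReal.neg_le_neg_iff]
  exact iInf₂_mono fun σ hσ => Dmin_anti_left hA h (Matrix.PosSemidef.one.kronecker hσ.1)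

theorem neg_Hmin_eq_Hmax [Nonempty y] [Nonempty z] (G : Matrix (x × y) z ℂ) :
    -Hmin (G * Gᴴ) = Hmax (swapCut G * (swapCut G)ᴴ) := by
  have h := iInf_Dalpha_eq_iSup G one_pos le_rfl
  simp only [Dalpha_upperParam_one, Dalpha_lowerParam_one] at h
  rw [Hmin, Hmax, neg_neg, h, neg_iInf₂]

theorem trace_conj_swapCut (A B : Matrix (x × y) z ℂ) :
    ((swapCut A)ᴴ * swapCut B).trace = (Aᴴ * B).trace := by
  simp only [Matrix.trace, Matrix.diag_apply, Matrix.mul_apply, swapCut, Matrix.of_apply,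
    Matrix.conjTranspose_apply, Fintype.sum_prod_type]
  rw [Finset.sum_comm, Finset.sum_congr rfl fun i _ => Finset.sum_comm, Finset.sum_comm]

theorem trace_swapCut_mul_conj (G : Matrix (x × y) z ℂ) :
    (swapCut G * (swapCut G)ᴴ).trace = (G * Gᴴ).trace := by
  rw [Matrix.trace_mul_comm, trace_conj_swapCut, Matrix.trace_mul_comm]

theorem isState_swapCut {G : Matrix (x × y) z ℂ} (hG : IsState (G * Gᴴ)) :
    IsState (swapCut G * (swapCut G)ᴴ) :=
  ⟨Matrix.posSemidef_self_mul_conjTranspose _, by rw [trace_swapCut_mul_conj, hG.2]⟩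

/-- A substate close to one marginal of a pure state dominates the marginal of a vector whose
complementary marginal is as close to the complementary marginal of the pure state. -/
theorem exists_isClose_swapCut {G : Matrix (x × y) z ℂ} (hG : IsState (G * Gᴴ)) {ε : ℝ}
    {ω : Matrix (x × y) (x × y) ℂ} (hω : IsClose ε ω (G * Gᴴ)) :
    ∃ M : Matrix (x × y) z ℂ, M * Mᴴ ≤ ω ∧
      IsClose ε (swapCut M * (swapCut M)ᴴ) (swapCut G * (swapCut G)ᴴ) := by
  obtain ⟨M, hM, htr⟩ := exists_uhlmann hω.1.1 G
  refine ⟨M, hM, isClose_of_fidelity_le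
    ⟨Matrix.posSemidef_self_mul_conjTranspose _, ?_⟩ (isState_swapCut hG) hG hω ?_⟩
  · rw [trace_swapCut_mul_conj]
    exact (re_trace_le hM).trans hω.1.2
  -- The overlap of the two vectors does not depend on the cut. It equals the fidelity on one side
  -- and bounds it from below on the other.
  · rw [← htr, ← trace_conj_swapCut]
    exact re_trace_le_fidelity _ _

/-- Duality of the smooth min- and max-entropies. -/
theorem neg_HminSmooth_eq_HmaxSmooth [Nonempty y] [Nonempty z] {G : Matrix (x × y) z ℂ}
    (hG : IsState (G * Gᴴ)) (ε : ℝ) :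
    -HminSmooth ε (G * Gᴴ) = HmaxSmooth ε (swapCut G * (swapCut G)ᴴ) := by
  rw [HminSmooth, HmaxSmooth, neg_iSup₂]
  refine le_antisymm (le_iInf₂ fun ω hω => ?_) (le_iInf₂ fun ω hω => ?_)
  -- Domination of the marginal by `ω` suffices, since `Hmax` is increasing in the operator; the
  -- other direction uses the same for `-Hmin`.
  · obtain ⟨M, hM, hc⟩ := exists_isClose_swapCut (isState_swapCut hG) hω
    refine le_trans (iInf₂_le (f := fun ω (_ : IsClose ε ω _) => -Hmin ω) _ hc) ?_
    rw [neg_Hmin_eq_Hmax]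
    exact Hmax_mono (Matrix.posSemidef_self_mul_conjTranspose _) hM
  · obtain ⟨M, hM, hc⟩ := exists_isClose_swapCut hG hω
    refine le_trans (iInf₂_le (f := fun ω (_ : IsClose ε ω _) => Hmax ω) _ hc) ?_
    rw [← neg_Hmin_eq_Hmax]
    exact neg_Hmin_mono hM

/-! ### Smooth subalgebra entropies -/

theorem flipDilation_mul_conj_le {N : StarSubalgebra ℂ (Matrix a a ℂ)} {V : Matrix (a × e) a ℂ}
    (hV : IsStinespring N V) : flipDilation V * (flipDilation V)ᴴ ≤ 1 := by
  have := conj_mul_le_smul_one (L := (flipDilation V)ᴴ) zero_le_one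
    (by rw [Matrix.conjTranspose_conjTranspose, flipDilation_isometry hV, one_smul])
  rwa [Matrix.conjTranspose_conjTranspose, one_smul] at this

theorem trace_dilate {N : StarSubalgebra ℂ (Matrix a a ℂ)} {V : Matrix (a × e) a ℂ}
    (hV : IsStinespring N V) (X : Matrix a a ℂ) :
    (flipDilation V * X * (flipDilation V)ᴴ).trace = X.trace := by
  rw [Matrix.trace_mul_comm, ← Matrix.mul_assoc, flipDilation_isometry hV, Matrix.one_mul]

theorem isState_dilate {N : StarSubalgebra ℂ (Matrix a a ℂ)} {V : Matrix (a × e) a ℂ}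
    (hV : IsStinespring N V) {ρ : Matrix a a ℂ} (hρ : IsState ρ) :
    IsState (flipDilation V * ρ * (flipDilation V)ᴴ) :=
  ⟨hρ.1.mul_mul_conjTranspose_same _, by rw [trace_dilate hV, hρ.2]⟩

theorem isClose_dilate {N : StarSubalgebra ℂ (Matrix a a ℂ)} {V : Matrix (a × e) a ℂ}
    (hV : IsStinespring N V) {ρ : Matrix a a ℂ} (hρ : IsState ρ) {ε : ℝ} {ρ' : Matrix a a ℂ}
    (h : IsClose ε ρ' ρ) :
    IsClose ε (flipDilation V * ρ' * (flipDilation V)ᴴ)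
      (flipDilation V * ρ * (flipDilation V)ᴴ) := by
  have hS := isState_dilate hV hρ
  obtain ⟨K, rfl⟩ := exists_eq_mul_conj hρ.1
  rw [dilate_mul_conj] at hS ⊢
  refine isClose_of_fidelity_le ⟨h.1.1.mul_mul_conjTranspose_same _, ?_⟩ hS hρ h (le_of_eq ?_)
  · rw [trace_dilate hV]
    exact h.1.2
  · have : (flipDilation V * K)ᴴ * (flipDilation V * ρ' * (flipDilation V)ᴴ) *
        (flipDilation V * K) = Kᴴ * ρ' * K := by
      rw [Matrix.conjTranspose_mul]
      calc _ = Kᴴ * ((flipDilation V)ᴴ * flipDilation V) * ρ' *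
            ((flipDilation V)ᴴ * flipDilation V) * K := by simp only [Matrix.mul_assoc]
        _ = _ := by rw [flipDilation_isometry hV, Matrix.mul_one, Matrix.mul_one]
    rw [this]

/-- With `ρ = K K^*`, the fidelity sees `ω` only through `(W K)^* ω (W K)`, which also computes the
fidelity of `W^* ω W` with `ρ`. The trace does not grow because `W W^* ≤ 1`. -/
theorem isClose_compress {N : StarSubalgebra ℂ (Matrix a a ℂ)} {V : Matrix (a × e) a ℂ}
    (hV : IsStinespring N V) {ρ : Matrix a a ℂ} (hρ : IsState ρ) {ε : ℝ}
    {ω : Matrix (e × a) (e × a) ℂ}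
    (h : IsClose ε ω (flipDilation V * ρ * (flipDilation V)ᴴ)) :
    IsClose ε ((flipDilation V)ᴴ * ω * flipDilation V) ρ := by
  have hS := isState_dilate hV hρ
  obtain ⟨K, rfl⟩ := exists_eq_mul_conj hρ.1
  rw [dilate_mul_conj] at hS h
  refine isClose_of_fidelity_le ⟨h.1.1.conjTranspose_mul_mul_same _, ?_⟩ hρ hS h (le_of_eq ?_)
  · rw [Matrix.trace_mul_comm, ← Matrix.mul_assoc]
    refine (re_trace_mul_le (flipDilation_mul_conj_le hV) h.1.1).trans ?_
    rw [Matrix.one_mul]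
    exact h.1.2
  · have : (flipDilation V * K)ᴴ * ω * (flipDilation V * K) =
        Kᴴ * ((flipDilation V)ᴴ * ω * flipDilation V) * K := by
      rw [Matrix.conjTranspose_mul]
      simp only [Matrix.mul_assoc]
    rw [this]

/-- Conjugating `ω ≤ c (1 ⊗ σ)` by `W` gives `W^* ω W ≤ c 𝓔(σ)`. -/
theorem Dmax_compress_le {N : StarSubalgebra ℂ (Matrix a a ℂ)} {V : Matrix (a × e) a ℂ}
    (hV : IsStinespring N V) (ω : Matrix (e × a) (e × a) ℂ) (σ : Matrix a a ℂ) :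
    Dmax ((flipDilation V)ᴴ * ω * flipDilation V) (condExp N σ) ≤
      Dmax ω ((1 : Matrix e e ℂ) ⊗ₖ σ) := by
  rw [Dmax, Dmax, log2_le_log2]
  refine le_iInf₂ fun c hc => iInf₂_le c ⟨hc.1, ?_⟩
  have := hc.2.conjTranspose_mul_mul_same (flipDilation V)
  rwa [Matrix.mul_sub, Matrix.sub_mul, Matrix.mul_smul, Matrix.smul_mul, ← compress,
    compress_flipDilation hV] at this

/-- Compressing `ω` amounts to replacing `1 ⊗ σ` by `W σ W^*`. Since `W` intertwines `σ^{1/2} ∈ N`,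
the latter is at most `1 ⊗ σ`, and `Dmin` decreases in its second argument. -/
theorem Dmin_le_compress {N : StarSubalgebra ℂ (Matrix a a ℂ)} {V : Matrix (a × e) a ℂ}
    (hV : IsStinespring N V) {ω : Matrix (e × a) (e × a) ℂ} (hω : ω.PosSemidef)
    {σ : Matrix a a ℂ} (hσ : σ.PosSemidef) (hσN : σ ∈ N) :
    Dmin ω ((1 : Matrix e e ℂ) ⊗ₖ σ) ≤ Dmin ((flipDilation V)ᴴ * ω * flipDilation V) σ := by
  set W := flipDilation V with hW
  set J := matPow σ (1 / 2) with hJ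
  have hJN : J ∈ N := cfc_mem_starSubalgebra N hσ.isHermitian hσN _
  have hJh : Jᴴ = J := (isHermitian_matPow _ _).eq
  have hJJ : J * Jᴴ = σ := by rw [hJh, sqrt_mul_sqrt hσ]
  have h1 : Dmin (Wᴴ * ω * W) σ = Dmin ω ((W * J) * (W * J)ᴴ) := by
    rw [← neg_inj, neg_Dmin_eq hω, ← hJJ, neg_Dmin_eq (hω.conjTranspose_mul_mul_same W),
      Matrix.conjTranspose_mul]
    simp only [Matrix.mul_assoc]
  rw [h1]
  refine Dmin_anti_right hω (Matrix.posSemidef_self_mul_conjTranspose _) ?_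
  have h2 := conj_mul_le (flipDilation_mul_conj_le hV) ((1 : Matrix e e ℂ) ⊗ₖ J)
  have h3 : ((1 : Matrix e e ℂ) ⊗ₖ J) * (W * Wᴴ) * ((1 : Matrix e e ℂ) ⊗ₖ J)ᴴ =
      (W * J) * (W * J)ᴴ := by
    rw [← one_kronecker_mul_flipDilation hV hJN, ← hW, Matrix.conjTranspose_mul]
    simp only [Matrix.mul_assoc]
  rw [← hW, h3, Matrix.mul_one, Matrix.conjTranspose_kronecker, Matrix.conjTranspose_one,
    ← Matrix.mul_kronecker_mul, Matrix.one_mul, hJJ] at h2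
  exact h2

theorem infState_Dmax [Nonempty a] {N : StarSubalgebra ℂ (Matrix a a ℂ)} {V : Matrix (a × e) a ℂ}
    (hV : IsStinespring N V) {ρ : Matrix a a ℂ} (hρ : ρ.PosSemidef) :
    infState Dmax ρ N = -Hmin (flipDilation V * ρ * (flipDilation V)ᴴ) := by
  have h := DalphaSub_upperParam hV hρ one_pos le_rfl
  simp only [DalphaSub, infState, Dalpha_upperParam_one] at h
  rw [Hmin, neg_neg, infState, h]

theorem infState_Dmin {N : StarSubalgebra ℂ (Matrix a a ℂ)} {V : Matrix (a × e) a ℂ}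
    (hV : IsStinespring N V) {ρ : Matrix a a ℂ} (hρ : ρ.PosSemidef) :
    infState Dmin ρ N = -Hmax (flipDilation V * ρ * (flipDilation V)ᴴ) := by
  have h := DalphaSub_lowerParam hV hρ one_pos le_rfl
  simp only [DalphaSub, infState, Dalpha_lowerParam_one] at h
  rw [Hmax, neg_neg, infState, h]

/-- Dilating a nearby substate preserves the value, and compressing one does not increase it. -/
theorem DmaxSub_eq_neg_HminSmooth [Nonempty a] {N : StarSubalgebra ℂ (Matrix a a ℂ)}
    {V : Matrix (a × e) a ℂ} (hV : IsStinespring N V) {ρ : Matrix a a ℂ} (hρ : IsState ρ) (ε : ℝ) :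
    DmaxSub ε ρ N = -HminSmooth ε (flipDilation V * ρ * (flipDilation V)ᴴ) := by
  rw [DmaxSub, HminSmooth, neg_iSup₂]
  refine le_antisymm (le_iInf₂ fun ω hω => ?_) (le_iInf₂ fun ρ' hρ' => ?_)
  · refine le_trans (iInf₂_le (f := fun ω (_ : IsClose ε ω _) => infState Dmax ω N) _
      (isClose_compress hV hρ hω)) ?_
    rw [Hmin, neg_neg]
    exact le_iInf₂ fun σ hσ => (iInf₂_le (condExp N σ)
      ⟨isState_condExp hV hσ, condExp_mem N σ⟩).trans (Dmax_compress_le hV ω σ)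
  · rw [infState_Dmax hV hρ'.1.1]
    exact iInf₂_le (f := fun ω (_ : IsClose ε ω _) => -Hmin ω) _ (isClose_dilate hV hρ hρ')

theorem DminSub_eq_neg_HmaxSmooth {N : StarSubalgebra ℂ (Matrix a a ℂ)}
    {V : Matrix (a × e) a ℂ} (hV : IsStinespring N V) {ρ : Matrix a a ℂ} (hρ : IsState ρ) (ε : ℝ) :
    DminSub ε ρ N = -HmaxSmooth ε (flipDilation V * ρ * (flipDilation V)ᴴ) := by
  rw [DminSub, HmaxSmooth, neg_iInf₂]
  refine le_antisymm (iSup₂_le fun ρ' hρ' => ?_) (iSup₂_le fun ω hω => ?_)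
  · rw [infState_Dmin hV hρ'.1.1]
    exact le_iSup₂ (f := fun ω (_ : IsClose ε ω _) => -Hmax ω) _ (isClose_dilate hV hρ hρ')
  · refine le_trans ?_ (le_iSup₂ (f := fun ω (_ : IsClose ε ω _) => infState Dmin ω N) _
      (isClose_compress hV hρ hω))
    rw [Hmax, neg_neg]
    exact le_iInf₂ fun σ hσ => (iInf₂_le σ hσ.1).trans
      (Dmin_le_compress hV hω.1.1 hσ.1.1 hσ.2)

/-! ### The dilated state and its marginals -/

/-- A vector of `ℂ^a ⊗ ℂ^f` as a matrix. -/
def vecMatrix (ψ : a × f → ℂ) : Matrix a f ℂ := Matrix.of fun i j => ψ (i, j)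

theorem traceSnd_ketBra (φ : a × f → ℂ) : traceSnd (ketBra φ) = vecMatrix φ * (vecMatrix φ)ᴴ := by
  ext i j
  simp [traceSnd, ketBra, vecMatrix, Matrix.mul_apply, Matrix.vecMulVec_apply]

theorem dilatedState_eq_ketBra (V : Matrix (a × e) a ℂ) (ψ : a × f → ℂ) :
    dilatedState V ψ = ketBra ((V ⊗ₖ (1 : Matrix f f ℂ)) *ᵥ ψ) := by
  rw [dilatedState, ketBra, ketBra, Matrix.mul_vecMulVec, Matrix.vecMulVec_mul, Matrix.star_mulVec]

theorem vecMatrix_dilate (V : Matrix (a × e) a ℂ) (ψ : a × f → ℂ) :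
    vecMatrix ((V ⊗ₖ (1 : Matrix f f ℂ)) *ᵥ ψ) = V * vecMatrix ψ := by
  ext p k
  simp [vecMatrix, Matrix.mulVec, dotProduct, Matrix.mul_apply, Fintype.sum_prod_type,
    Matrix.one_apply]

theorem traceSnd_dilatedState (V : Matrix (a × e) a ℂ) (ψ : a × f → ℂ) :
    traceSnd (dilatedState V ψ) = V * (vecMatrix ψ * (vecMatrix ψ)ᴴ) * Vᴴ := by
  rw [dilatedState_eq_ketBra, traceSnd_ketBra, vecMatrix_dilate, Matrix.conjTranspose_mul]
  simp only [Matrix.mul_assoc]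

theorem marginalEA_dilatedState (V : Matrix (a × e) a ℂ) (ψ : a × f → ℂ) :
    marginalEA (dilatedState V ψ) =
      (flipDilation V * vecMatrix ψ) * (flipDilation V * vecMatrix ψ)ᴴ := by
  rw [marginalEA, traceSnd_dilatedState, ← dilate_mul_conj, flipDilation_conj]

theorem marginalEF_dilatedState (V : Matrix (a × e) a ℂ) (ψ : a × f → ℂ) :
    marginalEF (dilatedState V ψ) = swapCut (flipDilation V * vecMatrix ψ) *
      (swapCut (flipDilation V * vecMatrix ψ))ᴴ := by
  have h : ∀ p k, ((V ⊗ₖ (1 : Matrix f f ℂ)) *ᵥ ψ) (p, k) = (V * vecMatrix ψ) p k := fun p k => by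
    rw [← vecMatrix_dilate]
    rfl
  rw [dilatedState_eq_ketBra]
  ext p q
  simp only [marginalEF, traceFst, ketBra, Matrix.of_apply, Matrix.submatrix_apply,
    Matrix.vecMulVec_apply, Pi.star_apply, Equiv.prodAssoc_symm_apply, h, Matrix.mul_apply,
    Matrix.conjTranspose_apply, swapCut, flipDilation, id_eq, Prod.swap_prod_mk]

/-! ### Pairs of dual Rényi parameters -/

theorem neg_Halpha_eq {s : ℝ} {G : Matrix (x × y) z ℂ} [Nonempty y] [Nonempty z] (hs : 0 < s)
    (hs1 : s ≤ 1) :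
    -Halpha (upperParam s) (G * Gᴴ) = Halpha (lowerParam s) (swapCut G * (swapCut G)ᴴ) := by
  have h1 : upperParam s ≠ 1 := by
    rw [upperParam, ne_eq, ENNReal.inv_eq_one, ENNReal.ofReal_eq_one]
    linarith
  have h2 : lowerParam s ≠ 1 := by
    rw [lowerParam, ne_eq, ENNReal.inv_eq_one, ENNReal.ofReal_eq_one]
    linarith
  rw [Halpha, Halpha, if_neg h1, if_neg h2, neg_iSup₂]
  simp only [neg_neg]
  exact iInf_Dalpha_eq_iSup G hs hs1

theorem neg_Halpha_of_ne_one {α : ℝ≥0∞} (hα : α ≠ 1) (ω : Matrix (x × y) (x × y) ℂ) :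
    -Halpha α ω =
      ⨅ (σ : Matrix y y ℂ) (_ : IsState σ), Dalpha α ω ((1 : Matrix x x ℂ) ⊗ₖ σ) := by
  rw [Halpha, if_neg hα, neg_iSup₂]
  simp only [neg_neg]

theorem exists_param {α β : ℝ≥0∞} (hα : 1 < α) (h : 1 / α + 1 / β = 2) :
    ∃ s : ℝ, 0 < s ∧ s ≤ 1 ∧ α = upperParam s ∧ β = lowerParam s := by
  rw [one_div, one_div] at h
  have hi : α⁻¹ < 1 := ENNReal.inv_lt_one.mpr hα
  have hi' : α⁻¹ ≠ ⊤ := hi.ne_top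
  have hr : (α⁻¹).toReal < 1 := by
    rw [← ENNReal.toReal_one]
    exact (ENNReal.toReal_lt_toReal hi' ENNReal.one_ne_top).mpr hi
  have hβ : β⁻¹ ≠ ⊤ := fun h' => by
    rw [h', add_top] at h
    exact absurd h (by norm_num)
  refine ⟨1 - (α⁻¹).toReal, by linarith, by linarith [ENNReal.toReal_nonneg (a := α⁻¹)], ?_, ?_⟩
  · rw [upperParam, sub_sub_cancel, ENNReal.ofReal_toReal hi', inv_inv]
  · have h2 : (β⁻¹).toReal = 1 + (1 - (α⁻¹).toReal) := by
      have := congrArg ENNReal.toReal h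
      rw [ENNReal.toReal_add hi' hβ, ENNReal.toReal_ofNat] at this
      linarith
    rw [lowerParam, ← h2, ENNReal.ofReal_toReal hβ, inv_inv]

theorem trichotomy_param {α β : ℝ≥0∞} (h : 1 / α + 1 / β = 2) :
    (α = 1 ∧ β = 1) ∨ 1 < α ∨ 1 < β := by
  by_contra! hcon
  obtain ⟨h1, h2, h3⟩ := hcon
  rw [one_div, one_div] at h
  have hα : 1 ≤ α⁻¹ := ENNReal.one_le_inv.mpr h2
  have hβ : 1 ≤ β⁻¹ := ENNReal.one_le_inv.mpr h3
  have hne : ∀ u v : ℝ≥0∞, 1 ≤ u → 1 ≤ v → u + v = 2 → u = 1 := by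
    intro u v hu hv huv
    refine le_antisymm ?_ hu
    by_contra! hlt
    have : (1 : ℝ≥0∞) + 1 < u + v := ENNReal.add_lt_add_of_lt_of_le ENNReal.one_ne_top hlt hv
    rw [huv, one_add_one_eq_two] at this
    exact lt_irrefl _ this
  have e1 : α = 1 := ENNReal.inv_eq_one.mp (hne _ _ hα hβ h)
  have e2 : β = 1 := ENNReal.inv_eq_one.mp (hne _ _ hβ hα (by rwa [add_comm]))
  exact h1 e1 e2

end SubalgebraEntropy

/-! ### The main theorem -/

theorem mainTheorem3 {a e f : Type*} [Fintype a] [DecidableEq a] [Fintype e] [DecidableEq e]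
    [Fintype f] [DecidableEq f]
    (N : StarSubalgebra ℂ (Matrix a a ℂ))
    (V : Matrix (a × e) a ℂ) (hV : IsStinespring N V)
    (ρ : Matrix a a ℂ) (hρ : IsState ρ)
    (ψ : a × f → ℂ) (hψ : IsPurification (ketBra ψ) ρ) :
    IsPurification (dilatedState V ψ) (V * ρ * V.conjTranspose) ∧
    (∀ ε : ℝ, 0 ≤ ε → ε < 1 →
      DmaxSub ε ρ N = -HminSmooth ε (marginalEA (dilatedState V ψ)) ∧
      DmaxSub ε ρ N = HmaxSmooth ε (marginalEF (dilatedState V ψ)) ∧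
      DminSub ε ρ N = -HmaxSmooth ε (marginalEA (dilatedState V ψ)) ∧
      DminSub ε ρ N = HminSmooth ε (marginalEF (dilatedState V ψ))) ∧
    (∀ α β : ℝ≥0∞, 1 / 2 ≤ α → 1 / α + 1 / β = 2 →
      DalphaSub α ρ N = -Halpha α (marginalEA (dilatedState V ψ)) ∧
      DalphaSub α ρ N = Halpha β (marginalEF (dilatedState V ψ))) := by
  have hΨ : vecMatrix ψ * (vecMatrix ψ).conjTranspose = ρ := by
    rw [← traceSnd_ketBra]
    exact hψ.2
  have ha : Nonempty a := by
    by_contra h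
    rw [not_nonempty_iff] at h
    have := hρ.2
    simp [Matrix.trace] at this
  have hf : Nonempty f := by
    by_contra h
    rw [not_nonempty_iff] at h
    have h0 : ρ = 0 := by
      rw [← hΨ]
      ext i j
      simp [Matrix.mul_apply]
    have := hρ.2
    simp [h0] at this
  set G := flipDilation V * vecMatrix ψ with hG
  have hEA : flipDilation V * ρ * (flipDilation V).conjTranspose = G * G.conjTranspose := by
    rw [← hΨ, dilate_mul_conj]
  have hGS : IsState (G * G.conjTranspose) := hEA ▸ isState_dilate hV hρ
  refine ⟨⟨⟨_, dilatedState_eq_ketBra V ψ⟩, by rw [traceSnd_dilatedState, hΨ]⟩,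
    fun ε _ _ => ?_, fun α β _ hαβ => ?_⟩
  · rw [marginalEA_dilatedState, marginalEF_dilatedState, ← hG]
    have h1 := DmaxSub_eq_neg_HminSmooth hV hρ ε
    have h2 := DminSub_eq_neg_HmaxSmooth hV hρ ε
    rw [hEA] at h1 h2
    -- Duality is used for both orders of the complementary systems, since cutting twice returns
    -- `G`.
    have h3 := neg_HminSmooth_eq_HmaxSmooth hGS ε
    have h4 := neg_HminSmooth_eq_HmaxSmooth (isState_swapCut hGS) ε
    rw [swapCut_swapCut] at h4
    exact ⟨h1, h1.trans h3, h2, by rw [h2, ← h4, neg_neg]⟩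
  · rw [marginalEA_dilatedState, marginalEF_dilatedState, ← hG]
    suffices h : DalphaSub α ρ N = -Halpha α (G * G.conjTranspose) ∧
        -Halpha α (G * G.conjTranspose) =
          Halpha β (swapCut G * (swapCut G).conjTranspose) from ⟨h.1, h.1.trans h.2⟩
    rcases trichotomy_param hαβ with ⟨rfl, rfl⟩ | hα | hβ
    · refine ⟨?_, Halpha_one_dual G⟩
      -- The isometry does not change the nonzero spectrum of `ρ`.
      have hvn : vnEntropy (G * G.conjTranspose) = vnEntropy ρ := by
        rw [vnEntropy_mul_conj, ← hΨ, vnEntropy_mul_conj, hG, Matrix.conjTranspose_mul,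
          Matrix.mul_assoc, ← Matrix.mul_assoc (flipDilation V).conjTranspose,
          flipDilation_isometry hV, Matrix.one_mul]
      rw [DalphaSub_one hV hρ, condExp_eq_traceFst hV, Halpha, if_pos rfl, hvn, hEA,
        ← EReal.coe_neg, neg_sub]
    · obtain ⟨s, hs, hs1, rfl, rfl⟩ := exists_param hα hαβ
      refine ⟨?_, neg_Halpha_eq hs hs1⟩
      rw [neg_Halpha_of_ne_one hα.ne', DalphaSub_upperParam hV hρ.1 hs hs1, hEA]
    -- Here `α` is the parameter below `1`, so duality is applied to the swapped cut.
    · obtain ⟨s, hs, hs1, rfl, rfl⟩ := exists_param hβ (by rwa [add_comm])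
      have hne : lowerParam s ≠ 1 := by
        rw [lowerParam, ne_eq, ENNReal.inv_eq_one, ENNReal.ofReal_eq_one]
        linarith
      refine ⟨?_, ?_⟩
      · rw [neg_Halpha_of_ne_one hne, DalphaSub_lowerParam hV hρ.1 hs hs1, hEA]
      · have h := neg_Halpha_eq (G := swapCut G) hs hs1
        rw [swapCut_swapCut] at h
        rw [← h, neg_neg]
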